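/- Let $\mathrm{Pin}^-_n\subset C\ell_{-n}(\mathbb R)$ be the pin group of the Clifford algebra with $e_i^2=-1$, with its double covering $\rho\colon\mathrm{Pin}^-_n\to O_n$. A pin$^-$ structure on a manifold is a reduction of the structure group of the frame bundle of its tangent bundle to $\mathrm{Pin}^-_n$ along $\rho$; on 1-manifolds, maps of pin$^-$ structures have to respect frames up to positive scale (i.e. up to the choice of a Riemannian metric). Let $S^1_b$ be the bounding pin$^-$ circle, the boundary of a pin$^-$ disc $D^2$, and let $S^1_{nb}$ be the non-bounding pin$^-$ circle, the circle with the pin$^-$ structure induced by its Lie group framing. Fix a pin$^-$ point $\mathrm{pt}$. A relative pin$^-$ structure on $[0,1]$ is a pin$^-$ structure on $[0,1]$ with isomorphisms of its restrictions to the two endpoints with $\mathrm{pt}$ (compatible with the direction of $[0,1]$); two are equivalent if they are isomorphic by a pin$^-$ diffeomorphism covering the identity and respecting the isomorphisms with $\mathrm{pt}$. Gluing the endpoints through these isomorphisms gives a pin$^-$ circle $[0,1]/\{0,1\}$. We say that a relative pin$^-$ structure is equivalent to $I_0$ if this circle is pin$^-$ diffeomorphic to $S^1_{nb}$, and to $I_1$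 if it is pin$^-$ diffeomorphic to $S^1_b$. (1) Any two relative pin$^-$ structures on the interval can be concatenated (gluing through $\mathrm{pt}$ and rescaling), and concatenation defines a group structure on the set of equivalence classes. This group is isomorphic to $\mathbb Z/2$, by an isomorphism under which the class of a relative structure is $0$ if and only if the structure is equivalent to $I_0$, and $1$ if and only if it is equivalent to $I_1$. In particular, $I_0$ is the identity and $I_1$ is the generator. (2) Let $M$ be an oriented pin$^-$ circle (i.e. a smooth manifold diffeomorphic to $S^1$, with an orientation and a pin$^-$ structure) with a simplicial structure with $n\ge 1$ edges, and fix an isomorphism with $\mathrm{pt}$, compatible with the orientation, of the pin$^-$ structure at every vertex. Then $M$ is not pin$^-$ diffeomorphic to both $S^1_b$ and $S^1_{nb}$. For every edge $e$ there is exactly one $t(e)\in\{0,1\}=\mathbb Z/2$ such that the relative pin$^-$ structure on $\overline e$ induced by $M$, with $\overline e$ parametrised along the orientation, is equivalent to $I_{t(e)}$. Let $m$ be the number of edges $e$ with $t(e)=1$. If $m$ is odd, then $M\cong S^1_b$. If $m$ is even, then $M\cong S^1_{nb}$. Here $\cong$ means pin$^-$ diffeomorphic. -/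

import Mathlib

open scoped Manifold ContDiff
open Bundle

noncomputable section

/-! ### The groups `Pin⁻ₙ` -/

/-- The quadratic form `v ↦ -(v₁² + ⋯ + vₙ²)` on `ℝⁿ`. -/
abbrev negForm (n : ℕ) : QuadraticForm ℝ (Fin n → ℝ) :=
  QuadraticMap.weightedSumSquares ℝ (fun _ : Fin n => (-1 : ℝ))

/-- The real Clifford algebra `Cℓ₋ₙ`, generated by `e₁, …, eₙ` with `eᵢ² = -1`,
`eᵢ eⱼ = - eⱼ eᵢ`. -/
abbrev ClMinus (n : ℕ) : Type := CliffordAlgebra (negForm n)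

/-- The canonical topology of the finite-dimensional real vector space `Cℓ₋ₙ`. -/
instance instTopologicalSpaceClMinus (n : ℕ) : TopologicalSpace (ClMinus n) :=
  moduleTopology ℝ (ClMinus n)

/-- The Lie group `Pin⁻ₙ ⊂ Cℓ₋ₙ` (for `n ≥ 1`), with the subspace topology. -/
abbrev PinMinus (n : ℕ) : Type := pinGroup (negForm n)

namespace PinMinus

theorem exists_rho {n : ℕ} (g : PinMinus n) (v : Fin n → ℝ) :
    ∃ w : Fin n → ℝ, CliffordAlgebra.ι (negForm n) w =
      CliffordAlgebra.involute (g : ClMinus n) * CliffordAlgebra.ι (negForm n) v *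
        ((g⁻¹ : PinMinus n) : ClMinus n) :=
  pinGroup.involute_act_ι_mem_range_ι (x := pinGroup.toUnits g) g.2 v

/-- The double covering `ρ : Pin⁻ₙ → Oₙ`, as an action on vectors:
`ρ(g) v = α(g) v g⁻¹`, with `α` the grading operator. -/
def rho {n : ℕ} (g : PinMinus n) (v : Fin n → ℝ) : Fin n → ℝ :=
  Classical.choose (exists_rho g v)

theorem ι_rho {n : ℕ} (g : PinMinus n) (v : Fin n → ℝ) :
    CliffordAlgebra.ι (negForm n) (rho g v) =
      CliffordAlgebra.involute (g : ClMinus n) * CliffordAlgebra.ι (negForm n) v *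
        ((g⁻¹ : PinMinus n) : ClMinus n) :=
  Classical.choose_spec (exists_rho g v)

/-- The isometric inclusion `ℝ → ℝ²`, `x ↦ (0, x)`. -/
def secondAxis : negForm 1 →qᵢ negForm 2 where
  toFun v := ![0, v 0]
  map_add' v w := by ext i; fin_cases i <;> simp
  map_smul' c v := by ext i; fin_cases i <;> simp
  map_app' v := by
    simp [QuadraticMap.weightedSumSquares_apply, Fin.sum_univ_two]

theorem map_mem {m n : ℕ} (f : negForm m →qᵢ negForm n) (g : PinMinus m) :
    CliffordAlgebra.map f (g : ClMinus m) ∈ pinGroup (negForm n) := by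
  obtain ⟨x, hx, hxg⟩ := g.2.1
  refine ⟨⟨Units.map (CliffordAlgebra.map f : ClMinus m →* ClMinus n) x, ?_, ?_⟩, ?_⟩
  · have hle : lipschitzGroup (negForm m) ≤ (lipschitzGroup (negForm n)).comap
        (Units.map (CliffordAlgebra.map f : ClMinus m →* ClMinus n)) := by
      refine (Subgroup.closure_le _).2 ?_
      rintro y ⟨v, hv⟩
      refine Subgroup.subset_closure ⟨f v, ?_⟩
      rw [← CliffordAlgebra.map_apply_ι, hv]
      rfl
    exact hle hx
  · rw [← hxg]
    rfl
  · have hstar : ∀ a : ClMinus m, star (CliffordAlgebra.map f a) =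
        CliffordAlgebra.map f (star a) := by
      intro a
      induction a using CliffordAlgebra.induction with
      | algebraMap r => simp [CliffordAlgebra.star_algebraMap]
      | ι v => simp [CliffordAlgebra.star_ι]
      | mul a b ha hb => simp [ha, hb]
      | add a b ha hb => simp [ha, hb]
    refine Unitary.mem_iff.2 ⟨?_, ?_⟩
    · rw [hstar, ← map_mul, pinGroup.star_mul_self_of_mem g.2, map_one]
    · rw [hstar, ← map_mul, pinGroup.mul_star_self_of_mem g.2, map_one]

/-- The inclusion `Pin⁻₁ → Pin⁻₂` induced by `ℝ → ℝ²`, `x ↦ (0, x)`. -/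
def incl (g : PinMinus 1) : PinMinus 2 :=
  ⟨CliffordAlgebra.map secondAxis (g : ClMinus 1), map_mem secondAxis g⟩

end PinMinus

/-! ### Pin⁻ structures -/

/-- A pin⁻ structure on a rank `n` real vector bundle `E → B` (`n ≥ 1`): a principal `Pin⁻ₙ`-bundle
`Total → B` together with a continuous map over `B` from `Total` to the bundle of frames of `E`,
equivariant along `ρ : Pin⁻ₙ → Oₙ ⊂ GLₙ(ℝ)`; that is, a reduction of the structure group of the
frame bundle of `E` to `Pin⁻ₙ`. A frame of `E x` is a linear isomorphism `ℝⁿ ≃ E x`. -/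
structure PinMinusStructure (n : ℕ) {B : Type} [TopologicalSpace B]
    (F : Type) (E : B → Type) [∀ x, AddCommGroup (E x)] [∀ x, Module ℝ (E x)]
    [TopologicalSpace (TotalSpace F E)] where
  /-- The total space of the principal bundle. -/
  Total : Type
  [top : TopologicalSpace Total]
  /-- The right action of `Pin⁻ₙ`, as a left action of the opposite group. -/
  [act : MulAction (PinMinus n)ᵐᵒᵖ Total]
  /-- The projection of the principal bundle. -/
  proj : Total → B
  locally_trivial : ∀ x : B, ∃ U : Set B, IsOpen U ∧ x ∈ U ∧
    ∃ h : U × PinMinus n ≃ₜ proj ⁻¹' U,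
      (∀ p, proj (h p) = p.1) ∧
      ∀ (u : U) (g g' : PinMinus n),
        (h (u, g * g') : Total) = MulOpposite.op g' • (h (u, g) : Total)
  /-- The frame underlying a point of the principal bundle. -/
  frame : ∀ q : Total, (Fin n → ℝ) ≃ₗ[ℝ] E (proj q)
  continuous_frame : ∀ v : Fin n → ℝ,
    Continuous fun q => (⟨proj q, frame q v⟩ : TotalSpace F E)
  frame_smul : ∀ (q : Total) (g : PinMinus n) (v : Fin n → ℝ),
    (⟨proj (MulOpposite.op g • q), frame (MulOpposite.op g • q) v⟩ : TotalSpace F E) =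
      ⟨proj q, frame q (PinMinus.rho g v)⟩

attribute [instance] PinMinusStructure.top PinMinusStructure.act

section OneManifolds

variable {H H' M M' : Type}
  [TopologicalSpace H] [TopologicalSpace H'] [TopologicalSpace M] [TopologicalSpace M']

/-- A (tangential) pin⁻ structure on a 1-manifold `M`, possibly with boundary. -/
abbrev PinMinus1 (I : ModelWithCorners ℝ (EuclideanSpace ℝ (Fin 1)) H) (M : Type)
    [TopologicalSpace M] [ChartedSpace H M] [IsManifold I 1 M] : Type 1 :=
  PinMinusStructure 1 (EuclideanSpace ℝ (Fin 1)) (fun x : M => TangentSpace I x)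

variable {I : ModelWithCorners ℝ (EuclideanSpace ℝ (Fin 1)) H}
  {I' : ModelWithCorners ℝ (EuclideanSpace ℝ (Fin 1)) H'}
  [ChartedSpace H M] [IsManifold I 1 M] [ChartedSpace H' M'] [IsManifold I' 1 M']

/-- Two tangent vectors at the same point which are positive multiples of each other. -/
def SameDirection (w w' : TangentBundle I M) : Prop :=
  ∃ c : ℝ, 0 < c ∧ w' = ⟨w.proj, c • w.snd⟩

namespace PinMinusStructure

/-- A frame of a tangent line is the same as a nonzero tangent vector. -/
def tangent (P : PinMinus1 I M) (q : P.Total) : TangentBundle I M :=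
  ⟨P.proj q, P.frame q (fun _ => 1)⟩

/-- `j` is a map of pin⁻ structures covering the immersion `f : M → M'`: a continuous
`Pin⁻₁`-equivariant map covering `f`, compatible with the frames through the differential of `f`.
As frames are not required to be orthonormal for a fixed metric, they are compared up to positive
scale, i.e. up to the contractible choice of a Riemannian metric. -/
structure IsPinMap (P : PinMinus1 I M) (P' : PinMinus1 I' M') (f : M → M')
    (j : P.Total → P'.Total) : Prop where
  continuous : Continuous j
  proj : ∀ q, P'.proj (j q) = f (P.proj q)
  equivariant : ∀ (q : P.Total) (g : PinMinus 1),
    j (MulOpposite.op g • q) = MulOpposite.op g • j q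
  frame : ∀ q, SameDirection (tangentMap I I' f (P.tangent q)) (P'.tangent (j q))

/-- Existence of a pin⁻ diffeomorphism `M ≅ M'`. -/
def PinDiffeomorphic (P : PinMinus1 I M) (P' : PinMinus1 I' M') : Prop :=
  ∃ (f : M ≃ₘ⟮I, I'⟯ M') (j : P.Total ≃ₜ P'.Total), IsPinMap P P' f j

end PinMinusStructure

end OneManifolds

/-! ### The bounding and the non-bounding pin⁻ circle -/

/-- A pin⁻ structure on the closed unit disc `D² ⊂ ℂ`, with tangent bundle `D² × ℂ`. -/
abbrev PinMinusDisc : Type 1 :=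
  PinMinusStructure 2 ℂ (Bundle.Trivial (Metric.closedBall (0 : ℂ) 1) ℂ)

/-- The pin⁻ structure `C` on the circle is the boundary of the pin⁻ structure `D` on the disc:
`C` is the reduction of `D|_{∂D²}` to `Pin⁻₁ ⊂ Pin⁻₂` consisting of the points whose
frame is given by an outward pointing vector followed by a vector tangent to the circle. -/
def IsBoundaryOfDisc (C : PinMinus1 (𝓡 1) Circle) (D : PinMinusDisc) : Prop :=
  ∃ j : C.Total → D.Total, Continuous j ∧
    (∀ q, ((D.proj (j q) : Metric.closedBall (0 : ℂ) 1) : ℂ) = C.proj q) ∧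
    (∀ (q : C.Total) (g : PinMinus 1),
      j (MulOpposite.op g • q) = MulOpposite.op (PinMinus.incl g) • j q) ∧
    ∀ q,
      0 < inner ℝ (C.proj q : ℂ) (D.frame (j q) ![1, 0] : ℂ) ∧
      ∃ c : ℝ, 0 < c ∧ (D.frame (j q) ![0, 1] : ℂ) =
        c • (mfderiv (𝓡 1) 𝓘(ℝ, ℂ) (fun z : Circle => (z : ℂ)) (C.proj q) (C.frame q (fun _ => 1)) : ℂ)

/-- The pin⁻ structure `C` is induced by a left-invariant framing of the Lie group `Circle`: the
framing lifts to a section of the principal bundle. -/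
def IsLieFramed (C : PinMinus1 (𝓡 1) Circle) : Prop :=
  ∃ v : GroupLieAlgebra (𝓡 1) Circle, v ≠ 0 ∧
    ∃ s : Circle → C.Total, Continuous s ∧
      ∀ z, C.tangent (s z) = ⟨z, mulInvariantVectorField (I := 𝓡 1) v z⟩

namespace PinMinusStructure

section

variable {M : Type} [TopologicalSpace M] [ChartedSpace (EuclideanSpace ℝ (Fin 1)) M]
  [IsManifold (𝓡 1) 1 M]

/-- `M` is (pin⁻ diffeomorphic to) the bounding circle `S¹_b`, the boundary of a pin⁻ disc. -/
def IsBoundingCircle (P : PinMinus1 (𝓡 1) M) : Prop :=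
  ∃ (C : PinMinus1 (𝓡 1) Circle) (D : PinMinusDisc),
    IsBoundaryOfDisc C D ∧ P.PinDiffeomorphic C

/-- `M` is (pin⁻ diffeomorphic to) the non-bounding circle `S¹_nb`, i.e. the circle with the
pin⁻ structure induced by its Lie group framing. -/
def IsNonboundingCircle (P : PinMinus1 (𝓡 1) M) : Prop :=
  ∃ C : PinMinus1 (𝓡 1) Circle, IsLieFramed C ∧ P.PinDiffeomorphic C

end

end PinMinusStructure

/-! ### Relative pin⁻ structures on the interval -/

/-- A relative pin⁻ structure on `[0, 1]`. The pin⁻ point `pt` is stabilised to the trivial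
`Pin⁻₁`-torsor over the line `ℝ`; the lines `T₀[0, 1]` and `T₁[0, 1]` are identified with `ℝ` using
the direction of increasing parameter. An isomorphism of `pt` with an endpoint is then
the same as the image of `1 ∈ Pin⁻₁`, a point of the fibre with positively oriented frame. -/
structure RelPinInterval where
  /-- The pin⁻ structure on the interval. -/
  pin : PinMinus1 (𝓡∂ 1) unitInterval
  /-- The identification with `pt` at `0`. -/
  left : pin.Total
  /-- The identification with `pt` at `1`. -/
  right : pin.Total
  left_dir : SameDirection ⟨0, oneTangentSpaceIcc 0⟩ (pin.tangent left)
  right_dir : SameDirection ⟨1, oneTangentSpaceIcc 1⟩ (pin.tangent right)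

namespace RelPinInterval

/-- Equivalence of relative pin⁻ structures: a pin⁻ diffeomorphism covering the identity and
respecting the identifications of the endpoints with `pt`. -/
def Equivalent (r r' : RelPinInterval) : Prop :=
  ∃ j : r.pin.Total ≃ₜ r'.pin.Total, r.pin.IsPinMap r'.pin id j ∧
    j r.left = r'.left ∧ j r.right = r'.right

instance instSetoidRelPinInterval : Setoid RelPinInterval where
  r := Equivalent
  iseqv := by
    refine ⟨fun r => ⟨Homeomorph.refl _, ⟨continuous_id, fun _ => rfl, fun _ _ => rfl,
      fun q => ⟨1, one_pos, ?_⟩⟩, rfl, rfl⟩, ?_, ?_⟩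
    · rw [tangentMap_id]
      simp
    · rintro r r' ⟨j, hj, hl, hr⟩
      refine ⟨j.symm, ⟨j.symm.continuous, fun q => ?_, fun q g => ?_, fun q => ?_⟩,
        by simp [← hl], by simp [← hr]⟩
      · simpa using (hj.proj (j.symm q)).symm
      · apply j.injective
        rw [hj.equivariant]
        simp
      · obtain ⟨c, hc, h⟩ := hj.frame (j.symm q)
        refine ⟨c⁻¹, inv_pos.2 hc, ?_⟩
        rw [tangentMap_id] at h ⊢
        simp only [id, Homeomorph.apply_symm_apply] at h ⊢
        rw [h]
        simp [smul_smul, inv_mul_cancel₀ hc.ne']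
    · rintro r r' r'' ⟨j, hj, hl, hr⟩ ⟨k, hk, hl', hr'⟩
      refine ⟨j.trans k, ⟨(j.trans k).continuous, fun q => ?_, fun q g => ?_, fun q => ?_⟩,
        by simp [hl, hl'], by simp [hr, hr']⟩
      · simp [hk.proj, hj.proj]
      · simp [hk.equivariant, hj.equivariant]
      · obtain ⟨c, hc, h⟩ := hj.frame q
        obtain ⟨d, hd, h'⟩ := hk.frame (j q)
        refine ⟨d * c, mul_pos hd hc, ?_⟩
        rw [tangentMap_id] at h h' ⊢
        simp only [id, Homeomorph.trans_apply] at h h' ⊢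
        rw [h', h]
        simp [smul_smul]

/-- The set of equivalence classes of relative pin⁻ intervals. -/
abbrev Classes : Type 1 := Quotient instSetoidRelPinInterval

/-- The parametrisation `x ↦ x / 2` of the first half of the interval. -/
def firstHalf (x : unitInterval) : unitInterval :=
  ⟨(x : ℝ) / 2, by constructor <;> linarith [x.2.1, x.2.2]⟩

/-- The parametrisation `x ↦ (1 + x) / 2` of the second half of the interval. -/
def secondHalf (x : unitInterval) : unitInterval :=
  ⟨(1 + (x : ℝ)) / 2, by constructor <;> linarith [x.2.1, x.2.2]⟩

/-- `r` is the concatenation of `r₁` and `r₂`: it is glued from `r₁` (on the first half) and `r₂`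
(on the second half) through the isomorphisms of the right end of `r₁` and the left end of `r₂`
with `pt`. -/
def IsConcatenation (r₁ r₂ r : RelPinInterval) : Prop :=
  ∃ (j₁ : r₁.pin.Total → r.pin.Total) (j₂ : r₂.pin.Total → r.pin.Total),
    r₁.pin.IsPinMap r.pin firstHalf j₁ ∧ r₂.pin.IsPinMap r.pin secondHalf j₂ ∧
    j₁ r₁.left = r.left ∧ j₁ r₁.right = j₂ r₂.left ∧ j₂ r₂.right = r.right

/-- `C` is the pin⁻ structure on the circle `[0, 1] / {0, 1}` obtained from `r` by gluing the ends
through their isomorphisms with `pt`. -/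
def ClosesUpTo (r : RelPinInterval) (C : PinMinus1 (𝓡 1) Circle) : Prop :=
  ∃ j : r.pin.Total → C.Total,
    r.pin.IsPinMap C (fun x => Circle.exp (2 * Real.pi * (x : ℝ))) j ∧ j r.left = j r.right

/-- `r` is equivalent to `I₀`: closing it up gives the non-bounding circle. -/
def IsI0 (r : RelPinInterval) : Prop := ∃ C, r.ClosesUpTo C ∧ C.IsNonboundingCircle

/-- `r` is equivalent to `I₁`: closing it up gives the bounding circle. -/
def IsI1 (r : RelPinInterval) : Prop := ∃ C, r.ClosesUpTo C ∧ C.IsBoundingCircle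

end RelPinInterval

/-! ### Triangulated circles -/

section Circles

variable {M : Type} [TopologicalSpace M] [ChartedSpace (EuclideanSpace ℝ (Fin 1)) M]
  [IsManifold (𝓡 1) 1 M]

/-- The velocity vector of a path `γ : [0, 1] → M` at time `x`. -/
def velocity (γ : unitInterval → M) (x : unitInterval) : TangentBundle (𝓡 1) M :=
  tangentMap (𝓡∂ 1) (𝓡 1) γ ⟨x, oneTangentSpaceIcc x⟩

variable (M) in
/-- A simplicial structure with `n ≥ 1` edges on an oriented circle `M`. The edges are numbered
cyclically and parametrised along the orientation; edge `i` joins vertex `i` to vertex `i + 1`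
(indices modulo `n`), and `M` is the disjoint union of the half-open edges. -/
structure CircleTriangulation (n : ℕ) [NeZero n] where
  /-- The parametrised edges. -/
  edge : Fin n → unitInterval → M
  smooth : ∀ i, ContMDiff (𝓡∂ 1) (𝓡 1) ∞ (edge i)
  velocity_ne_zero : ∀ i x, (velocity (edge i) x).snd ≠ 0
  edge_one : ∀ i, edge i 1 = edge (i + 1) 0
  coherent : ∀ i, SameDirection (velocity (edge i) 1) (velocity (edge (i + 1)) 0)
  existsUnique : ∀ x : M, ∃! p : Fin n × unitInterval, p.2 ≠ 1 ∧ edge p.1 p.2 = x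

/-- The relative pin⁻ structure `r` is the restriction of the pin⁻ structure `P` to the path `γ`,
with the endpoints identified with `pt` by the points `a` and `b` of `P.Total`. -/
def RelPinInterval.IsRestriction (r : RelPinInterval) (P : PinMinus1 (𝓡 1) M)
    (γ : unitInterval → M) (a b : P.Total) : Prop :=
  ∃ j : r.pin.Total → P.Total, r.pin.IsPinMap P γ j ∧ j r.left = a ∧ j r.right = b

/-- A choice, for every vertex of the triangulation, of a pin⁻ isomorphism with `pt`, i.e. of a
point of the principal bundle over the vertex with positively oriented frame. -/
structure VertexTrivialization (P : PinMinus1 (𝓡 1) M) {n : ℕ} [NeZero n]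
    (T : CircleTriangulation M n) where
  /-- The point of the principal bundle over vertex `i`. -/
  pt : Fin n → P.Total
  pt_dir : ∀ i, SameDirection (velocity (T.edge i) 0) (P.tangent (pt i))

/-- `t` is the combinatorial pin⁻ data: the relative pin⁻ structure on edge `i` is equivalent to
`I₀` if `t i = 0` and to `I₁` if `t i = 1`. -/
def IsCombinatorialPinData (P : PinMinus1 (𝓡 1) M) {n : ℕ} [NeZero n]
    (T : CircleTriangulation M n) (s : VertexTrivialization P T) (t : Fin n → ZMod 2) : Prop :=
  ∀ i, ∃ r : RelPinInterval, r.IsRestriction P (T.edge i) (s.pt i) (s.pt (i + 1)) ∧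
    (t i = 0 → r.IsI0) ∧ (t i = 1 → r.IsI1)

end Circles

end

/-! The algebra `Cℓ₋₁` is `ℂ`, and `Pin⁻₁` is the group of fourth roots of unity generated by `e =
i`; the kernel of `ρ` is `{±1}` and `e` reverses the line. Since `Pin⁻₁` is discrete, the principal
bundle of a pin⁻ 1-manifold is a covering, so its points are transported uniquely along paths. Along
an immersed path a frame that points forward keeps pointing forward.

On `[0, 1]`, transport of the left identification to the right end and the right identification
itself have the same direction, hence differ by a sign, `RelPinInterval.sgn`. Left ends can always
be matched, so the sign is a complete invariant (`equivalent_iff`); both signs occur (`ofSgn`), and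
signs multiply under concatenation (`IsConcatenation.sgn_eq`). Therefore the classes form a group
isomorphic to `{±1}`.

On a circle cut into edges, the bundle has a global section if and only if the product of the edge
signs is one (`prod_eq_one_of_hasSection`, `hasSection_of_prod_eq_one`). For a circle with one edge
the sign also determines how the bundle is glued from `[0, 1] × Pin⁻₁`, so the existence of a
section classifies pin⁻ circles (`pinDiffeomorphic_of_hasSection_iff`).

The Lie framing is a section. The boundary of a pin⁻ disc has none
(`IsBoundaryOfDisc.not_hasSection`): the disc is contractible and carries a normalized section,
relative to which the outward normal turns once; as `Pin⁻₂` covers the orthogonal group by squaring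
angles, a section on the boundary would yield a continuous square root of `z` on the circle. Hence
nonbounding means having a section, and with `m` edges of sign `-1` this means `(-1) ^ m = 1`. -/

noncomputable section

open MulOpposite

/-! ### Models of the Clifford algebras: `ℂ` for `n = 1`, the quaternions for `n = 2` -/

namespace PinMinus

instance instIsModuleTopologyClMinus (n : ℕ) : IsModuleTopology ℝ (ClMinus n) := ⟨rfl⟩

/-- `Cℓ₋₁ ≃ ℂ`, with `e₁` corresponding to `I`. -/
def complexEquiv : ClMinus 1 ≃ₐ[ℝ] ℂ :=
  (CliffordAlgebra.equivOfIsometry (Q₁ := negForm 1) (Q₂ := CliffordAlgebraComplex.Q)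
    { toLinearEquiv := LinearEquiv.funUnique (Fin 1) ℝ ℝ
      map_app' := fun v => by
        simp [QuadraticMap.weightedSumSquares_apply, CliffordAlgebraComplex.Q_apply] }).trans
    CliffordAlgebraComplex.equiv

theorem complexEquiv_ι (v : Fin 1 → ℝ) :
    complexEquiv (CliffordAlgebra.ι (negForm 1) v) = v 0 * Complex.I := by
  rw [complexEquiv, AlgEquiv.trans_apply, CliffordAlgebra.equivOfIsometry_apply,
    CliffordAlgebra.map_apply_ι]
  exact CliffordAlgebraComplex.toComplex_ι (v 0)

/-- `Cℓ₋₂ ≃ ℍ`, with `e₁`, `e₂` corresponding to the quaternions `i`, `j`. -/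
def quaternionEquiv : ClMinus 2 ≃ₐ[ℝ] Quaternion ℝ :=
  (CliffordAlgebra.equivOfIsometry (Q₁ := negForm 2)
    (Q₂ := CliffordAlgebraQuaternion.Q (-1 : ℝ) (-1))
    { toLinearEquiv := LinearEquiv.finTwoArrow ℝ ℝ
      map_app' := fun v => by
        simp [QuadraticMap.weightedSumSquares_apply, CliffordAlgebraQuaternion.Q_apply,
          Fin.sum_univ_two, add_comm] }).trans
    CliffordAlgebraQuaternion.equiv

theorem quaternionEquiv_ι (v : Fin 2 → ℝ) :
    (quaternionEquiv (CliffordAlgebra.ι (negForm 2) v)).re = 0 ∧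
    (quaternionEquiv (CliffordAlgebra.ι (negForm 2) v)).imI = v 0 ∧
    (quaternionEquiv (CliffordAlgebra.ι (negForm 2) v)).imJ = v 1 ∧
    (quaternionEquiv (CliffordAlgebra.ι (negForm 2) v)).imK = 0 := by
  have : quaternionEquiv (CliffordAlgebra.ι (negForm 2) v) =
      (⟨0, v 0, v 1, 0⟩ : QuaternionAlgebra ℝ (-1) 0 (-1)) := by
    refine Eq.trans ?_
      (CliffordAlgebraQuaternion.toQuaternion_ι (c₁ := (-1 : ℝ)) (c₂ := -1) (v 0, v 1))
    exact congrArg CliffordAlgebraQuaternion.toQuaternion (CliffordAlgebra.map_apply_ι _ v)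
  rw [this]
  exact ⟨rfl, rfl, rfl, rfl⟩

/-- Finite dimensionality makes multiplication continuous for the module topology. Only `n = 1` and
`n = 2` are needed, and there the models supply it. -/
instance instFiniteClMinusOne : Module.Finite ℝ (ClMinus 1) :=
  Module.Finite.equiv complexEquiv.symm.toLinearEquiv

instance instFiniteClMinusTwo : Module.Finite ℝ (ClMinus 2) :=
  Module.Finite.equiv quaternionEquiv.symm.toLinearEquiv

instance instIsTopologicalRingClMinusOne : IsTopologicalRing (ClMinus 1) :=
  IsModuleTopology.isTopologicalRing ℝ _

instance instIsTopologicalRingClMinusTwo : IsTopologicalRing (ClMinus 2) :=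
  IsModuleTopology.isTopologicalRing ℝ _

theorem continuous_complexEquiv : Continuous complexEquiv :=
  IsModuleTopology.continuous_of_linearMap complexEquiv.toLinearMap

theorem continuous_quaternionEquiv : Continuous quaternionEquiv :=
  IsModuleTopology.continuous_of_linearMap quaternionEquiv.toLinearMap

instance instT2SpaceClMinusOne : T2Space (ClMinus 1) :=
  .of_injective_continuous complexEquiv.injective continuous_complexEquiv

instance instT2SpaceClMinusTwo : T2Space (ClMinus 2) :=
  .of_injective_continuous quaternionEquiv.injective continuous_quaternionEquiv

/-- Inversion on the pin group is the restriction of the linear map `star`, and linear maps are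
continuous for the module topology. -/
instance instContinuousInv (n : ℕ) : ContinuousInv (PinMinus n) where
  continuous_inv := by
    refine Continuous.subtype_mk (f := fun g : PinMinus n => star (g : ClMinus n)) ?_ _
    have := IsModuleTopology.toContinuousAdd ℝ (ClMinus n)
    have h : Continuous fun x : ClMinus n => star x :=
      IsModuleTopology.continuous_of_linearMap
        (CliffordAlgebra.reverse.comp CliffordAlgebra.involute.toLinearMap)
    exact h.comp continuous_subtype_val

theorem coe_inv {n : ℕ} (g : PinMinus n) : ((g⁻¹ : PinMinus n) : ClMinus n) = star (g : ClMinus n) :=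
  rfl

/-- A unit vector as an element of the pin group. -/
def ofVector {n : ℕ} (v : Fin n → ℝ) (hv : negForm n v = -1) : PinMinus n :=
  ⟨CliffordAlgebra.ι (negForm n) v, by
    have h1 : CliffordAlgebra.ι (negForm n) v * CliffordAlgebra.ι (negForm n) v = -1 := by
      rw [CliffordAlgebra.ι_sq_scalar, hv]; simp
    refine ⟨⟨⟨CliffordAlgebra.ι (negForm n) v, -CliffordAlgebra.ι (negForm n) v, by simp [h1],
      by simp [h1]⟩, Subgroup.subset_closure ⟨v, rfl⟩, rfl⟩, ?_⟩
    refine Unitary.mem_iff.2 ⟨?_, ?_⟩ <;> simp [CliffordAlgebra.star_ι, h1]⟩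

theorem complexEquiv_star (x : ClMinus 1) : complexEquiv (star x) = star (complexEquiv x) := by
  induction x using CliffordAlgebra.induction with
  | algebraMap r => simp [CliffordAlgebra.star_algebraMap]
  | ι v => simp [CliffordAlgebra.star_ι, complexEquiv_ι]
  | mul a b ha hb => simp [ha, hb, mul_comm]
  | add a b ha hb => simp [ha, hb]

theorem complexEquiv_involute (x : ClMinus 1) :
    complexEquiv (CliffordAlgebra.involute x) = star (complexEquiv x) := by
  induction x using CliffordAlgebra.induction with
  | algebraMap r => simp
  | ι v => simp [complexEquiv_ι]
  | mul a b ha hb => simp [ha, hb]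
  | add a b ha hb => simp [ha, hb]

theorem quaternionEquiv_star (x : ClMinus 2) :
    quaternionEquiv (star x) = star (quaternionEquiv x) := by
  induction x using CliffordAlgebra.induction with
  | algebraMap r => simp [CliffordAlgebra.star_algebraMap]
  | ι v =>
    obtain ⟨h0, h1, h2, h3⟩ := quaternionEquiv_ι v
    ext <;> simp [CliffordAlgebra.star_ι, h0, h1, h2, h3]
  | mul a b ha hb => simp [ha, hb]
  | add a b ha hb => simp [ha, hb]

theorem quaternionEquiv_involute (x : ClMinus 2) :
    (quaternionEquiv (CliffordAlgebra.involute x)).re = (quaternionEquiv x).re ∧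
    (quaternionEquiv (CliffordAlgebra.involute x)).imI = -(quaternionEquiv x).imI ∧
    (quaternionEquiv (CliffordAlgebra.involute x)).imJ = -(quaternionEquiv x).imJ ∧
    (quaternionEquiv (CliffordAlgebra.involute x)).imK = (quaternionEquiv x).imK := by
  induction x using CliffordAlgebra.induction with
  | algebraMap r => simp
  | ι v =>
    obtain ⟨h0, h1, h2, h3⟩ := quaternionEquiv_ι v
    simp [h0, h3]
  | mul a b ha hb =>
    obtain ⟨h0, h1, h2, h3⟩ := ha
    obtain ⟨k0, k1, k2, k3⟩ := hb
    simp only [map_mul, Quaternion.re_mul, Quaternion.imI_mul, Quaternion.imJ_mul,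
      Quaternion.imK_mul, h0, h1, h2, h3, k0, k1, k2, k3]
    refine ⟨?_, ?_, ?_, ?_⟩ <;> ring
  | add a b ha hb =>
    simp only [map_add, Quaternion.re_add, Quaternion.imI_add, Quaternion.imJ_add,
      Quaternion.imK_add, ha, hb]
    refine ⟨trivial, ?_, ?_, trivial⟩ <;> ring

theorem ι_injective_one : Function.Injective (CliffordAlgebra.ι (negForm 1)) := by
  intro v w h
  have := congrArg complexEquiv h
  simp only [complexEquiv_ι] at this
  ext i
  fin_cases i
  simpa using this

theorem ι_injective_two : Function.Injective (CliffordAlgebra.ι (negForm 2)) := by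
  intro v w h
  obtain ⟨-, h1, h2, -⟩ := quaternionEquiv_ι v
  obtain ⟨-, k1, k2, -⟩ := quaternionEquiv_ι w
  ext i
  fin_cases i
  · rw [h] at h1; exact h1.symm.trans k1
  · rw [h] at h2; exact h2.symm.trans k2

/-! ### The group `Pin⁻₁` -/

/-- The Lipschitz group is generated by invertible vectors, which are imaginary in `ℂ`; the union of
the two axes is closed under products and inverses. -/
theorem re_mul_im_complexEquiv (g : PinMinus 1) :
    (complexEquiv (g : ClMinus 1)).re = 0 ∨ (complexEquiv (g : ClMinus 1)).im = 0 := by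
  obtain ⟨x, hx, hxg⟩ := g.2.1
  rw [← hxg]
  change (complexEquiv x).re = 0 ∨ (complexEquiv x).im = 0
  clear hxg
  induction hx using Subgroup.closure_induction with
  | mem y hy =>
    obtain ⟨v, hv⟩ := hy
    left
    rw [← hv, complexEquiv_ι]
    simp
  | one => simp
  | mul y z _ _ hy hz =>
    simp only [Units.val_mul, map_mul, Complex.mul_re, Complex.mul_im]
    rcases hy with hy | hy <;> rcases hz with hz | hz <;> simp [hy, hz]
  | inv y _ hy =>
    have : complexEquiv (↑y⁻¹ : ClMinus 1) = (complexEquiv y)⁻¹ := by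
      refine eq_inv_of_mul_eq_one_left ?_
      rw [← map_mul]
      simp
    rw [this, Complex.inv_re, Complex.inv_im]
    rcases hy with hy | hy <;> simp [hy]

theorem normSq_complexEquiv (g : PinMinus 1) :
    (complexEquiv (g : ClMinus 1)).re ^ 2 + (complexEquiv (g : ClMinus 1)).im ^ 2 = 1 := by
  have := congrArg complexEquiv (pinGroup.star_mul_self_of_mem g.2)
  rw [map_mul, complexEquiv_star, map_one] at this
  have := congrArg Complex.re this
  simp at this
  linarith

/-- The basis vector of `ℝ`, as an element of `Pin⁻₁`. -/
def e : PinMinus 1 := ofVector (fun _ => 1) (by simp [QuadraticMap.weightedSumSquares_apply])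

theorem complexEquiv_e : complexEquiv (e : ClMinus 1) = Complex.I := by
  simp [e, ofVector, complexEquiv_ι]

theorem complexEquiv_e_sq : complexEquiv ((e * e : PinMinus 1) : ClMinus 1) = -1 := by
  rw [Submonoid.coe_mul, map_mul, complexEquiv_e, Complex.I_mul_I]

theorem ext_complexEquiv {g h : PinMinus 1}
    (H : complexEquiv (g : ClMinus 1) = complexEquiv (h : ClMinus 1)) : g = h :=
  Subtype.ext (complexEquiv.injective H)

/-- The two axes meet the unit circle in the fourth roots of unity. -/
theorem eq_one_or (g : PinMinus 1) : g = 1 ∨ g = e * e ∨ g = e ∨ g = e * (e * e) := by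
  have h1 := normSq_complexEquiv g
  rcases re_mul_im_complexEquiv g with h | h
  · have h2 : (complexEquiv (g : ClMinus 1)).im ^ 2 = 1 := by rw [h] at h1; linarith
    right; right
    rcases sq_eq_one_iff.1 h2 with h3 | h3
    · left
      apply ext_complexEquiv
      rw [complexEquiv_e]
      apply Complex.ext <;> simp [h, h3]
    · right
      apply ext_complexEquiv
      rw [Submonoid.coe_mul, map_mul, complexEquiv_e_sq, complexEquiv_e]
      apply Complex.ext <;> simp [h, h3]
  · have h2 : (complexEquiv (g : ClMinus 1)).re ^ 2 = 1 := by rw [h] at h1; linarith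
    rcases sq_eq_one_iff.1 h2 with h3 | h3
    · left
      apply ext_complexEquiv
      rw [OneMemClass.coe_one, map_one]
      apply Complex.ext <;> simp [h, h3]
    · right; left
      apply ext_complexEquiv
      rw [complexEquiv_e_sq]
      apply Complex.ext <;> simp [h, h3]

instance instFinitePinMinusOne : Finite (PinMinus 1) := by
  refine Set.finite_univ_iff.1 (Set.Finite.subset
    (Set.toFinite {1, e * e, e, e * (e * e)}) fun g _ => ?_)
  simpa using eq_one_or g

/-- A finite Hausdorff space is discrete. This is what turns principal `Pin⁻₁`-bundles into
coverings. -/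
instance instDiscreteTopologyPinMinusOne : DiscreteTopology (PinMinus 1) := inferInstance

/-- The sign by which `ρ(g)` acts on the line. -/
def sign (g : PinMinus 1) : ℝ := (complexEquiv (g : ClMinus 1) ^ 2).re

/-- Both the grading operator and inversion become complex conjugation, so `ρ(g)` multiplies by the
conjugate of `z ^ 2`, and `z ^ 2` is real for `z` on an axis. -/
theorem rho_eq_sign_smul (g : PinMinus 1) (v : Fin 1 → ℝ) : rho g v = sign g • v := by
  apply ι_injective_one
  apply complexEquiv.injective
  rw [ι_rho, coe_inv, map_mul, map_mul, complexEquiv_star, complexEquiv_involute, complexEquiv_ι,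
    complexEquiv_ι, sign]
  rcases re_mul_im_complexEquiv g with h | h <;>
    apply Complex.ext <;> simp [pow_two, h] <;> ring

theorem sign_one : sign 1 = 1 := by simp [sign]

theorem sign_mul (g h : PinMinus 1) : sign (g * h) = sign g * sign h := by
  simp only [sign, Submonoid.coe_mul, map_mul]
  rcases re_mul_im_complexEquiv g with h1 | h1 <;> rcases re_mul_im_complexEquiv h with h2 | h2 <;>
    simp [pow_two, h1, h2] <;> ring

theorem sign_e : sign e = -1 := by simp [sign, complexEquiv_e]

/-- The inclusion of `{±1}` into `Pin⁻₁`. -/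
def unit : ℤˣ →* PinMinus 1 where
  toFun u := if u = 1 then 1 else e * e
  map_one' := by simp
  map_mul' u v := by
    have he : (e * e : PinMinus 1) * (e * e) = 1 := by
      apply ext_complexEquiv
      rw [Submonoid.coe_mul, map_mul, complexEquiv_e_sq, OneMemClass.coe_one, map_one]
      norm_num
    rcases Int.units_eq_one_or u with rfl | rfl <;> rcases Int.units_eq_one_or v with rfl | rfl <;>
      simp [he]

theorem unit_neg_one : unit (-1) = e * e := by simp [unit]

theorem e_sq_ne_one : (e * e : PinMinus 1) ≠ 1 := fun h => by
  have := complexEquiv_e_sq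
  rw [h, OneMemClass.coe_one, map_one] at this
  norm_num at this

theorem unit_injective : Function.Injective unit := by
  intro u v h
  rcases Int.units_eq_one_or u with rfl | rfl <;> rcases Int.units_eq_one_or v with rfl | rfl
  · rfl
  · rw [map_one, unit_neg_one] at h; exact absurd h.symm e_sq_ne_one
  · rw [map_one, unit_neg_one] at h; exact absurd h e_sq_ne_one
  · rfl

theorem sign_unit (u : ℤˣ) : sign (unit u) = 1 := by
  rcases Int.units_eq_one_or u with rfl | rfl
  · rw [map_one, sign_one]
  · rw [unit_neg_one, sign_mul, sign_e]; norm_num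

theorem exists_unit_of_sign_pos {g : PinMinus 1} (hg : 0 < sign g) : ∃ u, g = unit u := by
  rcases eq_one_or g with rfl | rfl | rfl | rfl
  · exact ⟨1, (map_one _).symm⟩
  · exact ⟨-1, unit_neg_one.symm⟩
  · rw [sign_e] at hg; norm_num at hg
  · simp only [sign_mul, sign_e] at hg; norm_num at hg

theorem sign_ne_zero (g : PinMinus 1) : sign g ≠ 0 := by
  rcases eq_one_or g with rfl | rfl | rfl | rfl <;> simp [sign_mul, sign_e, sign_one]

end PinMinus

namespace PinMinus

/-! ### The group `Pin⁻₂` -/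

/-- The identification `ℝ² ≃ ℂ`. -/
def toComplex : (Fin 2 → ℝ) ≃ₗ[ℝ] ℂ := Complex.basisOneI.equivFun.symm

theorem toComplex_apply (v : Fin 2 → ℝ) : toComplex v = ⟨v 0, v 1⟩ := by
  apply Complex.ext <;> simp [toComplex, Module.Basis.equivFun_symm_apply, Fin.sum_univ_two]

/-- The even part of an element of `Cℓ₋₂`, as a complex number with `e₁ e₂ = I`. -/
def evenPart (x : ClMinus 2) : ℂ := ⟨(quaternionEquiv x).re, (quaternionEquiv x).imK⟩

/-- The odd part of an element of `Cℓ₋₂`, as a vector in `ℂ = ℝ²`. -/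
def oddPart (x : ClMinus 2) : ℂ := ⟨(quaternionEquiv x).imI, (quaternionEquiv x).imJ⟩

theorem ext_parts {x y : ClMinus 2} (h : evenPart x = evenPart y) (h' : oddPart x = oddPart y) :
    x = y := by
  apply quaternionEquiv.injective
  simp only [evenPart, oddPart, Complex.mk.injEq] at h h'
  exact Quaternion.ext _ _ h.1 h'.1 h'.2 h.2

theorem continuous_evenPart : Continuous evenPart := by
  have h : Continuous fun x => (((quaternionEquiv x).re : ℂ) + (quaternionEquiv x).imK * Complex.I) :=
    ((Complex.continuous_ofReal.comp (Quaternion.continuous_re.comp continuous_quaternionEquiv)).add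
      ((Complex.continuous_ofReal.comp
        (Quaternion.continuous_imK.comp continuous_quaternionEquiv)).mul_const _))
  exact h.congr fun x => (Complex.mk_eq_add_mul_I _ _).symm

theorem continuous_oddPart : Continuous oddPart := by
  have h : Continuous fun x => (((quaternionEquiv x).imI : ℂ) + (quaternionEquiv x).imJ * Complex.I) :=
    ((Complex.continuous_ofReal.comp
      (Quaternion.continuous_imI.comp continuous_quaternionEquiv)).add
      ((Complex.continuous_ofReal.comp
        (Quaternion.continuous_imJ.comp continuous_quaternionEquiv)).mul_const _))
  exact h.congr fun x => (Complex.mk_eq_add_mul_I _ _).symm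

/-- An element is `a + b i`, where `a` is its even part and `b` its odd part, both in the copy of
`ℂ` spanned by `1` and `k`. Moving the quaternion `i` past such a number conjugates it, which gives
this rule and the next. -/
theorem evenPart_mul (x y : ClMinus 2) :
    evenPart (x * y) = evenPart x * evenPart y - oddPart x * star (oddPart y) := by
  apply Complex.ext <;> simp [evenPart, oddPart] <;> ring

theorem oddPart_mul (x y : ClMinus 2) :
    oddPart (x * y) = evenPart x * oddPart y + oddPart x * star (evenPart y) := by
  apply Complex.ext <;> simp [evenPart, oddPart] <;> ring

theorem evenPart_one : evenPart 1 = 1 := by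
  rw [evenPart, map_one]
  rfl

theorem oddPart_one : oddPart 1 = 0 := by
  rw [oddPart, map_one]
  rfl

theorem evenPart_add (x y : ClMinus 2) : evenPart (x + y) = evenPart x + evenPart y := by
  apply Complex.ext <;> simp [evenPart]

theorem oddPart_add (x y : ClMinus 2) : oddPart (x + y) = oddPart x + oddPart y := by
  apply Complex.ext <;> simp [oddPart]

theorem evenPart_smul (r : ℝ) (x : ClMinus 2) : evenPart (r • x) = r * evenPart x := by
  apply Complex.ext <;> simp [evenPart]

theorem oddPart_smul (r : ℝ) (x : ClMinus 2) : oddPart (r • x) = r * oddPart x := by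
  apply Complex.ext <;> simp [oddPart]

theorem evenPart_ι (v : Fin 2 → ℝ) : evenPart (CliffordAlgebra.ι (negForm 2) v) = 0 := by
  obtain ⟨h0, -, -, h3⟩ := quaternionEquiv_ι v
  apply Complex.ext <;> simp [evenPart, h0, h3]

theorem oddPart_ι (v : Fin 2 → ℝ) : oddPart (CliffordAlgebra.ι (negForm 2) v) = toComplex v := by
  obtain ⟨-, h1, h2, -⟩ := quaternionEquiv_ι v
  rw [toComplex_apply]
  apply Complex.ext <;> simp [oddPart, h1, h2]

theorem evenPart_star (x : ClMinus 2) : evenPart (star x) = star (evenPart x) := by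
  apply Complex.ext <;> simp [evenPart, quaternionEquiv_star]

theorem oddPart_star (x : ClMinus 2) : oddPart (star x) = -oddPart x := by
  apply Complex.ext <;> simp [oddPart, quaternionEquiv_star]

theorem evenPart_involute (x : ClMinus 2) :
    evenPart (CliffordAlgebra.involute x) = evenPart x := by
  apply Complex.ext <;> simp [evenPart, quaternionEquiv_involute]

theorem oddPart_involute (x : ClMinus 2) :
    oddPart (CliffordAlgebra.involute x) = -oddPart x := by
  apply Complex.ext <;> simp [oddPart, quaternionEquiv_involute]

/-- The generators of the Lipschitz group are odd, and products and inverses of homogeneous elements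
are homogeneous. -/
theorem evenPart_eq_zero_or (g : PinMinus 2) :
    evenPart (g : ClMinus 2) = 0 ∨ oddPart (g : ClMinus 2) = 0 := by
  obtain ⟨x, hx, hxg⟩ := g.2.1
  rw [← hxg]
  change evenPart (x : ClMinus 2) = 0 ∨ oddPart (x : ClMinus 2) = 0
  clear hxg
  induction hx using Subgroup.closure_induction with
  | mem y hy =>
    obtain ⟨v, hv⟩ := hy
    left
    rw [← hv, evenPart_ι]
  | one => right; exact oddPart_one
  | mul y z _ _ hy hz =>
    simp only [Units.val_mul, evenPart_mul, oddPart_mul]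
    rcases hy with hy | hy <;> rcases hz with hz | hz <;> simp [hy, hz]
  | inv y _ hy =>
    have h1 := congrArg evenPart (y.mul_inv)
    have h2 := congrArg oddPart (y.mul_inv)
    rw [evenPart_mul, evenPart_one] at h1
    rw [oddPart_mul, oddPart_one] at h2
    rcases hy with hy | hy
    · simp only [hy, zero_mul, zero_sub, zero_add, neg_eq_iff_eq_neg] at h1 h2
      rcases mul_eq_zero.1 h2 with h | h
      · simp [h] at h1
      · left; simpa using h
    · simp only [hy, zero_mul, sub_zero, add_zero] at h1 h2
      rcases mul_eq_zero.1 h2 with h | h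
      · simp [h] at h1
      · right; exact h

theorem evenPart_add_oddPart (g : PinMinus 2) :
    evenPart (g : ClMinus 2) * star (evenPart (g : ClMinus 2)) +
      oddPart (g : ClMinus 2) * star (oddPart (g : ClMinus 2)) = 1 := by
  have := congrArg evenPart (pinGroup.mul_star_self_of_mem g.2)
  rw [evenPart_mul, evenPart_star, oddPart_star, evenPart_one] at this
  rw [← this]
  simp

/-- Only one of the two terms survives: an even `a` rotates by `a ^ 2`, an odd `b` reflects by `v ↦
-b ^ 2 * star v`. The squares are the source of the square root obstruction on the circle. -/
theorem toComplex_rho (g : PinMinus 2) (v : Fin 2 → ℝ) :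
    toComplex (rho g v) = evenPart (g : ClMinus 2) ^ 2 * toComplex v -
      oddPart (g : ClMinus 2) ^ 2 * star (toComplex v) := by
  rw [← oddPart_ι, ι_rho, coe_inv, oddPart_mul, oddPart_mul, evenPart_mul, evenPart_involute,
    oddPart_involute, evenPart_star, oddPart_star, evenPart_ι, oddPart_ι]
  rcases evenPart_eq_zero_or g with h | h <;> simp [h] <;> ring

/-- `ρ(g)` as a linear automorphism of `ℝ²`. -/
def rhoEquiv (g : PinMinus 2) : (Fin 2 → ℝ) ≃ₗ[ℝ] (Fin 2 → ℝ) :=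
  have key : ∀ (g h : PinMinus 2) (v : Fin 2 → ℝ), rho (g * h) v = rho g (rho h v) := by
    intro g h v
    apply ι_injective_two
    simp only [ι_rho, Submonoid.coe_mul, map_mul, mul_inv_rev, mul_assoc]
  have one : ∀ v : Fin 2 → ℝ, rho 1 v = v := fun v => by
    apply toComplex.injective
    rw [toComplex_rho]
    simp [evenPart_one, oddPart_one]
  { toFun := rho g
    invFun := rho g⁻¹
    map_add' := fun v w => by
      apply toComplex.injective
      simp only [toComplex_rho, map_add, star_add]
      ring
    map_smul' := fun r v => by
      apply toComplex.injective
      simp only [toComplex_rho, map_smul, star_smul, RingHom.id_apply, smul_sub, star_trivial,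
        mul_smul_comm]
    left_inv := fun v => by rw [← key, inv_mul_cancel, one]
    right_inv := fun v => by rw [← key, mul_inv_cancel, one] }

theorem rho_mul (g h : PinMinus 2) (v : Fin 2 → ℝ) : rho (g * h) v = rho g (rho h v) := by
  apply ι_injective_two
  simp only [ι_rho, Submonoid.coe_mul, map_mul, mul_inv_rev, mul_assoc]

theorem quaternionEquiv_map_secondAxis (x : ClMinus 1) :
    evenPart (CliffordAlgebra.map secondAxis x) = (complexEquiv x).re ∧
    oddPart (CliffordAlgebra.map secondAxis x) = (complexEquiv x).im * Complex.I := by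
  induction x using CliffordAlgebra.induction with
  | algebraMap r =>
    rw [AlgHom.commutes]
    constructor <;> apply Complex.ext <;> simp [evenPart, oddPart]
  | ι v =>
    rw [CliffordAlgebra.map_apply_ι, evenPart_ι, oddPart_ι, toComplex_apply, complexEquiv_ι]
    have h0 : secondAxis v 0 = 0 := rfl
    have h1 : secondAxis v 1 = v 0 := rfl
    constructor <;> apply Complex.ext <;> simp [h0, h1]
  | mul a b ha hb =>
    rw [map_mul, evenPart_mul, oddPart_mul, ha.1, ha.2, hb.1, hb.2, map_mul]
    constructor <;> apply Complex.ext <;> simp [sub_eq_add_neg]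
  | add a b ha hb =>
    rw [map_add, evenPart_add, oddPart_add, ha.1, ha.2, hb.1, hb.2, map_add]
    constructor <;> apply Complex.ext <;> simp

theorem evenPart_incl (g : PinMinus 1) :
    evenPart (incl g : ClMinus 2) = (complexEquiv (g : ClMinus 1)).re :=
  (quaternionEquiv_map_secondAxis _).1

theorem oddPart_incl (g : PinMinus 1) :
    oddPart (incl g : ClMinus 2) = (complexEquiv (g : ClMinus 1)).im * Complex.I :=
  (quaternionEquiv_map_secondAxis _).2

theorem incl_mul (g h : PinMinus 1) : incl (g * h) = incl g * incl h :=
  Subtype.ext (map_mul (CliffordAlgebra.map secondAxis) (g : ClMinus 1) h)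

theorem incl_one : incl 1 = 1 := Subtype.ext (map_one (CliffordAlgebra.map secondAxis))

theorem incl_injective : Function.Injective incl := by
  intro g h H
  have h1 := evenPart_incl g
  have h2 := oddPart_incl g
  rw [H, evenPart_incl] at h1
  rw [H, oddPart_incl] at h2
  apply ext_complexEquiv
  apply Complex.ext
  · exact_mod_cast h1.symm
  · simpa using h2.symm

theorem negForm_two (v : Fin 2 → ℝ) :
    negForm 2 v = -((toComplex v).re * (toComplex v).re + (toComplex v).im * (toComplex v).im) := by
  rw [toComplex_apply, QuadraticMap.weightedSumSquares_apply, Fin.sum_univ_two]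
  simp only [smul_eq_mul]
  ring

/-- The elements `cos θ + sin θ e₁ e₂`. -/
def spin (c : Circle) : PinMinus 2 :=
  -- The product of vectors `v` and `w` has even part `-v * star w`; this equals `c` for `v = 1` and
  -- `w = -star c`. Writing it as a product of unit vectors puts it in the pin group.
  ofVector (toComplex.symm 1) (by
      rw [negForm_two, LinearEquiv.apply_symm_apply]
      simp) *
    ofVector (toComplex.symm (-star (c : ℂ))) (by
      have hc := Circle.normSq_coe c
      rw [Complex.normSq_apply] at hc
      rw [negForm_two, LinearEquiv.apply_symm_apply]
      simp only [Complex.neg_re, Complex.neg_im, RCLike.star_def, Complex.conj_re, Complex.conj_im]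
      linarith)

theorem evenPart_spin (c : Circle) : evenPart (spin c : ClMinus 2) = c := by
  rw [spin, Submonoid.coe_mul, evenPart_mul]
  simp only [ofVector, evenPart_ι, oddPart_ι, LinearEquiv.apply_symm_apply]
  simp

theorem oddPart_spin (c : Circle) : oddPart (spin c : ClMinus 2) = 0 := by
  rw [spin, Submonoid.coe_mul, oddPart_mul]
  simp only [ofVector, evenPart_ι, oddPart_ι, LinearEquiv.apply_symm_apply]
  simp

theorem exists_circle_eq {z : ℂ} (hz : z * star z = 1) : ∃ c : Circle, (c : ℂ) = z := by
  refine ⟨⟨z, mem_sphere_zero_iff_norm.2 ?_⟩, rfl⟩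
  have h2 := congrArg norm hz
  rw [norm_mul, norm_star, norm_one] at h2
  nlinarith [norm_nonneg z]

theorem eq_spin_or (g : PinMinus 2) : ∃ c, g = spin c ∨ g = spin c * incl e := by
  have h := evenPart_add_oddPart g
  rcases evenPart_eq_zero_or g with h0 | h0
  -- The odd part of `spin c * incl e` is `c * I`, which determines `c`.
  · obtain ⟨c, hc⟩ := exists_circle_eq (z := -Complex.I * oddPart (g : ClMinus 2)) (by
      rw [h0, zero_mul, zero_add] at h
      rw [star_mul', ← h]
      simp only [star_neg, RCLike.star_def, Complex.conj_I]
      linear_combination (-oddPart (g : ClMinus 2) * starRingEnd ℂ (oddPart (g : ClMinus 2))) *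
        Complex.I_mul_I)
    refine ⟨c, Or.inr (Subtype.ext (ext_parts ?_ ?_))⟩
    · rw [Submonoid.coe_mul, evenPart_mul, evenPart_spin, oddPart_spin, evenPart_incl, h0,
        complexEquiv_e]
      simp
    · rw [Submonoid.coe_mul, oddPart_mul, evenPart_spin, oddPart_spin, oddPart_incl,
        complexEquiv_e, hc]
      simp only [Complex.I_im, Complex.ofReal_one, one_mul, zero_mul, add_zero]
      linear_combination oddPart (g : ClMinus 2) * Complex.I_mul_I
  · obtain ⟨c, hc⟩ := exists_circle_eq (z := evenPart (g : ClMinus 2)) (by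
      rwa [h0, zero_mul, add_zero] at h)
    refine ⟨c, Or.inl (Subtype.ext (ext_parts ?_ ?_))⟩
    · rw [evenPart_spin, hc]
    · rw [oddPart_spin, h0]

theorem spin_mul (c d : Circle) : spin (c * d) = spin c * spin d := by
  refine Subtype.ext (ext_parts ?_ ?_)
  · simp [evenPart_mul, evenPart_spin, oddPart_spin]
  · simp [oddPart_mul, oddPart_spin]

theorem continuous_circle_coe : Continuous fun c : Circle => (c : ℂ) := continuous_induced_dom

theorem continuous_spin : Continuous spin := by
  refine Continuous.subtype_mk (f := fun c => (spin c : ClMinus 2)) ?_ _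
  -- This is `spin c` as a real linear combination of `1` and `e₁ e₂`.
  have h : Continuous fun c : Circle => (c : ℂ).re • (1 : ClMinus 2) + (c : ℂ).im •
      (CliffordAlgebra.ι (negForm 2) (toComplex.symm 1) *
        CliffordAlgebra.ι (negForm 2) (toComplex.symm Complex.I)) := by
    have h1 : Continuous fun c : Circle => (c : ℂ).re :=
      Complex.continuous_re.comp continuous_circle_coe
    have h2 : Continuous fun c : Circle => (c : ℂ).im :=
      Complex.continuous_im.comp continuous_circle_coe
    fun_prop
  refine h.congr fun c => ext_parts ?_ ?_
  · rw [evenPart_spin, evenPart_add, evenPart_smul, evenPart_smul, evenPart_mul]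
    simp [evenPart_ι, oddPart_ι, evenPart_one, Complex.re_add_im]
  · rw [oddPart_spin, oddPart_add, oddPart_smul, oddPart_smul, oddPart_mul]
    simp [evenPart_ι, oddPart_one]

theorem toComplex_rho_spin (c : Circle) (v : Fin 2 → ℝ) :
    toComplex (rho (spin c) v) = c ^ 2 * toComplex v := by
  simp [toComplex_rho, evenPart_spin, oddPart_spin]

theorem toComplex_rho_incl_e (v : Fin 2 → ℝ) :
    toComplex (rho (incl e) v) = star (toComplex v) := by
  simp [toComplex_rho, evenPart_incl, oddPart_incl, complexEquiv_e]

theorem continuous_rho (v : Fin 2 → ℝ) : Continuous fun g => toComplex (rho g v) := by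
  simp only [toComplex_rho]
  have h1 := continuous_evenPart.comp (continuous_subtype_val (p := (· ∈ pinGroup (negForm 2))))
  have h2 := continuous_oddPart.comp (continuous_subtype_val (p := (· ∈ pinGroup (negForm 2))))
  exact ((h1.pow 2).mul continuous_const).sub ((h2.pow 2).mul continuous_const)

end PinMinus

/-! ### Topology of the principal bundle of a pin⁻ structure -/

theorem isCoveringMap_of_locally_trivial {X B G : Type*} [TopologicalSpace X] [TopologicalSpace B]
    [TopologicalSpace G] [DiscreteTopology G] {f : X → B} (hf : Continuous f)
    (h : ∀ x : B, ∃ U : Set B, IsOpen U ∧ x ∈ U ∧ ∃ h : U × G ≃ₜ f ⁻¹' U, ∀ p, f (h p) = p.1) :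
    IsCoveringMap f := by
  intro x
  obtain ⟨U, hU, hx, h, hp⟩ := h x
  refine IsEvenlyCovered.to_isEvenlyCovered_preimage (I := G)
    ⟨inferInstance, U, hx, hU, hU.preimage hf, h.symm, fun q => ?_⟩
  rw [← hp, h.apply_symm_apply]

/-- Hausdorff total spaces make continuous maps from compact spaces closed, hence quotient maps when
surjective. -/
theorem t2Space_of_isCoveringMap {X B : Type*} [TopologicalSpace X] [TopologicalSpace B] [T2Space B]
    {f : X → B} (hf : IsCoveringMap f) : T2Space X := by
  refine ⟨fun x y hxy => ?_⟩
  by_cases h : f x = f y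
  · exact hf.isSeparatedMap x y h hxy
  · exact separated_by_continuous hf.continuous h

namespace PinMinusStructure

variable {n : ℕ} {B : Type} [TopologicalSpace B] {F : Type} {E : B → Type}
  [∀ x, AddCommGroup (E x)] [∀ x, Module ℝ (E x)] [TopologicalSpace (TotalSpace F E)]
  (P : PinMinusStructure n F E)

theorem proj_smul (q : P.Total) (g : PinMinus n) : P.proj (op g • q) = P.proj q :=
  congrArg TotalSpace.proj (P.frame_smul q g 0)

theorem exists_proj_eq (x : B) : ∃ q, P.proj q = x := by
  obtain ⟨U, hU, hx, h, hp, he⟩ := P.locally_trivial x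
  exact ⟨h (⟨x, hx⟩, 1), hp _⟩

theorem exists_smul_eq {q q' : P.Total} (hq : P.proj q = P.proj q') :
    ∃ g : PinMinus n, q' = op g • q := by
  obtain ⟨U, hU, hx, h, hp, he⟩ := P.locally_trivial (P.proj q)
  obtain ⟨⟨u, g⟩, hg⟩ := h.surjective ⟨q, hx⟩
  obtain ⟨⟨u', g'⟩, hg'⟩ := h.surjective ⟨q', by rw [Set.mem_preimage, ← hq]; exact hx⟩
  have e1 : (h (u, g) : P.Total) = q := congrArg Subtype.val hg
  have e2 : (h (u', g') : P.Total) = q' := congrArg Subtype.val hg'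
  have hu : u' = u := by
    apply Subtype.ext
    rw [← hp (u, g), ← hp (u', g'), e1, e2, hq]
  refine ⟨g⁻¹ * g', ?_⟩
  rw [← e1, ← he, mul_inv_cancel_left, ← e2, hu]

theorem smul_left_injective (q : P.Total) :
    Function.Injective fun g : PinMinus n => op g • q := by
  intro g g' hg
  obtain ⟨U, hU, hx, h, hp, he⟩ := P.locally_trivial (P.proj q)
  obtain ⟨⟨u, k⟩, hk⟩ := h.surjective ⟨q, hx⟩
  have e1 : (h (u, k) : P.Total) = q := congrArg Subtype.val hk
  simp only [← e1, ← he] at hg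
  have := h.injective (Subtype.ext hg)
  simpa using this

variable [TopologicalSpace F] [∀ x, TopologicalSpace (E x)] [FiberBundle F E]

theorem continuous_proj : Continuous P.proj :=
  (FiberBundle.continuous_proj F E).comp (P.continuous_frame 0)

/-- Continuity of the action is not part of the structure; it holds because a local trivialization
turns the action into right multiplication. -/
theorem continuous_smul [ContinuousMul (PinMinus n)] :
    Continuous fun p : PinMinus n × P.Total => op p.1 • p.2 := by
  refine continuous_iff_continuousAt.2 fun ⟨g₀, q₀⟩ => ?_
  obtain ⟨U, hU, hx, h, hp, he⟩ := P.locally_trivial (P.proj q₀)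
  have hW : IsOpen {p : PinMinus n × P.Total | P.proj p.2 ∈ U} :=
    hU.preimage (P.continuous_proj.comp continuous_snd)
  refine ContinuousOn.continuousAt ?_ (hW.mem_nhds hx)
  rw [continuousOn_iff_continuous_domRestrict]
  have hc : Continuous fun p : {p : PinMinus n × P.Total | P.proj p.2 ∈ U} =>
      h.symm ⟨p.1.2, p.2⟩ := h.symm.continuous.comp (by fun_prop)
  have hc' : Continuous fun p : {p : PinMinus n × P.Total | P.proj p.2 ∈ U} =>
      (h ((h.symm ⟨p.1.2, p.2⟩).1, (h.symm ⟨p.1.2, p.2⟩).2 * p.1.1) : P.Total) := by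
    refine continuous_subtype_val.comp (h.continuous.comp ?_)
    fun_prop
  refine hc'.congr fun p => ?_
  rw [he, Prod.mk.eta, h.apply_symm_apply]
  rfl

/-- In a local trivialization the difference of two points of a fibre is the quotient of their group
coordinates. -/
theorem continuous_of_smul_eq [ContinuousMul (PinMinus n)] {A : Type*} [TopologicalSpace A]
    {a b : A → P.Total} {g : A → PinMinus n} (ha : Continuous a) (hb : Continuous b)
    (hg : ∀ x, b x = op (g x) • a x) : Continuous g := by
  refine continuous_iff_continuousAt.2 fun x₀ => ?_
  obtain ⟨U, hU, hx, h, hp, he⟩ := P.locally_trivial (P.proj (a x₀))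
  have hW : IsOpen {x | P.proj (a x) ∈ U} := hU.preimage (P.continuous_proj.comp ha)
  refine ContinuousOn.continuousAt ?_ (hW.mem_nhds hx)
  rw [continuousOn_iff_continuous_domRestrict]
  have hbU : ∀ x : {x | P.proj (a x) ∈ U}, P.proj (b x) ∈ U := fun x => by
    rw [hg, P.proj_smul]
    exact x.2
  have hc : Continuous fun x : {x | P.proj (a x) ∈ U} => h.symm ⟨a x, x.2⟩ :=
    h.symm.continuous.comp (by fun_prop)
  have hc' : Continuous fun x : {x | P.proj (a x) ∈ U} => h.symm ⟨b x, hbU x⟩ :=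
    h.symm.continuous.comp (by fun_prop)
  have hc'' : Continuous fun x : {x | P.proj (a x) ∈ U} =>
      (h.symm ⟨a x, x.2⟩).2⁻¹ * (h.symm ⟨b x, hbU x⟩).2 := by fun_prop
  refine hc''.congr fun x => ?_
  have key : h.symm ⟨b x, hbU x⟩ = ((h.symm ⟨a x, x.2⟩).1, (h.symm ⟨a x, x.2⟩).2 * g x) := by
    rw [Homeomorph.symm_apply_eq]
    apply Subtype.ext
    rw [he, Prod.mk.eta, h.apply_symm_apply]
    exact hg x
  rw [key, inv_mul_cancel_left]
  rfl

theorem isCoveringMap_proj [DiscreteTopology (PinMinus n)] : IsCoveringMap P.proj := by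
  refine isCoveringMap_of_locally_trivial (G := PinMinus n) P.continuous_proj fun x => ?_
  obtain ⟨U, hU, hx, h, hp, -⟩ := P.locally_trivial x
  exact ⟨U, hU, hx, h, hp⟩

end PinMinusStructure

/-! ### Directions of tangent vectors -/

section Direction

variable {H H' M M' : Type}
  [TopologicalSpace H] [TopologicalSpace H'] [TopologicalSpace M] [TopologicalSpace M']
  {I : ModelWithCorners ℝ (EuclideanSpace ℝ (Fin 1)) H}
  {I' : ModelWithCorners ℝ (EuclideanSpace ℝ (Fin 1)) H'}
  [ChartedSpace H M] [ChartedSpace H' M']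

namespace SameDirection

theorem symm {w w' : TangentBundle I M} (h : SameDirection w w') : SameDirection w' w := by
  obtain ⟨c, hc, rfl⟩ := h
  exact ⟨c⁻¹, inv_pos.2 hc, by simp [smul_smul, inv_mul_cancel₀ hc.ne']⟩

theorem trans {w w' w'' : TangentBundle I M} (h : SameDirection w w') (h' : SameDirection w' w'') :
    SameDirection w w'' := by
  obtain ⟨c, hc, rfl⟩ := h
  obtain ⟨d, hd, rfl⟩ := h'
  exact ⟨d * c, mul_pos hd hc, by simp [smul_smul]⟩

theorem proj_eq {w w' : TangentBundle I M} (h : SameDirection w w') : w'.proj = w.proj := by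
  obtain ⟨c, -, rfl⟩ := h
  rfl

theorem snd_ne_zero {w w' : TangentBundle I M} (h : SameDirection w w') (hw : w.snd ≠ 0) :
    w'.snd ≠ 0 := by
  obtain ⟨c, hc, rfl⟩ := h
  exact smul_ne_zero hc.ne' hw

theorem tangentMap {w w' : TangentBundle I M} (h : SameDirection w w') (f : M → M') :
    SameDirection (tangentMap I I' f w) (tangentMap I I' f w') := by
  obtain ⟨c, hc, rfl⟩ := h
  exact ⟨c, hc, congrArg (TotalSpace.mk (f w.proj)) (map_smul (mfderiv I I' f w.proj) c w.snd)⟩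

end SameDirection

theorem TangentBundle.exists_eq_smul {u w : TangentBundle I M} (h : u.proj = w.proj)
    (hw : w.snd ≠ 0) : ∃ c : ℝ, u = ⟨w.proj, c • w.snd⟩ := by
  obtain ⟨x, u⟩ := u
  obtain ⟨y, w⟩ := w
  obtain rfl : x = y := h
  have hf : Module.finrank ℝ (TangentSpace I x) = 1 := finrank_euclideanSpace_fin (𝕜 := ℝ) (n := 1)
  obtain ⟨c, hc⟩ := exists_smul_eq_of_finrank_eq_one hf hw u
  exact ⟨c, by rw [← hc]⟩

variable [IsManifold I 1 M] [IsManifold I' 1 M']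

/-- In a trivialization of the tangent bundle the factor is a quotient of continuous real functions
with nonvanishing denominator. -/
theorem TangentBundle.exists_continuous_eq_smul {X : Type*} [TopologicalSpace X]
    {u w : X → TangentBundle I M} (hu : Continuous u) (hw : Continuous w)
    (h : ∀ x, (u x).proj = (w x).proj) (hw0 : ∀ x, (w x).snd ≠ 0) :
    ∃ c : X → ℝ, Continuous c ∧ ∀ x, u x = ⟨(w x).proj, c x • (w x).snd⟩ := by
  choose c hc using fun x => exists_eq_smul (h x) (hw0 x)
  refine ⟨c, continuous_iff_continuousAt.2 fun x₀ => ?_, hc⟩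
  let e := trivializationAt (EuclideanSpace ℝ (Fin 1)) (TangentSpace I) (w x₀).proj
  have hbase : ∀ᶠ x in nhds x₀, (w x).proj ∈ e.baseSet :=
    ((FiberBundle.continuous_proj (EuclideanSpace ℝ (Fin 1)) (TangentSpace I)).comp
      hw).continuousAt.eventually
      (e.open_baseSet.mem_nhds (FiberBundle.mem_baseSet_trivializationAt' _))
  have hcont : ∀ v : X → TangentBundle I M, Continuous v → (∀ x, (v x).proj = (w x).proj) →
      ContinuousAt (fun x => (e (v x)).2 0) x₀ := by
    intro v hv hvw
    have he : ContinuousAt e (v x₀) := e.continuousAt (by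
      rw [e.mem_source, hvw]
      exact FiberBundle.mem_baseSet_trivializationAt' _)
    have := (continuous_snd.continuousAt.comp he).comp hv.continuousAt
    exact ((EuclideanSpace.proj (𝕜 := ℝ) (0 : Fin 1)).continuous.continuousAt).comp this
  have hne : ∀ x, (w x).proj ∈ e.baseSet → (e (w x)).2 0 ≠ 0 := by
    intro x hx h0
    apply hw0 x
    apply (e.continuousLinearEquivAt ℝ (w x).proj hx).injective
    rw [map_zero]
    ext i
    fin_cases i
    exact h0
  have hdiv := (hcont u hu h).div (hcont w hw fun _ => rfl)
    (hne x₀ (FiberBundle.mem_baseSet_trivializationAt' _))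
  refine hdiv.congr_of_eventuallyEq ?_
  filter_upwards [hbase] with x hx
  refine (eq_div_iff (hne x hx)).2 ?_
  beta_reduce
  rw [hc x]
  have := congrArg (fun v : EuclideanSpace ℝ (Fin 1) => v 0)
    (map_smul (e.continuousLinearEquivAt ℝ (w x).proj hx) (c x) (w x).snd)
  exact this.symm

/-- The ratio of two nowhere vanishing fields is continuous and never zero, so its sign is constant
by the intermediate value theorem. -/
theorem TangentBundle.sameDirection_of_preconnected {X : Type*} [TopologicalSpace X]
    [PreconnectedSpace X] {u w : X → TangentBundle I M} (hu : Continuous u) (hw : Continuous w)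
    (h : ∀ x, (u x).proj = (w x).proj) (hu0 : ∀ x, (u x).snd ≠ 0) (hw0 : ∀ x, (w x).snd ≠ 0)
    {x₀ : X} (h0 : SameDirection (w x₀) (u x₀)) (x : X) : SameDirection (w x) (u x) := by
  obtain ⟨c, hc, hcu⟩ := exists_continuous_eq_smul hu hw h hw0
  have hc0 : ∀ x, c x ≠ 0 := by
    intro x hx
    have h1 := hcu x
    rw [hx, zero_smul] at h1
    have h2 := hu0 x
    rw [h1] at h2
    exact h2 rfl
  have hx₀ : 0 < c x₀ := by
    obtain ⟨d, hd, hdu⟩ := h0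
    rw [hcu x₀] at hdu
    have h1 : c x₀ • (w x₀).snd = d • (w x₀).snd := eq_of_heq (TotalSpace.mk.inj hdu).2
    have h2 := smul_left_injective ℝ (hw0 x₀) h1
    rwa [h2]
  refine ⟨c x, ?_, hcu x⟩
  by_contra hneg
  obtain ⟨y, hy⟩ := mem_range_of_exists_le_of_exists_ge hc ⟨x, not_lt.1 hneg⟩ ⟨x₀, hx₀.le⟩
  exact hc0 y hy

namespace PinMinusStructure

variable (P : PinMinus1 I M)

theorem continuous_tangent : Continuous P.tangent := P.continuous_frame _

theorem tangent_snd_ne_zero (q : P.Total) : (P.tangent q).snd ≠ 0 := by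
  intro h
  have := (P.frame q).map_eq_zero_iff.1 h
  exact one_ne_zero (congrFun this 0)

theorem tangent_smul (q : P.Total) (g : PinMinus 1) :
    P.tangent (op g • q) = ⟨P.proj q, PinMinus.sign g • (P.tangent q).snd⟩ := by
  refine (P.frame_smul q g _).trans ?_
  rw [PinMinus.rho_eq_sign_smul]
  exact congrArg (TotalSpace.mk (P.proj q)) (map_smul (P.frame q) _ _)

theorem sameDirection_tangent_unit_smul (q : P.Total) (u : ℤˣ) :
    SameDirection (P.tangent q) (P.tangent (op (PinMinus.unit u) • q)) :=
  ⟨1, one_pos, by rw [tangent_smul, PinMinus.sign_unit]; rfl⟩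

theorem sameDirection_tangent_smul {P : PinMinus1 I M} {P' : PinMinus1 I' M'} {q : P.Total}
    {q' : P'.Total} {f : M → M'}
    (h : SameDirection (tangentMap I I' f (P.tangent q)) (P'.tangent q')) (g : PinMinus 1) :
    SameDirection (tangentMap I I' f (P.tangent (op g • q))) (P'.tangent (op g • q')) := by
  obtain ⟨c, hc, h⟩ := h
  refine ⟨c, hc, ?_⟩
  have hp : P'.proj q' = f (P.proj q) := congrArg TotalSpace.proj h
  rw [tangent_smul, h, tangent_smul, hp]
  refine congrArg (TotalSpace.mk (f (P.proj q))) ?_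
  have h1 := map_smul (mfderiv I I' f (P.proj q)) (PinMinus.sign g) (P.tangent q).snd
  exact (smul_comm (PinMinus.sign g) c (mfderiv I I' f (P.proj q) (P.tangent q).snd)).trans
    (congrArg (c • ·) h1.symm)

/-- If a point of the fibre has the opposite direction, acting by `e` reverses it. -/
theorem exists_sameDirection_tangent {w : TangentBundle I M} (hw : w.snd ≠ 0) :
    ∃ q, SameDirection w (P.tangent q) := by
  obtain ⟨q, hq⟩ := P.exists_proj_eq w.proj
  obtain ⟨c, hc⟩ := TangentBundle.exists_eq_smul (u := P.tangent q) (w := w) hq hw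
  have hc0 : c ≠ 0 := by
    rintro rfl
    have := P.tangent_snd_ne_zero q
    rw [hc] at this
    exact this (zero_smul _ _)
  rcases hc0.lt_or_gt with h | h
  · refine ⟨op PinMinus.e • q, -c, neg_pos.2 h, ?_⟩
    rw [tangent_smul, PinMinus.sign_e, hc, hq]
    simp
  · exact ⟨q, c, h, hc⟩

/-- The element relating the two points acts on the line with positive sign, so it lies in the
kernel `{±1}` of `ρ`. All signs below arise here. -/
theorem exists_unit_smul_eq {w : TangentBundle I M} {q q' : P.Total}
    (hq : SameDirection w (P.tangent q)) (hq' : SameDirection w (P.tangent q')) :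
    ∃ u : ℤˣ, q' = op (PinMinus.unit u) • q := by
  obtain ⟨g, rfl⟩ := P.exists_smul_eq (q := q) (q' := q') (hq.proj_eq.trans hq'.proj_eq.symm)
  obtain ⟨c, hc, h⟩ := hq.symm.trans hq'
  rw [tangent_smul] at h
  have h1 : PinMinus.sign g • (P.tangent q).snd = c • (P.tangent q).snd :=
    eq_of_heq (TotalSpace.mk.inj h).2
  have h2 := _root_.smul_left_injective ℝ (P.tangent_snd_ne_zero q) h1
  obtain ⟨u, rfl⟩ := PinMinus.exists_unit_of_sign_pos (g := g) (h2 ▸ hc)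
  exact ⟨u, rfl⟩

end PinMinusStructure

end Direction

/-! ### Sections and lifts -/

namespace PinMinusStructure

section Sections

variable {n : ℕ} {B : Type} [TopologicalSpace B] {F : Type} {E : B → Type}
  [∀ x, AddCommGroup (E x)] [∀ x, Module ℝ (E x)] [TopologicalSpace (TotalSpace F E)]
  [TopologicalSpace F] [∀ x, TopologicalSpace (E x)] [FiberBundle F E]
  (P : PinMinusStructure n F E)

/-- The trivialization of the principal bundle given by a global section. -/
def sectionHomeomorph [ContinuousMul (PinMinus n)] (σ : B → P.Total) (hσ : Continuous σ)
    (hp : ∀ x, P.proj (σ x) = x) : B × PinMinus n ≃ₜ P.Total :=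
  have hex : ∀ q : P.Total, ∃ g : PinMinus n, q = op g • σ (P.proj q) :=
    fun q => P.exists_smul_eq (hp _)
  have hproj : ∀ (x : B) (g : PinMinus n), P.proj (op g • σ x) = x := fun x g => by
    rw [P.proj_smul, hp]
  { toFun := fun p => op p.2 • σ p.1
    invFun := fun q => (P.proj q, (hex q).choose)
    left_inv := fun ⟨x, g⟩ => by
      refine Prod.ext (hproj x g) (P.smul_left_injective (σ x) ?_)
      have := (hex (op g • σ x)).choose_spec
      simpa only [hproj] using this.symm
    right_inv := fun q => (hex q).choose_spec.symm
    continuous_toFun := P.continuous_smul.comp (continuous_snd.prodMk (hσ.comp continuous_fst))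
    continuous_invFun := P.continuous_proj.prodMk
      (P.continuous_of_smul_eq (hσ.comp P.continuous_proj) continuous_id
        fun q => (hex q).choose_spec) }

variable [DiscreteTopology (PinMinus n)] {γ : unitInterval → B}

/-- Path lifting in the covering `P.proj` serves as parallel transport. -/
theorem exists_lift (hγ : Continuous γ) {a : P.Total} (ha : P.proj a = γ 0) :
    ∃ s : unitInterval → P.Total, Continuous s ∧ (∀ x, P.proj (s x) = γ x) ∧ s 0 = a :=
  ⟨P.isCoveringMap_proj.liftPath ⟨γ, hγ⟩ a ha.symm, ContinuousMap.continuous _,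
    fun x => congrFun (P.isCoveringMap_proj.liftPath_lifts ⟨γ, hγ⟩ a ha.symm) x,
    P.isCoveringMap_proj.liftPath_zero ⟨γ, hγ⟩ a ha.symm⟩

theorem lift_unique {s s' : unitInterval → P.Total} (hs : Continuous s) (hs' : Continuous s')
    (h : ∀ x, P.proj (s x) = P.proj (s' x)) (h0 : s 0 = s' 0) : s = s' :=
  P.isCoveringMap_proj.eq_of_comp_eq hs hs' (funext h) 0 h0

end Sections

section

variable {H H' M M' : Type}
  [TopologicalSpace H] [TopologicalSpace H'] [TopologicalSpace M] [TopologicalSpace M']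
  {I : ModelWithCorners ℝ (EuclideanSpace ℝ (Fin 1)) H}
  {I' : ModelWithCorners ℝ (EuclideanSpace ℝ (Fin 1)) H'}
  [ChartedSpace H M] [ChartedSpace H' M'] [IsManifold I 1 M] [IsManifold I' 1 M']

/-- A section trivializes the bundle, so an equivariant map may be prescribed freely on it; the
frame condition then needs checking only along the section. -/
theorem exists_isPinMap_of_section (P : PinMinus1 I M) (P' : PinMinus1 I' M') {f : M → M'}
    {σ : M → P.Total} {s : M → P'.Total} (hσ : Continuous σ) (hs : Continuous s)
    (hp : ∀ x, P.proj (σ x) = x) (hp' : ∀ x, P'.proj (s x) = f x)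
    (hdir : ∀ x, SameDirection (tangentMap I I' f (P.tangent (σ x))) (P'.tangent (s x))) :
    ∃ j, IsPinMap P P' f j ∧ ∀ x, j (σ x) = s x := by
  let h := P.sectionHomeomorph σ hσ hp
  let k : M × PinMinus 1 → P'.Total := fun p => op p.2 • s p.1
  have hk : Continuous k := P'.continuous_smul.comp (continuous_snd.prodMk (hs.comp continuous_fst))
  have hj : ∀ x g, k (h.symm (op g • σ x)) = op g • s x := fun x g => by
    have : h.symm (op g • σ x) = (x, g) := by rw [Homeomorph.symm_apply_eq]; rfl
    rw [this]
  have hsurj : ∀ q, ∃ x g, q = op g • σ x := fun q =>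
    ⟨(h.symm q).1, (h.symm q).2, (h.apply_symm_apply q).symm⟩
  refine ⟨k ∘ h.symm, ⟨hk.comp h.symm.continuous, fun q => ?_, fun q g => ?_, fun q => ?_⟩,
    fun x => ?_⟩
  · obtain ⟨x, g, rfl⟩ := hsurj q
    rw [Function.comp, hj, P'.proj_smul, hp', P.proj_smul, hp]
  · obtain ⟨x, g', rfl⟩ := hsurj q
    simp only [Function.comp, smul_smul, ← op_mul, hj]
  · obtain ⟨x, g, rfl⟩ := hsurj q
    rw [Function.comp, hj]
    exact sameDirection_tangent_smul (hdir x) g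
  · have := hj x 1
    rwa [op_one, one_smul, one_smul] at this

end

end PinMinusStructure

/-- Two quotients of `Z` by the same relation. It compares bundles over circles, both glued from
`[0, 1] × Pin⁻₁`. -/
theorem exists_homeomorph_of_isQuotientMap {X Y Z : Type*} [TopologicalSpace X] [TopologicalSpace Y]
    [TopologicalSpace Z] {p : Z → X} {q : Z → Y} (hp : Topology.IsQuotientMap p)
    (hq : Topology.IsQuotientMap q) (h : ∀ z z', p z = p z' ↔ q z = q z') :
    ∃ j : X ≃ₜ Y, ∀ z, j (p z) = q z := by
  choose a ha using hp.surjective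
  choose b hb using hq.surjective
  have h1 : ∀ z, q (a (p z)) = q z := fun z => (h _ _).1 (ha _)
  have h2 : ∀ z, p (b (q z)) = p z := fun z => (h _ _).2 (hb _)
  refine ⟨⟨⟨fun x => q (a x), fun y => p (b y), fun x => ?_, fun y => ?_⟩, ?_, ?_⟩, h1⟩
  · exact (h2 _).trans (ha _)
  · exact (h1 _).trans (hb _)
  · exact hp.continuous_iff.2 (hq.continuous.congr fun z => (h1 z).symm)
  · exact hq.continuous_iff.2 (hp.continuous.congr fun z => (h2 z).symm)

/-! ### Velocities of paths -/

section Velocity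

variable {H M : Type} [TopologicalSpace H] [TopologicalSpace M]
  (I : ModelWithCorners ℝ (EuclideanSpace ℝ (Fin 1)) H) [ChartedSpace H M]

/-- The velocity vector of a path in a 1-manifold, possibly with boundary. -/
def pathVelocity (γ : unitInterval → M) (x : unitInterval) : TangentBundle I M :=
  tangentMap (𝓡∂ 1) I γ ⟨x, oneTangentSpaceIcc x⟩

/-- A `C¹` path whose velocity vanishes nowhere. -/
structure IsImmersedPath (γ : unitInterval → M) : Prop where
  contMDiff : ContMDiff (𝓡∂ 1) I 1 γ
  velocity_ne_zero : ∀ x, (pathVelocity I γ x).snd ≠ 0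

variable {I}

/-- By definition `oneTangentSpaceIcc` is the image of `1` under the derivative of `Set.projIcc`,
which is `C¹` on the closed interval. -/
theorem continuous_unitTangent :
    Continuous fun x : unitInterval =>
      (⟨x, oneTangentSpaceIcc x⟩ : TangentBundle (𝓡∂ 1) unitInterval) := by
  have h := (contMDiffOn_projIcc (x := (0 : ℝ)) (y := 1) (n := 1)).continuousOn_tangentMapWithin
    le_rfl (uniqueDiffOn_Icc zero_lt_one).uniqueMDiffOn
  have h1 : Continuous fun x : unitInterval => (⟨(x : ℝ), (1 : ℝ)⟩ : TangentBundle 𝓘(ℝ) ℝ) := by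
    have := (tangentBundleModelSpaceHomeomorph 𝓘(ℝ)).symm.continuous.comp
      (f := fun x : unitInterval => ((x : ℝ), (1 : ℝ))) (by fun_prop)
    exact this
  refine (h.comp_continuous h1 fun x => x.2).congr fun x => ?_
  have hx : Set.projIcc (0 : ℝ) 1 zero_le_one x = x := Set.projIcc_val zero_le_one x
  exact TotalSpace.ext hx (heq_of_eq (oneTangentSpaceIcc_def x).symm)

theorem unitTangent_ne_zero (x : unitInterval) : oneTangentSpaceIcc x ≠ 0 := by
  intro h
  have h1 := mfderiv_subtypeVal_Icc_one x
  have h2 : (1 : TangentSpace (𝓡∂ 1) x) = 0 := h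
  rw [h2, map_zero] at h1
  exact zero_ne_one (α := ℝ) h1

theorem IsImmersedPath.continuous {γ : unitInterval → M} (h : IsImmersedPath I γ) : Continuous γ :=
  h.contMDiff.continuous

theorem IsImmersedPath.continuous_pathVelocity [IsManifold I 1 M] {γ : unitInterval → M}
    (h : IsImmersedPath I γ) :
    Continuous (pathVelocity I γ) :=
  (h.contMDiff.continuous_tangentMap le_rfl).comp continuous_unitTangent

theorem pathVelocity_id (x : unitInterval) :
    pathVelocity (𝓡∂ 1) id x = ⟨x, oneTangentSpaceIcc x⟩ := by
  rw [pathVelocity, tangentMap_id]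
  rfl

theorem pathVelocity_comp {H' M' : Type} [TopologicalSpace H'] [TopologicalSpace M']
    {I' : ModelWithCorners ℝ (EuclideanSpace ℝ (Fin 1)) H'} [ChartedSpace H' M']
    {γ : unitInterval → M} {f : M → M'}
    (hf : MDifferentiable I I' f) (hγ : MDifferentiable (𝓡∂ 1) I γ) (x : unitInterval) :
    pathVelocity I' (f ∘ γ) x = tangentMap I I' f (pathVelocity I γ x) := by
  simp only [pathVelocity]
  rw [tangentMap_comp_at _ (hf _) (hγ _)]

end Velocity

section AffinePaths

theorem contMDiff_affine {φ : unitInterval → unitInterval} {a b : ℝ}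
    (hφ : ∀ x, (φ x : ℝ) = a * x + b) : ContMDiff (𝓡∂ 1) (𝓡∂ 1) 1 φ := by
  have hcomp : (fun z : unitInterval => (z : ℝ)) ∘ φ = (fun t : ℝ => a * t + b) ∘ Subtype.val :=
    funext hφ
  refine contMDiff_iff_comp_subtypeVal_Icc.2 ⟨?_, ?_⟩
  · refine Continuous.congr (f := fun x : unitInterval => (⟨a * x + b, hφ x ▸ (φ x).2⟩ : unitInterval))
      (Continuous.subtype_mk (by fun_prop) _) fun x => Subtype.ext (hφ x).symm
  · rw [hcomp]
    have : ContDiff ℝ 1 fun t : ℝ => a * t + b := by fun_prop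
    exact this.contMDiff.comp contMDiff_subtypeVal_Icc

/-- The inclusion into `ℝ` sends `oneTangentSpaceIcc` to `1`; differentiating its composite with `φ`
in two ways identifies the factor as `a`. -/
theorem sameDirection_pathVelocity_affine {φ : unitInterval → unitInterval} {a b : ℝ} (ha : 0 < a)
    (hφ : ∀ x, (φ x : ℝ) = a * x + b) (x : unitInterval) :
    SameDirection ⟨φ x, oneTangentSpaceIcc (φ x)⟩ (pathVelocity (𝓡∂ 1) φ x) := by
  have hd : ∀ y, MDifferentiableAt (𝓡∂ 1) 𝓘(ℝ) (Subtype.val : unitInterval → ℝ) y := fun y =>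
    (contMDiff_subtypeVal_Icc (n := 1) y).mdifferentiableAt one_ne_zero
  have hdφ : MDifferentiableAt (𝓡∂ 1) (𝓡∂ 1) φ x :=
    (contMDiff_affine hφ x).mdifferentiableAt one_ne_zero
  have hda : HasDerivAt (fun t : ℝ => a * t + b) a (x : ℝ) := by
    simpa using ((hasDerivAt_id (x : ℝ)).const_mul a).add_const b
  obtain ⟨c, hc⟩ := TangentBundle.exists_eq_smul (u := pathVelocity (𝓡∂ 1) φ x)
    (w := ⟨φ x, oneTangentSpaceIcc (φ x)⟩) rfl (unitTangent_ne_zero _)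
  have h1 : mfderiv (𝓡∂ 1) 𝓘(ℝ) (Subtype.val ∘ φ) x (oneTangentSpaceIcc x) = a := by
    have hcomp : (Subtype.val : unitInterval → ℝ) ∘ φ = (fun t : ℝ => a * t + b) ∘ Subtype.val :=
      funext hφ
    rw [hcomp, mfderiv_comp x hda.differentiableAt.mdifferentiableAt (hd x),
      ContinuousLinearMap.comp_apply]
    have h2 : mfderiv (𝓡∂ 1) 𝓘(ℝ) (Subtype.val : unitInterval → ℝ) x (oneTangentSpaceIcc x) =
      (1 : ℝ) := mfderiv_subtypeVal_Icc_one x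
    rw [h2, mfderiv_eq_fderiv]
    rw [hda.hasFDerivAt.fderiv]
    have h4 : ContinuousLinearMap.toSpanSingleton ℝ a (1 : ℝ) = a := by simp
    exact h4
  rw [mfderiv_comp x (hd (φ x)) hdφ, ContinuousLinearMap.comp_apply] at h1
  have h3 : mfderiv (𝓡∂ 1) (𝓡∂ 1) φ x (oneTangentSpaceIcc x) = c • oneTangentSpaceIcc (φ x) :=
    eq_of_heq (TotalSpace.mk.inj hc).2
  have h2 : mfderiv (𝓡∂ 1) 𝓘(ℝ) (Subtype.val : unitInterval → ℝ) (φ x)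
    (oneTangentSpaceIcc (φ x)) = (1 : ℝ) := mfderiv_subtypeVal_Icc_one (φ x)
  rw [h3, map_smul, h2] at h1
  have hca : c * 1 = a := h1
  exact ⟨c, by linarith, hc⟩

theorem isImmersedPath_affine {φ : unitInterval → unitInterval} {a b : ℝ} (ha : 0 < a)
    (hφ : ∀ x, (φ x : ℝ) = a * x + b) : IsImmersedPath (𝓡∂ 1) φ :=
  ⟨contMDiff_affine hφ, fun x =>
    (sameDirection_pathVelocity_affine ha hφ x).snd_ne_zero (unitTangent_ne_zero _)⟩

end AffinePaths

/-! ### Pin⁻ structures from framings -/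

/-- The product `B × G`, restricted to the whole of `B`. -/
def univProdHomeomorph (B G : Type) [TopologicalSpace B]
    [TopologicalSpace G] : ↥(Set.univ : Set B) × G ≃ₜ ↥(Prod.fst ⁻¹' Set.univ : Set (B × G)) :=
  ((Homeomorph.Set.univ B).prodCongr (Homeomorph.refl G)).trans (Homeomorph.Set.univ (B × G)).symm

section Framing

variable {H M : Type} [TopologicalSpace H] [TopologicalSpace M]
  {I : ModelWithCorners ℝ (EuclideanSpace ℝ (Fin 1)) H} [ChartedSpace H M]

/-- The frame of a tangent line given by a nonzero vector. -/
def lineEquiv {x : M} (w : TangentSpace I x) (hw : w ≠ 0) : (Fin 1 → ℝ) ≃ₗ[ℝ] TangentSpace I x :=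
  (LinearEquiv.funUnique (Fin 1) ℝ ℝ).trans
    (LinearEquiv.ofBijective (LinearMap.toSpanSingleton ℝ (TangentSpace I x) w)
      ⟨fun _ _ h => smul_left_injective ℝ hw h, fun v =>
        exists_smul_eq_of_finrank_eq_one (finrank_euclideanSpace_fin (𝕜 := ℝ) (n := 1)) hw v⟩)

theorem lineEquiv_apply {x : M} (w : TangentSpace I x) (hw : w ≠ 0) (v : Fin 1 → ℝ) :
    lineEquiv w hw v = v 0 • w := rfl

variable [IsManifold I 1 M]

theorem continuous_smul_tangent {A : Type*} [TopologicalSpace A] {c : A → ℝ}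
    {w : A → TangentBundle I M} (hc : Continuous c) (hw : Continuous w) :
    Continuous fun a => (⟨(w a).proj, c a • (w a).snd⟩ : TangentBundle I M) := by
  refine continuous_iff_continuousAt.2 fun a₀ => ?_
  have h := (FiberBundle.continuousAt_totalSpace _ _).1 (hw.continuousAt (x := a₀))
  refine (FiberBundle.continuousAt_totalSpace _ _).2 ⟨h.1, ?_⟩
  let e := trivializationAt (EuclideanSpace ℝ (Fin 1)) (TangentSpace I) (w a₀).proj
  have hbase : ∀ᶠ a in nhds a₀, (w a).proj ∈ e.baseSet :=
    h.1.eventually (e.open_baseSet.mem_nhds (FiberBundle.mem_baseSet_trivializationAt' _))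
  refine (hc.continuousAt.smul h.2).congr_of_eventuallyEq ?_
  filter_upwards [hbase] with a ha
  exact map_smul (e.continuousLinearEquivAt ℝ (w a).proj ha) (c a) (w a).snd

/-- The pin⁻ structure given by a nowhere vanishing vector field. -/
def PinMinusStructure.ofFraming (X : ∀ x : M, TangentSpace I x)
    (hX : Continuous fun x => (⟨x, X x⟩ : TangentBundle I M)) (hX0 : ∀ x, X x ≠ 0) :
    PinMinus1 I M where
  Total := M × PinMinus 1
  act :=
    { smul := fun g p => (p.1, p.2 * g.unop)
      one_smul := fun p => Prod.ext rfl (mul_one p.2)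
      mul_smul := fun g g' p => Prod.ext rfl (mul_assoc p.2 g'.unop g.unop).symm }
  proj := Prod.fst
  locally_trivial := fun x =>
    ⟨Set.univ, isOpen_univ, trivial, univProdHomeomorph M (PinMinus 1), fun _ => rfl,
      fun _ _ _ => rfl⟩
  frame := fun p => lineEquiv (PinMinus.sign p.2 • X p.1)
    (smul_ne_zero (PinMinus.sign_ne_zero p.2) (hX0 p.1))
  continuous_frame := fun v => by
    have h1 : Continuous fun p : M × PinMinus 1 => v 0 * PinMinus.sign p.2 :=
      continuous_const.mul
        ((continuous_of_discreteTopology (f := PinMinus.sign)).comp continuous_snd)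
    refine (continuous_smul_tangent h1 (hX.comp continuous_fst)).congr fun p => ?_
    rw [lineEquiv_apply, smul_smul]
    rfl
  frame_smul := fun p g v => by
    refine congrArg (TotalSpace.mk p.1) ?_
    rw [lineEquiv_apply, lineEquiv_apply, PinMinus.rho_eq_sign_smul]
    change v 0 • PinMinus.sign (p.2 * g) • X p.1 =
      (PinMinus.sign g • v 0) • PinMinus.sign p.2 • X p.1
    rw [PinMinus.sign_mul, smul_smul, smul_smul, smul_eq_mul]
    congr 1
    ring

theorem PinMinusStructure.tangent_ofFraming (X : ∀ x : M, TangentSpace I x)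
    (hX : Continuous fun x => (⟨x, X x⟩ : TangentBundle I M)) (hX0 : ∀ x, X x ≠ 0)
    (p : M × PinMinus 1) :
    (PinMinusStructure.ofFraming X hX hX0).tangent p = ⟨p.1, PinMinus.sign p.2 • X p.1⟩ :=
  congrArg (TotalSpace.mk p.1) (one_smul ℝ _)

end Framing

/-! ### The sign of a relative pin⁻ structure -/

namespace PinMinusStructure

variable {H' M' : Type} [TopologicalSpace H'] [TopologicalSpace M']
  {I' : ModelWithCorners ℝ (EuclideanSpace ℝ (Fin 1)) H'} [ChartedSpace H' M'] [IsManifold I' 1 M']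

theorem sameDirection_lift (P : PinMinus1 I' M') {γ : unitInterval → M'} (hγ : IsImmersedPath I' γ)
    {s : unitInterval → P.Total} (hs : Continuous s) (hp : ∀ x, P.proj (s x) = γ x)
    (h0 : SameDirection (pathVelocity I' γ 0) (P.tangent (s 0))) (x : unitInterval) :
    SameDirection (pathVelocity I' γ x) (P.tangent (s x)) :=
  TangentBundle.sameDirection_of_preconnected (P.continuous_tangent.comp hs)
    hγ.continuous_pathVelocity hp (fun _ => P.tangent_snd_ne_zero _) hγ.velocity_ne_zero h0 x

end PinMinusStructure

namespace RelPinInterval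

theorem isImmersedPath_id : IsImmersedPath (𝓡∂ 1) (id : unitInterval → unitInterval) :=
  isImmersedPath_affine one_pos (b := 0) fun x => by simp

theorem exists_path (r : RelPinInterval) :
    ∃ s : unitInterval → r.pin.Total, Continuous s ∧ (∀ x, r.pin.proj (s x) = x) ∧ s 0 = r.left :=
  r.pin.exists_lift continuous_id (r.left_dir.proj_eq)

/-- The parallel transport of the left end. -/
def path (r : RelPinInterval) : unitInterval → r.pin.Total := r.exists_path.choose

theorem continuous_path (r : RelPinInterval) : Continuous r.path := r.exists_path.choose_spec.1

theorem proj_path (r : RelPinInterval) (x : unitInterval) : r.pin.proj (r.path x) = x :=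
  r.exists_path.choose_spec.2.1 x

theorem path_zero (r : RelPinInterval) : r.path 0 = r.left := r.exists_path.choose_spec.2.2

theorem sameDirection_path (r : RelPinInterval) (x : unitInterval) :
    SameDirection ⟨x, oneTangentSpaceIcc x⟩ (r.pin.tangent (r.path x)) := by
  have := r.pin.sameDirection_lift isImmersedPath_id r.continuous_path r.proj_path
    (by rw [pathVelocity_id, path_zero]; exact r.left_dir) x
  rwa [pathVelocity_id] at this

theorem exists_sgn (r : RelPinInterval) : ∃ u : ℤˣ, r.right = op (PinMinus.unit u) • r.path 1 :=
  r.pin.exists_unit_smul_eq (r.sameDirection_path 1) r.right_dir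

/-- The sign comparing the right end with the parallel transport of the left end. -/
def sgn (r : RelPinInterval) : ℤˣ := r.exists_sgn.choose

theorem right_eq (r : RelPinInterval) : r.right = op (PinMinus.unit r.sgn) • r.path 1 :=
  r.exists_sgn.choose_spec

/-- A relative pin⁻ structure with given sign. -/
def ofSgn (u : ℤˣ) : RelPinInterval where
  pin := .ofFraming (fun x => oneTangentSpaceIcc x) continuous_unitTangent unitTangent_ne_zero
  left := ((0 : unitInterval), (1 : PinMinus 1))
  right := ((1 : unitInterval), PinMinus.unit u)
  left_dir := ⟨1, one_pos, by
    rw [PinMinusStructure.tangent_ofFraming, PinMinus.sign_one]⟩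
  right_dir := ⟨1, one_pos, by
    rw [PinMinusStructure.tangent_ofFraming, PinMinus.sign_unit]⟩

theorem sgn_eq_of_path (r : RelPinInterval) {s : unitInterval → r.pin.Total} {u : ℤˣ}
    (hs : Continuous s) (hp : ∀ x, r.pin.proj (s x) = x) (h0 : s 0 = r.left)
    (h1 : r.right = op (PinMinus.unit u) • s 1) : r.sgn = u := by
  have : s = r.path := r.pin.lift_unique hs r.continuous_path
    (fun x => (hp x).trans (r.proj_path x).symm) (h0.trans r.path_zero.symm)
  rw [this, r.right_eq] at h1
  exact PinMinus.unit_injective (r.pin.smul_left_injective _ h1)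

theorem sgn_ofSgn (u : ℤˣ) : (ofSgn u).sgn = u := by
  refine sgn_eq_of_path (ofSgn u) (s := fun x => (x, (1 : PinMinus 1))) ?_ (fun x => rfl) rfl ?_
  · exact continuous_id.prodMk continuous_const
  · exact Prod.ext rfl (one_mul (PinMinus.unit u)).symm

variable {H' M' : Type} [TopologicalSpace H'] [TopologicalSpace M']
  {I' : ModelWithCorners ℝ (EuclideanSpace ℝ (Fin 1)) H'} [ChartedSpace H' M'] [IsManifold I' 1 M']

/-- A pin⁻ map carries transport to transport, by uniqueness of lifts, so the sign can be read off
in any target. Every later sign computation uses this. -/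
theorem apply_right_of_isPinMap (r : RelPinInterval) {P : PinMinus1 I' M'}
    {γ : unitInterval → M'} {j : r.pin.Total → P.Total} (hj : r.pin.IsPinMap P γ j)
    {s : unitInterval → P.Total} (hs : Continuous s) (hp : ∀ x, P.proj (s x) = γ x)
    (h0 : s 0 = j r.left) : j r.right = op (PinMinus.unit r.sgn) • s 1 := by
  have : s = j ∘ r.path := P.lift_unique hs (hj.continuous.comp r.continuous_path)
    (fun x => by rw [hp, Function.comp, hj.proj, r.proj_path])
    (by rw [h0, Function.comp, r.path_zero])
  rw [this, r.right_eq, hj.equivariant]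
  rfl

/-- Send the transport of the left end to the lift of `γ` starting at `a`. Only the image of the
right end is then forced. -/
theorem exists_isPinMap (r : RelPinInterval) (P : PinMinus1 I' M') {γ : unitInterval → M'}
    (hγ : IsImmersedPath I' γ) {a : P.Total} (ha : SameDirection (pathVelocity I' γ 0) (P.tangent a)) :
    ∃ j, r.pin.IsPinMap P γ j ∧ j r.left = a := by
  obtain ⟨s, hs, hp, h0⟩ := P.exists_lift hγ.continuous (a := a) ha.proj_eq
  obtain ⟨j, hj, hjs⟩ := r.pin.exists_isPinMap_of_section P (f := γ) r.continuous_path hs r.proj_path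
    hp fun x => ((r.sameDirection_path x).symm.tangentMap γ).trans
      (P.sameDirection_lift hγ hs hp (by rwa [h0]) x)
  exact ⟨j, hj, by rw [← r.path_zero, hjs, h0]⟩

/-- A map matching the left ends always exists; it matches the right ends exactly when the signs
agree. -/
theorem equivalent_iff (r r' : RelPinInterval) : r ≈ r' ↔ r.sgn = r'.sgn := by
  constructor
  · rintro ⟨j, hj, hl, hr⟩
    have := r.apply_right_of_isPinMap hj r'.continuous_path r'.proj_path
      (by rw [hl, r'.path_zero])
    rw [hr] at this
    exact (r'.sgn_eq_of_path r'.continuous_path r'.proj_path r'.path_zero this).symm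
  · intro h
    have hdir : SameDirection (pathVelocity (𝓡∂ 1) id 0) (r'.pin.tangent r'.left) := by
      rw [pathVelocity_id]; exact r'.left_dir
    have hdir' : SameDirection (pathVelocity (𝓡∂ 1) id 0) (r.pin.tangent r.left) := by
      rw [pathVelocity_id]; exact r.left_dir
    obtain ⟨j, hj, hjl⟩ := r.exists_isPinMap r'.pin isImmersedPath_id hdir
    obtain ⟨k, hk, hkl⟩ := r'.exists_isPinMap r.pin isImmersedPath_id hdir'
    -- The composite `k ∘ j` fixes `r.path` by uniqueness of lifts, hence everything by
    -- equivariance, because `r.path` meets every fibre.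
    have inv : ∀ (r r' : RelPinInterval) (j : r.pin.Total → r'.pin.Total)
        (k : r'.pin.Total → r.pin.Total), r.pin.IsPinMap r'.pin id j → r'.pin.IsPinMap r.pin id k →
        j r.left = r'.left → k r'.left = r.left → ∀ q, k (j q) = q := by
      intro r r' j k hj hk hjl hkl q
      have hpath : (fun x => k (j (r.path x))) = r.path :=
        r.pin.lift_unique (hk.continuous.comp (hj.continuous.comp r.continuous_path))
          r.continuous_path (fun x => by rw [hk.proj, hj.proj]; rfl)
          (by rw [r.path_zero, hjl, hkl])
      obtain ⟨g, hg⟩ := r.pin.exists_smul_eq (q := r.path (r.pin.proj q)) (q' := q) (r.proj_path _)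
      have := congrFun hpath (r.pin.proj q)
      rw [hg, hj.equivariant, hk.equivariant, this]
    refine ⟨⟨⟨j, k, inv r r' j k hj hk hjl hkl, inv r' r k j hk hj hkl hjl⟩, hj.continuous,
      hk.continuous⟩, hj, hjl, ?_⟩
    have := r.apply_right_of_isPinMap hj r'.continuous_path r'.proj_path
      (by rw [hjl, r'.path_zero])
    rw [h, ← r'.right_eq] at this
    exact this

theorem firstHalf_eq (x : unitInterval) : (firstHalf x : ℝ) = 1 / 2 * x + 0 := by
  simp only [firstHalf]; ring

theorem secondHalf_eq (x : unitInterval) : (secondHalf x : ℝ) = 1 / 2 * x + 1 / 2 := by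
  simp only [secondHalf]; ring

theorem firstHalf_zero : firstHalf 0 = 0 := Subtype.ext (by simp [firstHalf])

theorem secondHalf_one : secondHalf 1 = 1 := Subtype.ext (by simp [secondHalf])

theorem firstHalf_one : firstHalf 1 = secondHalf 0 := Subtype.ext (by simp [firstHalf, secondHalf])

theorem isImmersedPath_firstHalf : IsImmersedPath (𝓡∂ 1) firstHalf :=
  isImmersedPath_affine one_half_pos firstHalf_eq

theorem isImmersedPath_secondHalf : IsImmersedPath (𝓡∂ 1) secondHalf :=
  isImmersedPath_affine one_half_pos secondHalf_eq

theorem IsConcatenation.sgn_eq {r₁ r₂ r : RelPinInterval} (h : IsConcatenation r₁ r₂ r) :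
    r.sgn = r₁.sgn * r₂.sgn := by
  obtain ⟨j₁, j₂, h₁, h₂, hl, hm, hr⟩ := h
  have e1 := r₁.apply_right_of_isPinMap h₁ (s := r.path ∘ firstHalf)
    (r.continuous_path.comp isImmersedPath_firstHalf.continuous) (fun x => r.proj_path _)
    (by rw [Function.comp, firstHalf_zero, r.path_zero, hl])
  have e2 := r₂.apply_right_of_isPinMap h₂
    -- The lift over the second half has to start at the glued point, which differs from the
    -- transport of `r.left` by the first sign; so the signs accumulate.
    (s := fun x => op (PinMinus.unit r₁.sgn) • r.path (secondHalf x))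
    (r.pin.continuous_smul.comp (continuous_const.prodMk
      (r.continuous_path.comp isImmersedPath_secondHalf.continuous)))
    (fun x => by rw [r.pin.proj_smul, r.proj_path])
    (by rw [← hm, e1, Function.comp, firstHalf_one])
  rw [hr, smul_smul, ← op_mul, ← map_mul, secondHalf_one] at e2
  exact r.sgn_eq_of_path r.continuous_path r.proj_path r.path_zero e2

theorem exists_isConcatenation (r₁ r₂ : RelPinInterval) : ∃ r, IsConcatenation r₁ r₂ r := by
  -- A concatenation must have this sign, so the standard model with this sign is the candidate.
  let r := ofSgn (r₁.sgn * r₂.sgn)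
  have d1 : SameDirection (pathVelocity (𝓡∂ 1) firstHalf 0) (r.pin.tangent r.left) := by
    have := sameDirection_pathVelocity_affine one_half_pos firstHalf_eq 0
    rw [firstHalf_zero] at this
    exact this.symm.trans r.left_dir
  obtain ⟨j₁, h₁, hl⟩ := r₁.exists_isPinMap r.pin isImmersedPath_firstHalf d1
  have e1 := r₁.apply_right_of_isPinMap h₁ (s := r.path ∘ firstHalf)
    (r.continuous_path.comp isImmersedPath_firstHalf.continuous) (fun x => r.proj_path _)
    (by rw [Function.comp, firstHalf_zero, r.path_zero, hl])
  have d2 : SameDirection (pathVelocity (𝓡∂ 1) secondHalf 0) (r.pin.tangent (j₁ r₁.right)) := by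
    have h := sameDirection_pathVelocity_affine one_half_pos secondHalf_eq 0
    rw [e1, Function.comp, firstHalf_one]
    exact (h.symm.trans (r.sameDirection_path _)).trans
      (r.pin.sameDirection_tangent_unit_smul _ _)
  obtain ⟨j₂, h₂, hm⟩ := r₂.exists_isPinMap r.pin isImmersedPath_secondHalf d2
  have e2 := r₂.apply_right_of_isPinMap h₂
    (s := fun x => op (PinMinus.unit r₁.sgn) • r.path (secondHalf x))
    (r.pin.continuous_smul.comp (continuous_const.prodMk
      (r.continuous_path.comp isImmersedPath_secondHalf.continuous)))
    (fun x => by rw [r.pin.proj_smul, r.proj_path])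
    (by rw [hm, e1, Function.comp, firstHalf_one])
  refine ⟨r, j₁, j₂, h₁, h₂, hl, hm.symm, ?_⟩
  rw [e2, smul_smul, ← op_mul, ← map_mul, secondHalf_one, r.right_eq, sgn_ofSgn]

/-- The sign, as a bijection of the set of equivalence classes with `{±1}`. -/
def classesEquiv : Classes ≃ ℤˣ where
  toFun := Quotient.lift sgn fun r r' h => (equivalent_iff r r').1 h
  invFun u := ⟦ofSgn u⟧
  left_inv := by
    rintro ⟨r⟩
    exact Quotient.sound ((equivalent_iff _ _).2 (sgn_ofSgn _))
  right_inv := sgn_ofSgn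

end RelPinInterval

/-! ### Sections over circles -/

theorem PinMinus.complexEquiv_unit (u : ℤˣ) :
    PinMinus.complexEquiv (PinMinus.unit u : ClMinus 1) = ((u : ℤ) : ℂ) := by
  rcases Int.units_eq_one_or u with rfl | rfl
  · rw [map_one, OneMemClass.coe_one, map_one]; simp
  · rw [PinMinus.unit_neg_one, PinMinus.complexEquiv_e_sq]; simp

theorem PinMinus.complexEquiv_ne_zero (g : PinMinus 1) :
    PinMinus.complexEquiv (g : ClMinus 1) ≠ 0 := by
  intro h
  have := PinMinus.normSq_complexEquiv g
  simp [h] at this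

/-- A cyclic primitive of a family of signs with product one. -/
theorem exists_cyclic_primitive {n : ℕ} [NeZero n] {u : Fin n → ℤˣ} (hu : ∏ i, u i = 1) :
    ∃ v : Fin n → ℤˣ, ∀ i, v (i + 1) = v i * u i := by
  obtain ⟨m, rfl⟩ := Nat.exists_eq_succ_of_ne_zero (NeZero.ne n)
  -- The signs are extended by `1` to `ℕ`, so that partial products can serve as the primitive.
  let w : ℕ → ℤˣ := fun k => if h : k < m + 1 then u ⟨k, h⟩ else 1
  have hw : ∀ i : Fin (m + 1), w i = u i := fun i => dif_pos i.2
  refine ⟨fun i => ∏ k ∈ Finset.range i, w k, fun i => ?_⟩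
  rw [← hw i, ← Finset.prod_range_succ]
  refine Fin.lastCases ?_ (fun j => ?_) i
  -- At the last index the successor is `0`, with empty partial product; this is where the total
  -- product has to be one.
  · rw [Fin.last_add_one]
    have : ∏ k ∈ Finset.range (m + 1), w k = 1 := by
      rw [Finset.prod_range, ← hu]
      exact Finset.prod_congr rfl fun i _ => hw i
    rw [Fin.val_last, this]
    simp
  · rw [Fin.coeSucc_eq_succ]
    simp

namespace PinMinusStructure

section

variable {n : ℕ} {B : Type} [TopologicalSpace B] {F : Type} {E : B → Type}
  [∀ x, AddCommGroup (E x)] [∀ x, Module ℝ (E x)] [TopologicalSpace (TotalSpace F E)]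

/-- The principal bundle has a global section. -/
def HasSection (P : PinMinusStructure n F E) : Prop :=
  ∃ σ : B → P.Total, Continuous σ ∧ ∀ x, P.proj (σ x) = x

end

variable {H M : Type} [TopologicalSpace H] [TopologicalSpace M]
  {I : ModelWithCorners ℝ (EuclideanSpace ℝ (Fin 1)) H} [ChartedSpace H M] [IsManifold I 1 M]

/-- On each edge the lift differs from the section by a constant `g i`, and passing a vertex
multiplies this constant by `u i`. Going once around the circle returns to the same constant. -/
theorem prod_eq_one_of_hasSection {P : PinMinus1 I M} (hP : P.HasSection) {n : ℕ} [NeZero n]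
    {γ : Fin n → unitInterval → M} (hγ : ∀ i, Continuous (γ i)) (h1 : ∀ i, γ i 1 = γ (i + 1) 0)
    {s : Fin n → unitInterval → P.Total} (hs : ∀ i, Continuous (s i))
    (hp : ∀ i x, P.proj (s i x) = γ i x) {u : Fin n → ℤˣ}
    (hu : ∀ i, s (i + 1) 0 = op (PinMinus.unit (u i)) • s i 1) : ∏ i, u i = 1 := by
  obtain ⟨σ, hσ, hσp⟩ := hP
  choose g hg using fun i =>
    P.exists_smul_eq (q := σ (γ i 0)) (q' := s i 0) ((hσp _).trans (hp i 0).symm)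
  have hg' : ∀ i x, s i x = op (g i) • σ (γ i x) := fun i => congrFun <|
    P.lift_unique (hs i) (P.continuous_smul.comp (continuous_const.prodMk (hσ.comp (hγ i))))
      (fun x => by rw [P.proj_smul, hp, hσp]) (hg i)
  have hstep : ∀ i, g (i + 1) = g i * PinMinus.unit (u i) := by
    intro i
    have h := hu i
    rw [hg', hg', smul_smul, ← op_mul, h1] at h
    exact P.smul_left_injective _ h
  -- The relations are multiplied together inside the field `ℂ`, where the factors commute and
  -- cancel; the cyclic shift permutes the left side.
  have hz : ∏ i, PinMinus.complexEquiv (g i : ClMinus 1) =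
      (∏ i, PinMinus.complexEquiv (g i : ClMinus 1)) * ∏ i, (((u i : ℤˣ) : ℤ) : ℂ) := by
    rw [← Finset.prod_mul_distrib]
    refine (Equiv.prod_comp (Equiv.addRight (1 : Fin n)) _).symm.trans
      (Finset.prod_congr rfl fun i _ => ?_)
    rw [Equiv.coe_addRight, hstep, Submonoid.coe_mul, map_mul, PinMinus.complexEquiv_unit]
  have hne : ∏ i, PinMinus.complexEquiv (g i : ClMinus 1) ≠ 0 :=
    Finset.prod_ne_zero_iff.2 fun i _ => PinMinus.complexEquiv_ne_zero _
  have hone : ∏ i, (((u i : ℤˣ) : ℤ) : ℂ) = 1 := (mul_eq_left₀ hne).1 hz.symm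
  have hone' : ∏ i, ((u i : ℤˣ) : ℤ) = 1 := by exact_mod_cast hone
  apply Units.ext
  rw [Units.coe_prod, hone', Units.val_one]

/-- Correcting the lift on edge `i` by a cyclic primitive `v i` of the signs makes the lifts agree
at the vertices, so they descend along the quotient map from the disjoint union of the edges. -/
theorem hasSection_of_prod_eq_one [T2Space M] {P : PinMinus1 I M} {n : ℕ} [NeZero n]
    {γ : Fin n → unitInterval → M} (hγ : ∀ i, Continuous (γ i)) (h1 : ∀ i, γ i 1 = γ (i + 1) 0)
    (hex : ∀ x : M, ∃! p : Fin n × unitInterval, p.2 ≠ 1 ∧ γ p.1 p.2 = x)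
    {s : Fin n → unitInterval → P.Total} (hs : ∀ i, Continuous (s i))
    (hp : ∀ i x, P.proj (s i x) = γ i x) {u : Fin n → ℤˣ}
    (hu : ∀ i, s (i + 1) 0 = op (PinMinus.unit (u i)) • s i 1) (hprod : ∏ i, u i = 1) :
    P.HasSection := by
  obtain ⟨v, hv⟩ := exists_cyclic_primitive hprod
  let q : Fin n × unitInterval → M := fun p => γ p.1 p.2
  let t : Fin n × unitInterval → P.Total := fun p => op (PinMinus.unit (v p.1)) • s p.1 p.2
  have hq : Continuous q := continuous_prod_of_discrete_left.2 hγ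
  have ht : Continuous t := continuous_prod_of_discrete_left.2 fun i =>
    P.continuous_smul.comp (f := fun x => (PinMinus.unit (v i), s i x))
      (continuous_const.prodMk (hs i))
  have hqs : Function.Surjective q := fun x => (hex x).exists.imp fun p hp => hp.2
  have hquot : Topology.IsQuotientMap q := hq.isClosedMap.isQuotientMap hq hqs
  -- End points of edges are replaced by the start of the next edge, after which `hex` makes
  -- representatives unique.
  have hwrap : ∀ p : Fin n × unitInterval, ∃ p' : Fin n × unitInterval, p'.2 ≠ 1 ∧ q p' = q p ∧
      t p' = t p := by
    rintro ⟨i, x⟩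
    by_cases hx : x = 1
    · subst hx
      refine ⟨(i + 1, 0), zero_ne_one, (h1 i).symm, ?_⟩
      change op (PinMinus.unit (v (i + 1))) • s (i + 1) 0 = op (PinMinus.unit (v i)) • s i 1
      rw [hu, smul_smul, ← op_mul, ← map_mul, hv, mul_comm (v i), ← mul_assoc, Int.units_mul_self,
        one_mul]
    · exact ⟨(i, x), hx, rfl, rfl⟩
  have hcompat : ∀ p p', q p = q p' → t p = t p' := by
    intro p p' hpp
    obtain ⟨r, hr, hrq, hrt⟩ := hwrap p
    obtain ⟨r', hr', hrq', hrt'⟩ := hwrap p'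
    have : r = r' := (hex (q p)).unique ⟨hr, hrq⟩ ⟨hr', hrq'.trans hpp.symm⟩
    rw [← hrt, ← hrt', this]
  refine ⟨fun x => t (Function.surjInv hqs x), hquot.continuous_iff.2 (ht.congr fun p =>
    hcompat _ _ (Function.surjInv_eq hqs (q p)).symm), fun x => ?_⟩
  refine (P.proj_smul _ _).trans ((hp _ _).trans ?_)
  exact Function.surjInv_eq hqs x

/-! ### Circles with one edge: the holonomy sign and its gluing -/

/-- A loop which is injective except for its endpoints. -/
def IsSimpleLoop {M : Type} (γ : unitInterval → M) : Prop :=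
  Function.Surjective γ ∧
    ∀ x y, γ x = γ y ↔ x = y ∨ (x = 0 ∧ y = 1) ∨ (x = 1 ∧ y = 0)

theorem IsSimpleLoop.existsUnique {M : Type} {γ : unitInterval → M} (h : IsSimpleLoop γ) (x : M) :
    ∃! p : Fin 1 × unitInterval, p.2 ≠ 1 ∧ γ p.2 = x := by
  have hex : ∃ y : unitInterval, y ≠ 1 ∧ γ y = x := by
    obtain ⟨y, hy⟩ := h.1 x
    by_cases h1 : y = 1
    · exact ⟨0, zero_ne_one, by rw [← hy, h.2]; exact Or.inr (Or.inl ⟨rfl, h1⟩)⟩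
    · exact ⟨y, h1, hy⟩
  obtain ⟨y, hy1, hy⟩ := hex
  refine ⟨(0, y), ⟨hy1, hy⟩, ?_⟩
  rintro ⟨i, z⟩ ⟨hz1, hz⟩
  refine Prod.ext (Subsingleton.elim _ _) ?_
  rcases (h.2 z y).1 (hz.trans hy.symm) with h | h | h
  · exact h
  · exact absurd h.2 hy1
  · exact absurd h.1 hz1

theorem hasSection_iff_of_loop [T2Space M] {P : PinMinus1 I M} {γ : unitInterval → M}
    (hγ : Continuous γ) (hloop : IsSimpleLoop γ) {s : unitInterval → P.Total} (hs : Continuous s)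
    (hp : ∀ x, P.proj (s x) = γ x) {u : ℤˣ} (hu : s 0 = op (PinMinus.unit u) • s 1) :
    P.HasSection ↔ u = 1 := by
  have h1 : γ 1 = γ 0 := (hloop.2 1 0).2 (Or.inr (Or.inr ⟨rfl, rfl⟩))
  constructor
  · intro h
    simpa using prod_eq_one_of_hasSection h (n := 1) (γ := fun _ => γ) (fun _ => hγ) (fun _ => h1)
      (s := fun _ => s) (fun _ => hs) (fun _ => hp) (u := fun _ => u) fun _ => hu
  · intro h
    exact hasSection_of_prod_eq_one (n := 1) (γ := fun _ => γ) (fun _ => hγ) (fun _ => h1)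
      hloop.existsUnique (s := fun _ => s) (fun _ => hs) (fun _ => hp) (u := fun _ => u)
      (fun _ => hu) (by simpa using h)

/-- The right side mentions only `u`: the bundle is `[0, 1] × Pin⁻₁` with its ends glued by a
relation depending on the holonomy sign alone. -/
theorem smul_lift_eq_iff {P : PinMinus1 I M} {γ : unitInterval → M} (hloop : IsSimpleLoop γ)
    {s : unitInterval → P.Total} (hp : ∀ x, P.proj (s x) = γ x) {u : ℤˣ}
    (hu : s 0 = op (PinMinus.unit u) • s 1) (x y : unitInterval) (g h : PinMinus 1) :
    op g • s x = op h • s y ↔ (x = y ∧ g = h) ∨ (x = 0 ∧ y = 1 ∧ PinMinus.unit u * g = h) ∨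
      (x = 1 ∧ y = 0 ∧ g = PinMinus.unit u * h) := by
  constructor
  · intro H
    have hxy : γ x = γ y := by
      rw [← hp, ← hp, ← P.proj_smul _ g, H, P.proj_smul]
    rcases (hloop.2 x y).1 hxy with rfl | ⟨rfl, rfl⟩ | ⟨rfl, rfl⟩
    · exact Or.inl ⟨rfl, P.smul_left_injective _ H⟩
    · rw [hu, smul_smul, ← op_mul] at H
      exact Or.inr (Or.inl ⟨rfl, rfl, P.smul_left_injective _ H⟩)
    · rw [hu, smul_smul, ← op_mul] at H
      exact Or.inr (Or.inr ⟨rfl, rfl, P.smul_left_injective _ H⟩)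
  · rintro (⟨rfl, rfl⟩ | ⟨rfl, rfl, rfl⟩ | ⟨rfl, rfl, rfl⟩)
    · rfl
    · rw [hu, smul_smul, ← op_mul]
    · rw [hu, smul_smul, ← op_mul]

theorem isQuotientMap_smul_lift [T2Space M] {P : PinMinus1 I M} {γ : unitInterval → M}
    (hsurj : Function.Surjective γ) {s : unitInterval → P.Total} (hs : Continuous s)
    (hp : ∀ x, P.proj (s x) = γ x) :
    Topology.IsQuotientMap fun p : unitInterval × PinMinus 1 => op p.2 • s p.1 := by
  have := t2Space_of_isCoveringMap P.isCoveringMap_proj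
  have hc : Continuous fun p : unitInterval × PinMinus 1 => op p.2 • s p.1 :=
    P.continuous_smul.comp (continuous_snd.prodMk (hs.comp continuous_fst))
  refine hc.isClosedMap.isQuotientMap hc fun q => ?_
  obtain ⟨x, hx⟩ := hsurj (P.proj q)
  obtain ⟨g, hg⟩ := P.exists_smul_eq (q := s x) (q' := q) ((hp x).trans hx)
  exact ⟨(x, g), hg.symm⟩

/-- Equal holonomy signs give the same gluing relation, hence a homeomorphism of bundles; the frames
match because both lifts point along corresponding loops. -/
theorem pinDiffeomorphic_of_loop {H' M' : Type} [TopologicalSpace H'] [TopologicalSpace M']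
    {I' : ModelWithCorners ℝ (EuclideanSpace ℝ (Fin 1)) H'} [ChartedSpace H' M']
    [IsManifold I' 1 M'] [T2Space M] [T2Space M'] {P : PinMinus1 I M} {P' : PinMinus1 I' M'}
    (f : M ≃ₘ⟮I, I'⟯ M') {γ : unitInterval → M} {γ' : unitInterval → M'} (hf : f ∘ γ = γ')
    (hγ : IsImmersedPath I γ) (hγ' : IsImmersedPath I' γ') (hloop : IsSimpleLoop γ)
    (hloop' : IsSimpleLoop γ') {s : unitInterval → P.Total} {s' : unitInterval → P'.Total}
    (hs : Continuous s) (hs' : Continuous s') (hp : ∀ x, P.proj (s x) = γ x)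
    (hp' : ∀ x, P'.proj (s' x) = γ' x)
    (hdir : SameDirection (pathVelocity I γ 0) (P.tangent (s 0)))
    (hdir' : SameDirection (pathVelocity I' γ' 0) (P'.tangent (s' 0))) {u : ℤˣ}
    (hu : s 0 = op (PinMinus.unit u) • s 1) (hu' : s' 0 = op (PinMinus.unit u) • s' 1) :
    P.PinDiffeomorphic P' := by
  have hquot := isQuotientMap_smul_lift hloop.1 hs hp
  obtain ⟨j, hj⟩ := exists_homeomorph_of_isQuotientMap hquot
    (isQuotientMap_smul_lift hloop'.1 hs' hp') fun p p' => by
      rw [smul_lift_eq_iff hloop hp hu, smul_lift_eq_iff hloop' hp' hu']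
  have hj : ∀ x g, j (op g • s x) = op g • s' x := fun x g => hj (x, g)
  refine ⟨f, j, ⟨j.continuous, fun q => ?_, fun q g => ?_, fun q => ?_⟩⟩
  · obtain ⟨⟨x, g⟩, rfl⟩ := hquot.surjective q
    rw [hj, P'.proj_smul, P.proj_smul, hp', hp, ← hf]
    rfl
  · obtain ⟨⟨x, g'⟩, rfl⟩ := hquot.surjective q
    rw [hj, smul_smul, smul_smul, ← op_mul, hj]
  · obtain ⟨⟨x, g⟩, rfl⟩ := hquot.surjective q
    rw [hj]
    refine sameDirection_tangent_smul ?_ g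
    have h1 := ((P.sameDirection_lift hγ hs hp hdir x).symm.tangentMap (I' := I') f)
    rw [← pathVelocity_comp (f.mdifferentiable (by simp))
      (hγ.contMDiff.mdifferentiable one_ne_zero), hf] at h1
    exact h1.trans (P'.sameDirection_lift hγ' hs' hp' hdir' x)

theorem PinDiffeomorphic.hasSection {H' M' : Type} [TopologicalSpace H'] [TopologicalSpace M']
    {I' : ModelWithCorners ℝ (EuclideanSpace ℝ (Fin 1)) H'} [ChartedSpace H' M']
    [IsManifold I' 1 M'] {P : PinMinus1 I M} {P' : PinMinus1 I' M'} (h : P.PinDiffeomorphic P') :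
    P.HasSection ↔ P'.HasSection := by
  obtain ⟨f, j, hj⟩ := h
  constructor
  · rintro ⟨σ, hσ, hp⟩
    refine ⟨fun x => j (σ (f.symm x)), j.continuous.comp (hσ.comp f.symm.continuous), fun x => ?_⟩
    rw [hj.proj, hp, f.apply_symm_apply]
  · rintro ⟨σ, hσ, hp⟩
    refine ⟨fun x => j.symm (σ (f x)), j.symm.continuous.comp (hσ.comp f.continuous), fun x => ?_⟩
    have := hj.proj (j.symm (σ (f x)))
    rw [j.apply_symm_apply, hp] at this
    exact (f.injective this).symm

end PinMinusStructure

/-! ### The circle -/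

namespace Circle

theorem contMDiff_val : ContMDiff (𝓡 1) 𝓘(ℝ, ℂ) 1 (fun z : Circle => (z : ℂ)) :=
  have : Fact (Module.finrank ℝ ℂ = 1 + 1) := finrank_real_complex_fact'
  contMDiff_coe_sphere

theorem mdifferentiable_val : MDifferentiable (𝓡 1) 𝓘(ℝ, ℂ) (fun z : Circle => (z : ℂ)) :=
  contMDiff_val.mdifferentiable one_ne_zero

/-- The differential of the inclusion of the circle into `ℂ`. -/
def dval (z : Circle) : TangentSpace (𝓡 1) z →L[ℝ] ℂ :=
  mfderiv (𝓡 1) 𝓘(ℝ, ℂ) (fun z : Circle => (z : ℂ)) z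

theorem contMDiff_exp_mul (a : ℝ) : ContMDiff 𝓘(ℝ) (𝓡 1) 1 fun t : ℝ => Circle.exp (a * t) := by
  have h : ContDiff ℝ 1 fun t : ℝ => a * t := by fun_prop
  exact contMDiff_circleExp.comp h.contMDiff

theorem mfderiv_val_exp_mul (a t : ℝ) :
    dval (Circle.exp (a * t))
      (mfderiv 𝓘(ℝ) (𝓡 1) (fun t : ℝ => Circle.exp (a * t)) t (1 : ℝ)) =
      Complex.exp (a * t * Complex.I) * (a * Complex.I) := by
  have h := mfderiv_comp_apply (I' := 𝓡 1) (f := fun t : ℝ => Circle.exp (a * t))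
    (g := fun z : Circle => (z : ℂ)) t (mdifferentiable_val _)
    ((contMDiff_exp_mul a).mdifferentiable one_ne_zero t) (1 : ℝ)
  refine h.symm.trans ?_
  have hd : HasDerivAt ((fun z : Circle => (z : ℂ)) ∘ fun t : ℝ => Circle.exp (a * t))
      (Complex.exp (a * t * Complex.I) * (a * Complex.I)) t := by
    have h1 : HasDerivAt (fun t : ℝ => (a * t * Complex.I : ℂ)) (a * Complex.I) t := by
      have h0 : HasDerivAt (fun t : ℝ => (t : ℂ)) 1 t := Complex.ofRealCLM.hasDerivAt
      simpa using (h0.const_mul (a : ℂ)).mul_const Complex.I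
    refine h1.cexp.congr_of_eventuallyEq (Filter.Eventually.of_forall fun s => ?_)
    simp [Circle.coe_exp]
  rw [mfderiv_eq_fderiv, hd.hasFDerivAt.fderiv]
  have h4 : ContinuousLinearMap.toSpanSingleton ℝ
      (Complex.exp (a * t * Complex.I) * (a * Complex.I)) (1 : ℝ) =
      Complex.exp (a * t * Complex.I) * (a * Complex.I) := by simp
  exact h4

theorem exists_lieAlgebra_eq_I : ∃ v : GroupLieAlgebra (𝓡 1) Circle, dval 1 v = Complex.I := by
  have h : ∃ v : TangentSpace (𝓡 1) (Circle.exp (1 * 0)), dval (Circle.exp (1 * 0)) v =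
      Complex.I := ⟨_, (mfderiv_val_exp_mul 1 0).trans (by simp)⟩
  rwa [mul_zero, Circle.exp_zero] at h

/-- Left translation on the circle is the restriction of multiplication by `z` on `ℂ`, which is its
own derivative. -/
theorem mfderiv_val_mulInvariantVectorField (v : GroupLieAlgebra (𝓡 1) Circle) (z : Circle) :
    dval z (mulInvariantVectorField (I := 𝓡 1) v z) = z * dval 1 v := by
  have hL : MDifferentiableAt (𝓡 1) (𝓡 1) (z * ·) (1 : Circle) :=
    (contMDiff_mul_left (I := 𝓡 1) (n := 1) (a := z)).mdifferentiable one_ne_zero 1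
  have h := mfderiv_comp_apply_of_eq (I' := 𝓡 1) (f := fun w : Circle => z * w)
    (g := fun z : Circle => (z : ℂ)) (x := 1) (y := z) (mdifferentiable_val _) hL (mul_one z) v
  refine h.symm.trans ?_
  have hm : MDifferentiableAt 𝓘(ℝ, ℂ) 𝓘(ℝ, ℂ) (fun w : ℂ => (z : ℂ) * w) ((1 : Circle) : ℂ) :=
    (differentiableAt_id.const_mul (z : ℂ)).mdifferentiableAt
  have h2 := mfderiv_comp_apply (I' := 𝓘(ℝ, ℂ)) (g := fun w : ℂ => (z : ℂ) * w)
    (f := fun z : Circle => (z : ℂ)) (1 : Circle) hm (mdifferentiable_val _) v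
  refine Eq.trans ?_ (h2.trans ?_)
  · rfl
  · have hd : HasFDerivAt (fun w : ℂ => (z : ℂ) * w)
      ((z : ℂ) • ContinuousLinearMap.id ℝ ℂ) ((1 : Circle) : ℂ) := (hasFDerivAt_id _).const_mul _
    rw [mfderiv_eq_fderiv, hd.fderiv]
    rfl

/-- The invariant vector field `z ↦ i z` on the circle. -/
def field (z : Circle) : TangentSpace (𝓡 1) z :=
  mulInvariantVectorField (I := 𝓡 1) exists_lieAlgebra_eq_I.choose z

theorem mfderiv_val_field (z : Circle) : dval z (field z) = z * Complex.I := by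
  rw [field, mfderiv_val_mulInvariantVectorField]
  exact congrArg _ exists_lieAlgebra_eq_I.choose_spec

theorem field_ne_zero (z : Circle) : field z ≠ 0 := by
  intro h
  have := mfderiv_val_field z
  rw [h, map_zero] at this
  exact mul_ne_zero z.coe_ne_zero Complex.I_ne_zero this.symm

theorem continuous_field : Continuous fun z => (⟨z, field z⟩ : TangentBundle (𝓡 1) Circle) :=
  (contMDiff_mulInvariantVectorField (I := 𝓡 1) (G := Circle) _).continuous

end Circle

/-- The standard parametrization of the circle by the interval. -/
def circlePath (x : unitInterval) : Circle := Circle.exp (2 * Real.pi * (x : ℝ))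

theorem pathVelocity_circlePath (x : unitInterval) : pathVelocity (𝓡 1) circlePath x =
    tangentMap 𝓘(ℝ) (𝓡 1) (fun t : ℝ => Circle.exp (2 * Real.pi * t)) ⟨(x : ℝ), (1 : ℝ)⟩ := by
  have h := tangentMap_comp_at (I := 𝓡∂ 1) (I' := 𝓘(ℝ)) (I'' := 𝓡 1)
    (g := fun t : ℝ => Circle.exp (2 * Real.pi * t)) (f := (Subtype.val : unitInterval → ℝ))
    ⟨x, oneTangentSpaceIcc x⟩
    ((Circle.contMDiff_exp_mul _).mdifferentiable one_ne_zero _)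
    ((contMDiff_subtypeVal_Icc (n := 1)).mdifferentiable one_ne_zero _)
  refine h.trans (congrArg _ ?_)
  exact congrArg (TotalSpace.mk (x : ℝ)) (mfderiv_subtypeVal_Icc_one x)

theorem isImmersedPath_circlePath : IsImmersedPath (𝓡 1) circlePath where
  contMDiff := (Circle.contMDiff_exp_mul (2 * Real.pi)).comp contMDiff_subtypeVal_Icc
  velocity_ne_zero x := by
    rw [pathVelocity_circlePath]
    intro h
    have h1 := Circle.mfderiv_val_exp_mul (2 * Real.pi) x
    have h2 : mfderiv 𝓘(ℝ) (𝓡 1) (fun t : ℝ => Circle.exp (2 * Real.pi * t)) (x : ℝ) (1 : ℝ) = 0 := h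
    rw [h2, map_zero] at h1
    refine mul_ne_zero (Complex.exp_ne_zero _) (mul_ne_zero ?_ Complex.I_ne_zero) h1.symm
    exact_mod_cast Real.two_pi_pos.ne'

/-- Periodicity under `t ↦ t + 1`. The agreement of the end velocities is what makes the holonomy a
sign. -/
theorem pathVelocity_circlePath_one :
    pathVelocity (𝓡 1) circlePath 1 = pathVelocity (𝓡 1) circlePath 0 := by
  rw [pathVelocity_circlePath, pathVelocity_circlePath]
  have hper : (fun t : ℝ => Circle.exp (2 * Real.pi * t)) ∘ (fun t : ℝ => t + 1) =
      fun t : ℝ => Circle.exp (2 * Real.pi * t) := by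
    funext t
    simp [mul_add]
  have hd : HasDerivAt (fun t : ℝ => t + 1) 1 (0 : ℝ) := (hasDerivAt_id _).add_const 1
  have h := tangentMap_comp_at (I := 𝓘(ℝ)) (I' := 𝓘(ℝ)) (I'' := 𝓡 1)
    (g := fun t : ℝ => Circle.exp (2 * Real.pi * t)) (f := fun t : ℝ => t + 1)
    ⟨(0 : ℝ), (1 : ℝ)⟩ ((Circle.contMDiff_exp_mul _).mdifferentiable one_ne_zero _)
    hd.differentiableAt.mdifferentiableAt
  rw [hper] at h
  refine Eq.trans (congrArg _ ?_) h.symm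
  have h1 : mfderiv 𝓘(ℝ) 𝓘(ℝ) (fun t : ℝ => t + 1) 0 (1 : ℝ) = (1 : ℝ) := by
    rw [mfderiv_eq_fderiv, hd.hasFDerivAt.fderiv]
    have h4 : ContinuousLinearMap.toSpanSingleton ℝ (1 : ℝ) (1 : ℝ) = (1 : ℝ) := by simp
    exact h4
  have h0 : ((1 : unitInterval) : ℝ) = (0 : ℝ) + 1 := by simp
  refine TotalSpace.ext h0 (heq_of_eq h1.symm)

theorem isSimpleLoop_circlePath : PinMinusStructure.IsSimpleLoop circlePath := by
  have hpi := Real.pi_pos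
  constructor
  · intro z
    -- The argument lies in `(-π, π]`, so negative values are shifted by `2π` to land in the range
    -- of the loop.
    by_cases h : 0 ≤ Complex.arg z
    · refine ⟨⟨Complex.arg z / (2 * Real.pi), by positivity, ?_⟩, ?_⟩
      · rw [div_le_one (by positivity)]
        linarith [Complex.arg_le_pi z]
      · rw [circlePath]
        simp only
        rw [mul_div_cancel₀ _ (by positivity), Circle.exp_arg]
    · refine ⟨⟨(Complex.arg z + 2 * Real.pi) / (2 * Real.pi), ?_, ?_⟩, ?_⟩
      · apply div_nonneg _ (by positivity)
        linarith [Complex.neg_pi_lt_arg z]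
      · rw [div_le_one (by positivity)]
        linarith
      · rw [circlePath]
        simp only
        rw [mul_div_cancel₀ _ (by positivity), Circle.exp_add_two_pi, Circle.exp_arg]
  · intro x y
    rw [circlePath, circlePath, Circle.exp_eq_exp]
    constructor
    · rintro ⟨m, hm⟩
      have hm' : (x : ℝ) = y + m := by
        have : (2 * Real.pi) * (x : ℝ) = (2 * Real.pi) * (y + m) := by rw [hm]; ring
        exact mul_left_cancel₀ (by positivity) this
      have h1 : (m : ℝ) ≤ 1 := by linarith [x.2.2, y.2.1]
      have h2 : (-1 : ℝ) ≤ m := by linarith [x.2.1, y.2.2]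
      have h1' : m ≤ 1 := by exact_mod_cast h1
      have h2' : -1 ≤ m := by exact_mod_cast h2
      obtain rfl | rfl | rfl : m = -1 ∨ m = 0 ∨ m = 1 := by omega
      · right; left
        push_cast at hm'
        have hx : (x : ℝ) = 0 := by linarith [x.2.1, y.2.2]
        have hy : (y : ℝ) = 1 := by linarith [x.2.1, y.2.2]
        exact ⟨Subtype.ext hx, Subtype.ext hy⟩
      · left
        exact Subtype.ext (by simpa using hm')
      · right; right
        push_cast at hm'
        have hx : (x : ℝ) = 1 := by linarith [x.2.2, y.2.1]
        have hy : (y : ℝ) = 0 := by linarith [x.2.2, y.2.1]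
        exact ⟨Subtype.ext hx, Subtype.ext hy⟩
    · rintro (rfl | ⟨rfl, rfl⟩ | ⟨rfl, rfl⟩)
      · exact ⟨0, by simp⟩
      · exact ⟨-1, by simp⟩
      · exact ⟨1, by simp⟩

/-! ### The boundary of the standard pin⁻ disc -/

/-- Near `x₀` the ratio `a x / a x₀` stays in the slit plane, where its argument is continuous and
can be halved; the argument of `a x₀` contributes a constant. -/
theorem exists_local_circle_sqrt {A : Type*} [TopologicalSpace A] {a : A → ℂ} (ha : Continuous a)
    (x₀ : A) (h : a x₀ ≠ 0) : ∃ U : Set A, IsOpen U ∧ x₀ ∈ U ∧ ∃ c : U → Circle, Continuous c ∧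
      ∀ x : U, a x = ‖a x‖ * (c x : ℂ) ^ 2 := by
  refine ⟨{x | a x / a x₀ ∈ Complex.slitPlane},
    Complex.isOpen_slitPlane.preimage (ha.div_const _), ?_,
    fun x => Circle.exp (Complex.arg (a x₀) / 2) * Circle.exp (Complex.arg (a x / a x₀) / 2), ?_,
    fun x => ?_⟩
  · simp [div_self h]
  · have harg : Continuous fun x : {x | a x / a x₀ ∈ Complex.slitPlane} =>
        Complex.arg (a x / a x₀) :=
      continuous_iff_continuousAt.2 fun x => (Complex.continuousAt_arg x.2).comp
        (f := fun x : {x | a x / a x₀ ∈ Complex.slitPlane} => a x / a x₀)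
        ((ha.comp continuous_subtype_val).div_const _).continuousAt
    exact continuous_const.mul (Circle.exp.continuous.comp (harg.div_const _))
  · have h1 := Complex.norm_mul_exp_arg_mul_I (a x₀)
    have h2 := Complex.norm_mul_exp_arg_mul_I (a x / a x₀)
    have h3 : ‖a x‖ = ‖a x₀‖ * ‖a x / a x₀‖ := by
      rw [norm_div, mul_div_cancel₀ _ (norm_ne_zero_iff.2 h)]
    have h4 : a x = a x₀ * (a x / a x₀) := by rw [mul_div_cancel₀ _ h]
    have h5 : ∀ t : ℝ, ((Circle.exp (t / 2) : Circle) : ℂ) ^ 2 = Complex.exp (t * Complex.I) := by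
      intro t
      rw [Circle.coe_exp, ← Complex.exp_nat_mul]
      congr 1
      push_cast
      ring
    rw [h3, Circle.coe_mul, mul_pow, h5, h5]
    have h6 : a x = ‖a x₀‖ * Complex.exp (Complex.arg (a x₀) * Complex.I) *
        (‖a x / a x₀‖ * Complex.exp (Complex.arg (a x / a x₀) * Complex.I)) := by
      rw [h1, h2]
      exact h4
    refine h6.trans ?_
    push_cast
    ring

namespace PinMinus

theorem exists_circle_eq_rho (g : PinMinus 2) :
    ∃ z : Circle, (z : ℂ) = toComplex (rho g ![1, 0]) := by
  have h1 : toComplex ![1, 0] = 1 := by rw [toComplex_apply]; rfl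
  obtain ⟨c, rfl | rfl⟩ := eq_spin_or g
  · exact ⟨c ^ 2, by rw [toComplex_rho_spin, h1]; simp⟩
  · exact ⟨c ^ 2, by rw [rho_mul, toComplex_rho_spin, toComplex_rho_incl_e, h1]; simp⟩

/-- The first vector of the frame `ρ(g)`, as a point of the circle. -/
def firstVector (g : PinMinus 2) : Circle := (exists_circle_eq_rho g).choose

theorem coe_firstVector (g : PinMinus 2) : (firstVector g : ℂ) = toComplex (rho g ![1, 0]) :=
  (exists_circle_eq_rho g).choose_spec

theorem continuous_firstVector : Continuous firstVector :=
  Topology.IsInducing.subtypeVal.continuous_iff.2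
    ((continuous_rho ![1, 0]).congr fun g => (coe_firstVector g).symm)

/-- The orientation of the frame `ρ(g)`. -/
def orientation (g : PinMinus 2) : ℝ :=
  Complex.normSq (evenPart (g : ClMinus 2)) - Complex.normSq (oddPart (g : ClMinus 2))

theorem continuous_orientation : Continuous orientation :=
  (Complex.continuous_normSq.comp (continuous_evenPart.comp continuous_subtype_val)).sub
    (Complex.continuous_normSq.comp (continuous_oddPart.comp continuous_subtype_val))

/-- The frame is orthonormal, so its second vector is the first one turned by a right angle, up to
the sign `orientation g`. -/
theorem toComplex_rho_secondVector (g : PinMinus 2) :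
    toComplex (rho g ![0, 1]) = orientation g * (firstVector g * Complex.I) := by
  have h1 : toComplex ![1, 0] = 1 := by rw [toComplex_apply]; rfl
  have h2 : toComplex ![0, 1] = Complex.I := by rw [toComplex_apply]; rfl
  rw [coe_firstVector, toComplex_rho, toComplex_rho, h1, h2, orientation]
  have h := evenPart_add_oddPart g
  rw [RCLike.star_def, Complex.mul_conj, Complex.mul_conj] at h
  rcases evenPart_eq_zero_or g with h0 | h0
  · simp only [h0, map_zero, zero_sub, Complex.ofReal_neg, Complex.ofReal_zero, zero_add] at h ⊢
    simp [h]
  · simp only [h0, map_zero, sub_zero, Complex.ofReal_zero, add_zero] at h ⊢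
    simp [h]

theorem toComplex_rho_incl (g : PinMinus 1) :
    toComplex (rho (incl g) ![1, 0]) = 1 ∧
    toComplex (rho (incl g) ![0, 1]) = sign g * Complex.I := by
  have h1 : toComplex ![1, 0] = 1 := by rw [toComplex_apply]; rfl
  have h2 : toComplex ![0, 1] = Complex.I := by rw [toComplex_apply]; rfl
  have h3 := normSq_complexEquiv g
  rw [toComplex_rho, toComplex_rho, h1, h2, evenPart_incl, oddPart_incl, sign]
  constructor <;> apply Complex.ext <;> simp [pow_two] <;> linarith

theorem rho_incl_one (g : PinMinus 1) : rho (incl g) ![1, 0] = ![1, 0] := by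
  apply toComplex.injective
  rw [(toComplex_rho_incl g).1, toComplex_apply]
  rfl

theorem rho_incl_two (g : PinMinus 1) : rho (incl g) ![0, 1] = sign g • ![0, 1] := by
  have h2 : toComplex ![0, 1] = Complex.I := by rw [toComplex_apply]; rfl
  apply toComplex.injective
  rw [(toComplex_rho_incl g).2, map_smul, h2, Complex.real_smul]

theorem firstVector_mul_incl (g : PinMinus 2) (h : PinMinus 1) :
    firstVector (g * incl h) = firstVector g := by
  apply Circle.ext
  rw [coe_firstVector, coe_firstVector, rho_mul, rho_incl_one]

theorem orientation_mul_incl (g : PinMinus 2) (h : PinMinus 1) :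
    orientation (g * incl h) = sign h * orientation g := by
  have h1 := toComplex_rho_secondVector (g * incl h)
  have h2 : rho g (sign h • ![0, 1]) = sign h • rho g ![0, 1] := (rhoEquiv g).map_smul _ _
  rw [rho_mul, rho_incl_two, h2, map_smul, toComplex_rho_secondVector, firstVector_mul_incl,
    Complex.real_smul, ← mul_assoc] at h1
  have h3 := mul_right_cancel₀ (mul_ne_zero (firstVector g).coe_ne_zero Complex.I_ne_zero) h1
  exact_mod_cast h3.symm

theorem orientation_ne_zero (g : PinMinus 2) : orientation g ≠ 0 := by
  have h := evenPart_add_oddPart g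
  rw [RCLike.star_def, Complex.mul_conj, Complex.mul_conj] at h
  rw [orientation]
  have h' : Complex.normSq (evenPart (g : ClMinus 2)) +
      Complex.normSq (oddPart (g : ClMinus 2)) = 1 := by
    exact_mod_cast h
  intro h1
  rcases evenPart_eq_zero_or g with h0 | h0 <;> rw [h0, map_zero] at h' h1 <;> linarith

theorem spin_one : spin 1 = 1 := by
  have := spin_mul 1 1
  rw [mul_one] at this
  exact left_eq_mul.1 this

theorem spin_neg_one {c : Circle} (hc : (c : ℂ) = -1) : spin c = incl (e * e) := by
  refine Subtype.ext (ext_parts ?_ ?_)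
  · rw [evenPart_spin, evenPart_incl, complexEquiv_e_sq, hc]
    simp
  · rw [oddPart_spin, oddPart_incl, complexEquiv_e_sq]
    simp

theorem spin_mem_range_incl {c : Circle} (hc : (c : ℂ) ^ 2 = 1) :
    ∃ u : ℤˣ, spin c = incl (unit u) := by
  rcases sq_eq_one_iff.1 hc with h | h
  · obtain rfl : c = 1 := Circle.ext h
    exact ⟨1, by rw [spin_one, map_one, incl_one]⟩
  · exact ⟨-1, by rw [unit_neg_one, spin_neg_one h]⟩

/-- The stabilizer of `e₁` in `Pin⁻₂` is `Pin⁻₁`, so `firstVector` has `Pin⁻₁`-torsors as fibres. -/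
theorem exists_eq_incl {g : PinMinus 2} (hg : firstVector g = 1) : ∃ h, g = incl h := by
  have h1 : toComplex ![1, 0] = 1 := by rw [toComplex_apply]; rfl
  have hg' := coe_firstVector g
  rw [hg, Circle.coe_one] at hg'
  obtain ⟨c, rfl | rfl⟩ := eq_spin_or g
  · rw [toComplex_rho_spin, h1, mul_one] at hg'
    obtain ⟨u, hu⟩ := spin_mem_range_incl hg'.symm
    exact ⟨_, hu⟩
  · rw [rho_mul, toComplex_rho_spin, toComplex_rho_incl_e, h1, star_one, mul_one] at hg'
    obtain ⟨u, hu⟩ := spin_mem_range_incl hg'.symm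
    exact ⟨unit u * e, by rw [hu, incl_mul]⟩

theorem coe_firstVector_spin_mul (c : Circle) (g : PinMinus 2) :
    (firstVector (spin c * g) : ℂ) = c ^ 2 * firstVector g := by
  rw [coe_firstVector, coe_firstVector, rho_mul, toComplex_rho_spin]

theorem isEmbedding_incl : Topology.IsEmbedding incl :=
  (continuous_of_discreteTopology.isClosedEmbedding incl_injective).isEmbedding

end PinMinus

open PinMinus

/-- In the trivial bundle over the disc the boundary reduction over `z` consists of the `g` with
first vector `z`, so its total space is `Pin⁻₂` itself. As `spin c` rotates by `c ^ 2`, a local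
square root of `z` provides a local section. -/
theorem firstVector_locally_trivial (z₀ : Circle) : ∃ U : Set Circle, IsOpen U ∧ z₀ ∈ U ∧
    ∃ h : U × PinMinus 1 ≃ₜ firstVector ⁻¹' U, (∀ p, firstVector (h p) = p.1) ∧
      ∀ (u : U) (g g' : PinMinus 1),
        (h (u, g * g') : PinMinus 2) = (h (u, g) : PinMinus 2) * incl g' := by
  obtain ⟨U, hU, hz, c, hc, hc2⟩ := exists_local_circle_sqrt continuous_circle_coe z₀
    z₀.coe_ne_zero
  have hc2 : ∀ z : U, (c z : ℂ) ^ 2 = ((z : Circle) : ℂ) := fun z => by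
    rw [hc2 z, Circle.norm_coe]; simp
  have hfirst : ∀ (z : U) (g : PinMinus 1), firstVector (spin (c z) * incl g) = z := fun z g => by
    apply Circle.ext
    rw [firstVector_mul_incl, ← mul_one (spin (c z)), coe_firstVector_spin_mul, hc2,
      coe_firstVector, ← incl_one, (toComplex_rho_incl 1).1, mul_one]
  have hex : ∀ k : firstVector ⁻¹' U, ∃ g, (spin (c ⟨firstVector k, k.2⟩))⁻¹ * k = incl g := by
    intro k
    refine exists_eq_incl (Circle.ext ?_)
    have := coe_firstVector_spin_mul (c ⟨firstVector k, k.2⟩)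
      ((spin (c ⟨firstVector k, k.2⟩))⁻¹ * k)
    rw [mul_inv_cancel_left, hc2] at this
    rw [Circle.coe_one]
    exact (mul_eq_left₀ (Circle.coe_ne_zero _)).1 this.symm
  choose r hr using hex
  have hfc : Continuous fun k : firstVector ⁻¹' U => (⟨firstVector k, k.2⟩ : U) :=
    (continuous_firstVector.comp continuous_subtype_val).subtype_mk _
  have hrc : Continuous r := by
    refine isEmbedding_incl.continuous_iff.2 (Continuous.congr ?_ hr)
    exact ((continuous_spin.comp (hc.comp hfc)).inv).mul continuous_subtype_val
  refine ⟨U, hU, hz, ⟨⟨fun p => ⟨spin (c p.1) * incl p.2, ?_⟩,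
    fun k => (⟨firstVector k, k.2⟩, r k), fun p => ?_, fun k => ?_⟩, ?_, ?_⟩,
    fun p => hfirst p.1 p.2, fun u g g' => ?_⟩
  · rw [Set.mem_preimage, hfirst]
    exact p.1.2
  · refine Prod.ext (Subtype.ext (hfirst _ _)) (incl_injective ?_)
    rw [← hr]
    have : (⟨firstVector (spin (c p.1) * incl p.2), by rw [hfirst]; exact p.1.2⟩ : U) = p.1 :=
      Subtype.ext (hfirst _ _)
    simp only [this, inv_mul_cancel_left]
  · apply Subtype.ext
    change spin _ * incl (r k) = k
    rw [← hr, mul_inv_cancel_left]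
  · refine Continuous.subtype_mk ?_ _
    exact (continuous_spin.comp (hc.comp continuous_fst)).mul
      (isEmbedding_incl.continuous.comp continuous_snd)
  · exact hfc.prodMk hrc
  · change spin _ * incl (g * g') = spin _ * incl g * incl g'
    rw [incl_mul, mul_assoc]

/-- The standard pin⁻ structure on the disc. -/
def standardDisc : PinMinusDisc where
  Total := Metric.closedBall (0 : ℂ) 1 × PinMinus 2
  act :=
    { smul := fun g p => (p.1, p.2 * g.unop)
      one_smul := fun p => Prod.ext rfl (mul_one p.2)
      mul_smul := fun g g' p => Prod.ext rfl (mul_assoc p.2 g'.unop g.unop).symm }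
  proj := Prod.fst
  locally_trivial := fun _ =>
    ⟨Set.univ, isOpen_univ, trivial, univProdHomeomorph (Metric.closedBall (0 : ℂ) 1) (PinMinus 2),
      fun _ => rfl, fun _ _ _ => rfl⟩
  frame := fun p => (rhoEquiv p.2).trans toComplex
  continuous_frame := fun v =>
    (Bundle.Trivial.homeomorphProd (Metric.closedBall (0 : ℂ) 1) ℂ).symm.continuous.comp
      (continuous_fst.prodMk ((continuous_rho v).comp continuous_snd))
  frame_smul := fun p g v => congrArg (TotalSpace.mk p.1) (congrArg toComplex (rho_mul p.2 g v))

/-- The boundary of the standard pin⁻ disc. -/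
def boundaryCircle : PinMinus1 (𝓡 1) Circle where
  Total := PinMinus 2
  act :=
    { smul := fun g p => p * incl g.unop
      one_smul := fun p => (congrArg (p * ·) incl_one).trans (mul_one p)
      mul_smul := fun g g' p =>
        (congrArg (p * ·) (incl_mul g'.unop g.unop)).trans (mul_assoc p _ _).symm }
  proj := firstVector
  locally_trivial := firstVector_locally_trivial
  frame := fun p => lineEquiv (orientation p • Circle.field (firstVector p))
    (smul_ne_zero (orientation_ne_zero p) (Circle.field_ne_zero _))
  continuous_frame := fun v => by
    refine (continuous_smul_tangent (continuous_const.mul continuous_orientation)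
      (Circle.continuous_field.comp continuous_firstVector) (c := fun p => v 0 * orientation p)).congr
        fun p => ?_
    rw [lineEquiv_apply, smul_smul]
    rfl
  frame_smul := fun p g v => by
    have h : ∀ q w, (⟨firstVector q, lineEquiv (orientation q • Circle.field (firstVector q))
        (smul_ne_zero (orientation_ne_zero q) (Circle.field_ne_zero _)) w⟩ :
          TangentBundle (𝓡 1) Circle) =
        ⟨firstVector q, (w 0 * orientation q) • Circle.field (firstVector q)⟩ := fun q w => by
      rw [lineEquiv_apply, smul_smul]
    refine (h _ _).trans (Eq.trans ?_ (h _ _).symm)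
    change (⟨firstVector (p * incl g), (v 0 * orientation (p * incl g)) •
      Circle.field (firstVector (p * incl g))⟩ : TangentBundle (𝓡 1) Circle) = _
    rw [firstVector_mul_incl, orientation_mul_incl, rho_eq_sign_smul, Pi.smul_apply, smul_eq_mul]
    congr 2
    ring

theorem inner_firstVector (g : PinMinus 2) :
    inner ℝ (firstVector g : ℂ) (toComplex (rho g ![1, 0])) = 1 := by
  rw [← coe_firstVector, real_inner_self_eq_norm_sq, Circle.norm_coe, one_pow]

theorem toComplex_rho_eq_dval (g : PinMinus 2) : toComplex (rho g ![0, 1]) =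
    (1 : ℝ) • Circle.dval (firstVector g) ((1 : ℝ) • orientation g • Circle.field (firstVector g)) := by
  rw [toComplex_rho_secondVector, one_smul, one_smul, map_smul, Circle.mfderiv_val_field,
    Complex.real_smul]

/-- The inclusion of the boundary of the standard pin⁻ disc. -/
def boundaryInclusion (g : PinMinus 2) : Metric.closedBall (0 : ℂ) 1 × PinMinus 2 :=
  (⟨firstVector g, mem_closedBall_zero_iff.2 (Circle.norm_coe _).le⟩, g)

theorem continuous_boundaryInclusion : Continuous boundaryInclusion :=
  ((continuous_circle_coe.comp continuous_firstVector).subtype_mk _).prodMk continuous_id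

theorem boundaryInclusion_mul_incl (g : PinMinus 2) (h : PinMinus 1) :
    boundaryInclusion (g * incl h) = ((boundaryInclusion g).1, g * incl h) :=
  Prod.ext (Subtype.ext (congrArg (fun z : Circle => (z : ℂ)) (firstVector_mul_incl g h))) rfl

theorem isBoundaryOfDisc_boundaryCircle : IsBoundaryOfDisc boundaryCircle standardDisc := by
  refine ⟨boundaryInclusion, continuous_boundaryInclusion, fun _ => rfl, ?_, fun g => ⟨?_, ?_⟩⟩
  · exact boundaryInclusion_mul_incl
  · exact one_pos.trans_eq (inner_firstVector g).symm
  · exact ⟨1, one_pos, toComplex_rho_eq_dval g⟩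

theorem exists_isBoundaryOfDisc : ∃ C D, IsBoundaryOfDisc C D :=
  ⟨_, _, isBoundaryOfDisc_boundaryCircle⟩

/-! ### The bounding circle has no section -/

/-- Along `t ↦ exp(it)` such a root equals `exp(it/2)` up to a constant sign by connectedness, but
the latter changes sign between `0` and `2π`. -/
theorem Circle.not_exists_continuous_sqrt {k : Circle → ℂ} (hk : Continuous k)
    (h : ∀ z, k z ^ 2 = z) : False := by
  have h1 : Continuous fun t : ℝ => k (Circle.exp t) := hk.comp Circle.exp.continuous
  have h2 : Continuous fun t : ℝ => Complex.exp (t * Complex.I / 2) := by fun_prop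
  have h3 := isPreconnected_univ.eq_or_eq_neg_of_sq_eq h1.continuousOn h2.continuousOn
    (fun t _ => by
      simp only [Pi.pow_apply, h, Circle.coe_exp, ← Complex.exp_nat_mul]
      congr 1
      push_cast
      ring) (fun _ => Complex.exp_ne_zero _)
  have h4 : Circle.exp (2 * Real.pi) = Circle.exp 0 := by simp
  have h5 : Complex.exp (((2 * Real.pi : ℝ) : ℂ) * Complex.I / 2) = -1 := by
    rw [← Complex.exp_pi_mul_I]
    congr 1
    push_cast
    ring
  rcases h3 with h3 | h3
  all_goals
    have e0 := h3 (Set.mem_univ 0)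
    have e1 := h3 (Set.mem_univ (2 * Real.pi))
    simp only [h4, Pi.neg_apply, h5] at e1
    simp only [Complex.ofReal_zero, zero_mul, zero_div, Complex.exp_zero, Pi.neg_apply, e1] at e0
    norm_num at e0

namespace PinMinus

/-- A square root of the first vector of the frame `ρ(g)`. -/
def sqrtFirstVector (g : PinMinus 2) : ℂ :=
  evenPart (g : ClMinus 2) - Complex.I * oddPart (g : ClMinus 2)

theorem continuous_sqrtFirstVector : Continuous sqrtFirstVector :=
  (continuous_evenPart.comp continuous_subtype_val).sub
    (continuous_const.mul (continuous_oddPart.comp continuous_subtype_val))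

theorem sqrtFirstVector_sq (g : PinMinus 2) : sqrtFirstVector g ^ 2 = firstVector g := by
  have h1 : toComplex ![1, 0] = 1 := by rw [toComplex_apply]; rfl
  rw [coe_firstVector, toComplex_rho, h1, sqrtFirstVector, star_one]
  rcases evenPart_eq_zero_or g with h | h <;> rw [h]
  · linear_combination oddPart (g : ClMinus 2) ^ 2 * Complex.I_mul_I
  · ring

theorem isEmbedding_incl_unit : Topology.IsEmbedding fun u : ℤˣ => incl (unit u) :=
  (continuous_of_discreteTopology.isClosedEmbedding
    (incl_injective.comp unit_injective)).isEmbedding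

end PinMinus

/-! ### Normalized frames on a pin⁻ disc -/

namespace PinMinusStructure

variable (D : PinMinusDisc)

/-- The frame of a point of a pin⁻ disc, as a frame of `ℂ`. -/
def complexFrame (q : D.Total) : (Fin 2 → ℝ) ≃ₗ[ℝ] ℂ := D.frame q

theorem continuous_complexFrame (v : Fin 2 → ℝ) : Continuous fun q => D.complexFrame q v :=
  continuous_snd.comp ((Bundle.Trivial.homeomorphProd (Metric.closedBall (0 : ℂ) 1) ℂ).continuous.comp
    (D.continuous_frame v))

theorem complexFrame_smul (q : D.Total) (g : PinMinus 2) (v : Fin 2 → ℝ) :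
    D.complexFrame (op g • q) v = D.complexFrame q (rho g v) :=
  congrArg (fun p => (Bundle.Trivial.homeomorphProd (Metric.closedBall (0 : ℂ) 1) ℂ p).2)
    (D.frame_smul q g v)

/-- The complex linear part of the frame of a point of a pin⁻ disc. -/
def linearPart (q : D.Total) : ℂ :=
  (D.complexFrame q ![1, 0] - Complex.I * D.complexFrame q ![0, 1]) / 2

/-- The complex antilinear part of the frame of a point of a pin⁻ disc. -/
def antilinearPart (q : D.Total) : ℂ :=
  (D.complexFrame q ![1, 0] + Complex.I * D.complexFrame q ![0, 1]) / 2

theorem continuous_linearPart : Continuous D.linearPart :=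
  ((D.continuous_complexFrame _).sub
    (continuous_const.mul (D.continuous_complexFrame _))).div_const _

theorem continuous_antilinearPart : Continuous D.antilinearPart :=
  ((D.continuous_complexFrame _).add
    (continuous_const.mul (D.continuous_complexFrame _))).div_const _

theorem complexFrame_eq (q : D.Total) (v : Fin 2 → ℝ) : D.complexFrame q v =
    D.linearPart q * toComplex v + D.antilinearPart q * star (toComplex v) := by
  have hv : v = v 0 • ![1, 0] + v 1 • ![0, 1] := by
    ext i; fin_cases i <;> simp
  have h1 : star (toComplex v) = v 0 - v 1 * Complex.I := by
    rw [toComplex_apply]; apply Complex.ext <;> simp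
  have h2 : toComplex v = v 0 + v 1 * Complex.I := by
    rw [toComplex_apply]; apply Complex.ext <;> simp
  rw [h1, h2]
  conv_lhs => rw [hv]
  rw [map_add, map_smul, map_smul, Complex.real_smul, Complex.real_smul, linearPart, antilinearPart]
  linear_combination (v 1 * D.complexFrame q ![0, 1]) * Complex.I_mul_I

theorem complexFrame_symm (q : D.Total) (w : ℂ) : D.complexFrame q (toComplex.symm w) =
    D.linearPart q * w + D.antilinearPart q * star w := by
  rw [complexFrame_eq, LinearEquiv.apply_symm_apply]

theorem parts_unique {q : D.Total} {a b : ℂ}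
    (h : ∀ v, D.complexFrame q v = a * toComplex v + b * star (toComplex v)) :
    D.linearPart q = a ∧ D.antilinearPart q = b := by
  have h1 : toComplex ![1, 0] = 1 := by rw [toComplex_apply]; rfl
  have h2 : toComplex ![0, 1] = Complex.I := by rw [toComplex_apply]; rfl
  rw [linearPart, antilinearPart, h, h, h1, h2]
  simp only [RCLike.star_def, Complex.conj_I, map_one]
  constructor
  · linear_combination (b - a) / 2 * Complex.I_mul_I
  · linear_combination (a - b) / 2 * Complex.I_mul_I

theorem parts_spin_smul (q : D.Total) (c : Circle) :
    D.linearPart (op (spin c) • q) = D.linearPart q * c ^ 2 ∧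
    D.antilinearPart (op (spin c) • q) = D.antilinearPart q * star (c : ℂ) ^ 2 := by
  refine D.parts_unique fun v => ?_
  rw [complexFrame_smul, complexFrame_eq, toComplex_rho_spin, star_mul', star_pow]
  ring

theorem parts_incl_e_smul (q : D.Total) :
    D.linearPart (op (incl e) • q) = D.antilinearPart q ∧
    D.antilinearPart (op (incl e) • q) = D.linearPart q := by
  refine D.parts_unique fun v => ?_
  rw [complexFrame_smul, complexFrame_eq, toComplex_rho_incl_e, star_star]
  ring

theorem parts_incl_unit_smul (q : D.Total) (u : ℤˣ) :
    D.linearPart (op (incl (unit u)) • q) = D.linearPart q ∧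
    D.antilinearPart (op (incl (unit u)) • q) = D.antilinearPart q := by
  rcases Int.units_eq_one_or u with rfl | rfl
  · rw [map_one, incl_one, op_one, one_smul]
    exact ⟨rfl, rfl⟩
  · rw [unit_neg_one, incl_mul, op_mul, mul_smul, (D.parts_incl_e_smul _).1,
      (D.parts_incl_e_smul _).2, (D.parts_incl_e_smul _).2, (D.parts_incl_e_smul _).1]
    exact ⟨rfl, rfl⟩

/-- A real linear map `w ↦ a * w + b * star w` with `‖a‖ = ‖b‖` is not injective, whereas a frame
is. Frames in the disc need not be orthonormal, hence the antilinear part. -/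
theorem norm_parts_ne (q : D.Total) : ‖D.linearPart q‖ ≠ ‖D.antilinearPart q‖ := by
  intro h
  have h0 : D.linearPart q * star (D.linearPart q) =
      D.antilinearPart q * star (D.antilinearPart q) := by
    rw [RCLike.star_def, Complex.mul_conj', Complex.mul_conj', h]
  have h1 : ∀ w, D.linearPart q * w + D.antilinearPart q * star w = 0 → w = 0 := fun w hw => by
    rw [← complexFrame_symm] at hw
    simpa using hw
  -- The vectors `star a - b` and `I * (star a + b)` lie in the kernel; if both vanish, then `a = b
  -- = 0`.
  have h2 := h1 (star (D.linearPart q) - D.antilinearPart q) (by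
    rw [star_sub, star_star]
    linear_combination h0)
  have h3 := h1 (Complex.I * (star (D.linearPart q) + D.antilinearPart q)) (by
    rw [star_mul', star_add, star_star, RCLike.star_def, Complex.conj_I, ← RCLike.star_def]
    linear_combination Complex.I * h0)
  have h3 := (mul_eq_zero.1 h3).resolve_left Complex.I_ne_zero
  have h4 : star (D.linearPart q) = 0 := by linear_combination (h2 + h3) / 2
  have h5 : D.antilinearPart q = 0 := by linear_combination (h3 - h2) / 2
  have h6 := h1 1 (by rw [h5, star_eq_zero.1 h4]; simp)
  exact one_ne_zero h6

/-- The points of a pin⁻ disc over which the frame is positively oriented with positive complex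
linear part. -/
def IsNormalized (q : D.Total) : Prop :=
  D.linearPart q = ‖D.linearPart q‖ ∧ ‖D.antilinearPart q‖ < ‖D.linearPart q‖

variable {D}

/-- A rotation `spin c` multiplies the linear part by `c ^ 2`, so positivity forces `c ^ 2 = 1`; the
other component of `Pin⁻₂` swaps which part dominates. -/
theorem IsNormalized.exists_unit {q q' : D.Total} (h : D.IsNormalized q) (h' : D.IsNormalized q')
    (hq : D.proj q = D.proj q') : ∃ u : ℤˣ, q' = op (incl (unit u)) • q := by
  obtain ⟨g, rfl⟩ := D.exists_smul_eq hq
  obtain ⟨c, rfl | rfl⟩ := eq_spin_or g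
  · have h1 := h'.1
    rw [(D.parts_spin_smul q c).1, norm_mul, norm_pow, Circle.norm_coe, one_pow, mul_one, ← h.1]
      at h1
    have h0 : D.linearPart q ≠ 0 := norm_pos_iff.1 ((norm_nonneg _).trans_lt h.2)
    obtain ⟨u, hu⟩ := spin_mem_range_incl ((mul_eq_left₀ h0).1 h1)
    exact ⟨u, by rw [hu]⟩
  · have h2 := h'.2
    rw [op_mul, mul_smul, (D.parts_incl_e_smul _).1, (D.parts_incl_e_smul _).2,
      (D.parts_spin_smul q c).1, (D.parts_spin_smul q c).2, norm_mul, norm_mul, norm_pow, norm_pow,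
      norm_star, Circle.norm_coe, one_pow, mul_one, mul_one] at h2
    exact absurd h2 h.2.not_gt

theorem IsNormalized.incl_unit_smul {q : D.Total} (h : D.IsNormalized q) (u : ℤˣ) :
    D.IsNormalized (op (incl (unit u)) • q) := by
  rw [IsNormalized, (D.parts_incl_unit_smul q u).1, (D.parts_incl_unit_smul q u).2]
  exact h

variable (D)

theorem exists_oriented_local_section (x₀ : Metric.closedBall (0 : ℂ) 1) :
    ∃ U : Set (Metric.closedBall (0 : ℂ) 1), IsOpen U ∧ ∃ hx : x₀ ∈ U, ∃ τ : U → D.Total,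
      Continuous τ ∧ (∀ x, D.proj (τ x) = x) ∧
      ‖D.antilinearPart (τ ⟨x₀, hx⟩)‖ < ‖D.linearPart (τ ⟨x₀, hx⟩)‖ := by
  obtain ⟨U, hU, hx, h, hp, he⟩ := D.locally_trivial x₀
  have hc : ∀ g, Continuous fun x : U => (h (x, g) : D.Total) := fun g =>
    continuous_subtype_val.comp (h.continuous.comp (Continuous.prodMk_left g))
  rcases lt_or_gt_of_ne (D.norm_parts_ne (h (⟨x₀, hx⟩, 1))) with h1 | h1
  · refine ⟨U, hU, hx, fun x => h (x, incl e), hc _, fun x => hp _, ?_⟩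
    have h2 := he ⟨x₀, hx⟩ 1 (incl e)
    rw [one_mul] at h2
    simp only [h2, (D.parts_incl_e_smul _).1, (D.parts_incl_e_smul _).2]
    exact h1
  · exact ⟨U, hU, hx, fun x => h (x, 1), hc _, fun x => hp _, h1⟩

theorem exists_normalized_local_section (x₀ : Metric.closedBall (0 : ℂ) 1) :
    ∃ W : Set (Metric.closedBall (0 : ℂ) 1), IsOpen W ∧ x₀ ∈ W ∧ ∃ τ : W → D.Total,
      Continuous τ ∧ (∀ x, D.proj (τ x) = x) ∧ ∀ x, D.IsNormalized (τ x) := by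
  obtain ⟨U, hU, hx, τ, hτ, hp, h0⟩ := D.exists_oriented_local_section x₀
  have hα := D.continuous_linearPart.comp hτ
  have hβ := D.continuous_antilinearPart.comp hτ
  obtain ⟨V, hV, hxV, c, hc, hc2⟩ := exists_local_circle_sqrt hα ⟨x₀, hx⟩
    (norm_pos_iff.1 ((norm_nonneg _).trans_lt h0))
  have hO : IsOpen (V ∩ {x | ‖D.antilinearPart (τ x)‖ < ‖D.linearPart (τ x)‖}) :=
    hV.inter (isOpen_lt hβ.norm hα.norm)
  have hW : ∀ x : (Subtype.val '' (V ∩ {x | ‖D.antilinearPart (τ x)‖ < ‖D.linearPart (τ x)‖}) :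
      Set (Metric.closedBall (0 : ℂ) 1)), ∃ hx : x.1 ∈ U, (⟨x, hx⟩ : U) ∈ V ∧
        ‖D.antilinearPart (τ ⟨x, hx⟩)‖ < ‖D.linearPart (τ ⟨x, hx⟩)‖ := by
    rintro ⟨_, y, ⟨hy, hy'⟩, rfl⟩
    exact ⟨y.2, hy, hy'⟩
  choose hWU hWV hWn using hW
  -- Here `c ^ 2` is the phase of the linear part, so acting by the inverse of `spin c` makes that
  -- part positive.
  refine ⟨_, hU.isOpenMap_subtype_val _ hO, ⟨_, ⟨hxV, h0⟩, rfl⟩,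
    fun x => op (spin (c ⟨⟨x, hWU x⟩, hWV x⟩)⁻¹) • τ ⟨x, hWU x⟩, ?_, fun x => ?_, fun x => ?_⟩
  · refine D.continuous_smul.comp (Continuous.prodMk (continuous_spin.comp ?_) (hτ.comp (by fun_prop)))
    exact (hc.comp ((continuous_subtype_val.subtype_mk _).subtype_mk _)).inv
  · rw [D.proj_smul, hp]
  · have h1 := hc2 ⟨⟨x, hWU x⟩, hWV x⟩
    have h2 : D.linearPart (op (spin (c ⟨⟨x, hWU x⟩, hWV x⟩)⁻¹) • τ ⟨x, hWU x⟩) =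
        ‖D.linearPart (τ ⟨x, hWU x⟩)‖ := by
      rw [(D.parts_spin_smul _ _).1]
      refine (congrArg (· * _) h1).trans ?_
      rw [mul_assoc, ← mul_pow, ← Circle.coe_mul, mul_inv_cancel, Circle.coe_one, one_pow, mul_one]
      rfl
    rw [IsNormalized, h2, (D.parts_spin_smul _ _).2, norm_mul, norm_pow, norm_star, Circle.norm_coe,
      one_pow, mul_one, Complex.norm_real, norm_norm]
    exact ⟨rfl, hWn x⟩

/-- Normalization reduces the structure group from `Pin⁻₂` to the discrete group `{±1}`, which makes
lifting over the contractible disc available. -/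
theorem isCoveringMap_proj_normalized :
    IsCoveringMap fun q : {q // D.IsNormalized q} => D.proj q := by
  refine isCoveringMap_of_locally_trivial (G := ℤˣ)
    (D.continuous_proj.comp continuous_subtype_val) fun x₀ => ?_
  obtain ⟨W, hW, hx, τ, hτ, hp, hn⟩ := D.exists_normalized_local_section x₀
  have hex : ∀ q : (fun q : {q // D.IsNormalized q} => D.proj q) ⁻¹' W,
      ∃ u : ℤˣ, (q : D.Total) = op (incl (unit u)) • τ ⟨D.proj q, q.2⟩ := fun q =>
    (hn _).exists_unit q.1.2 (hp _)
  choose u hu using hex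
  have hpc : Continuous fun q : (fun q : {q // D.IsNormalized q} => D.proj q) ⁻¹' W =>
      (⟨D.proj q, q.2⟩ : W) :=
    (D.continuous_proj.comp (continuous_subtype_val.comp continuous_subtype_val)).subtype_mk _
  have huc : Continuous u := isEmbedding_incl_unit.continuous_iff.2
    (D.continuous_of_smul_eq (hτ.comp hpc) (continuous_subtype_val.comp continuous_subtype_val) hu)
  have hproj : ∀ p : W × ℤˣ, D.proj (op (incl (unit p.2)) • τ p.1) = p.1 := fun p => by
    rw [D.proj_smul, hp]
  refine ⟨W, hW, hx, ⟨⟨fun p => ⟨⟨op (incl (unit p.2)) • τ p.1, (hn _).incl_unit_smul _⟩, ?_⟩,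
    fun q => (⟨D.proj q, q.2⟩, u q), fun p => ?_, fun q => ?_⟩, ?_, ?_⟩, hproj⟩
  · exact Set.mem_preimage.2 ((hproj p).symm ▸ p.1.2)
  · have h1 : (⟨D.proj (op (incl (unit p.2)) • τ p.1), (hproj p).symm ▸ p.1.2⟩ : W) = p.1 :=
      Subtype.ext (hproj p)
    refine Prod.ext h1 (isEmbedding_incl_unit.injective (D.smul_left_injective (τ p.1) ?_))
    exact ((congrArg (fun y => op _ • τ y) h1).symm.trans (hu _).symm)
  · exact Subtype.ext (Subtype.ext (hu q).symm)
  · refine ((D.continuous_smul.comp (Continuous.prodMk ?_ (hτ.comp continuous_fst))).subtype_mk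
      _).subtype_mk _
    exact isEmbedding_incl_unit.continuous.comp continuous_snd
  · exact hpc.prodMk huc

/-- The radial homotopy `(t, z) ↦ t * z` starts at the constant map to the centre; it lifts to the
double covering of normalized points, and its end `t = 1` is the section over the boundary. -/
theorem exists_normalized_section : ∃ ψ : Circle → D.Total, Continuous ψ ∧
    (∀ z, (D.proj (ψ z) : ℂ) = z) ∧ ∀ z, D.IsNormalized (ψ z) := by
  obtain ⟨W, -, hx, τ, -, hp, hn⟩ := D.exists_normalized_local_section ⟨0, by simp⟩
  have hmem : ∀ p : unitInterval × Circle, ((p.1 : ℝ) : ℂ) * p.2 ∈ Metric.closedBall (0 : ℂ) 1 :=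
    fun p => by
      rw [mem_closedBall_zero_iff, norm_mul, Circle.norm_coe, mul_one, Complex.norm_real,
        Real.norm_of_nonneg p.1.2.1]
      exact p.1.2.2
  let H : C(unitInterval × Circle, Metric.closedBall (0 : ℂ) 1) :=
    ⟨fun p => ⟨_, hmem p⟩, Continuous.subtype_mk (by
      exact (Complex.continuous_ofReal.comp (continuous_subtype_val.comp continuous_fst)).mul
        (continuous_circle_coe.comp continuous_snd)) _⟩
  have hH : ∀ z, H (0, z) = D.proj (τ ⟨_, hx⟩) := fun z => by
    refine Eq.trans (Subtype.ext ?_) (hp ⟨_, hx⟩).symm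
    simp [H]
  let L := D.isCoveringMap_proj_normalized.liftHomotopy H
    (ContinuousMap.const _ ⟨τ ⟨_, hx⟩, hn _⟩) hH
  refine ⟨fun z => (L (1, z)).1, ?_, fun z => ?_, fun z => (L (1, z)).2⟩
  · exact continuous_subtype_val.comp (L.continuous.comp (Continuous.prodMk_right _))
  · have h := congrArg Subtype.val (congrFun (D.isCoveringMap_proj_normalized.liftHomotopy_lifts H
      (ContinuousMap.const _ ⟨τ ⟨_, hx⟩, hn _⟩) hH) (1, z))
    refine h.trans ?_
    simp [H]

end PinMinusStructure

theorem Complex.continuous_sqrt_of_re_pos {A : Type*} [TopologicalSpace A] {a : A → ℂ}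
    (ha : Continuous a) (h : ∀ x, 0 < (a x).re) :
    ∃ b : A → ℂ, Continuous b ∧ ∀ x, b x ^ 2 = a x := by
  refine ⟨fun x => Complex.exp (Complex.log (a x) / 2), ?_, fun x => ?_⟩
  · exact Complex.continuous_exp.comp ((ha.clog fun x => Or.inl (h x)).div_const _)
  · have h0 : a x ≠ 0 := fun h0 => by simpa [h0] using h x
    rw [← Complex.exp_nat_mul, Nat.cast_ofNat, mul_div_cancel₀ _ two_ne_zero, Complex.exp_log h0]

open PinMinusStructure in
-- Compare the section with the normalized section `ψ` through `g : Circle → Pin⁻₂`. The first frame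
-- vector `w` lies within a right angle of both `z` and `firstVector (g z)`, so these two differ by
-- a factor with a continuous square root. As `firstVector (g z)` is a square, so is `z`.
theorem IsBoundaryOfDisc.not_hasSection {C : PinMinus1 (𝓡 1) Circle} {D : PinMinusDisc}
    (h : IsBoundaryOfDisc C D) : ¬ C.HasSection := by
  rintro ⟨σ, hσ, hσp⟩
  obtain ⟨j, hj, hjp, -, hjf⟩ := h
  obtain ⟨ψ, hψ, hψp, hψn⟩ := D.exists_normalized_section
  have hproj : ∀ z, D.proj (ψ z) = D.proj (j (σ z)) := fun z =>
    Subtype.ext (by rw [hψp, hjp, hσp])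
  choose g hg using fun z => D.exists_smul_eq (hproj z)
  have hgc : Continuous g := D.continuous_of_smul_eq hψ (hj.comp hσ) hg
  have hc : ∀ c : Circle, (c : ℂ) * star (c : ℂ) = 1 := fun c => by
    rw [RCLike.star_def, Complex.mul_conj', Circle.norm_coe]
    simp
  let w : Circle → ℂ := fun z => D.complexFrame (j (σ z)) ![1, 0]
  have hw : Continuous w := (D.continuous_complexFrame _).comp (hj.comp hσ)
  have hw1 : ∀ z : Circle, 0 < (w z * star (z : ℂ)).re := fun z => by
    have h1 : 0 < inner ℝ (C.proj (σ z) : ℂ) (w z) := (hjf (σ z)).1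
    rwa [hσp, Complex.inner] at h1
  have hw2 : ∀ z, 0 < (w z * star (firstVector (g z) : ℂ)).re := fun z => by
    have h1 : w z = D.linearPart (ψ z) * firstVector (g z) +
        D.antilinearPart (ψ z) * star (firstVector (g z) : ℂ) := by
      change D.complexFrame (j (σ z)) ![1, 0] = _
      rw [hg, complexFrame_smul, complexFrame_eq, coe_firstVector]
    -- The dominating positive linear part keeps the real part positive.
    have h2 : w z * star (firstVector (g z) : ℂ) = ‖D.linearPart (ψ z)‖ +
        D.antilinearPart (ψ z) * star (firstVector (g z) : ℂ) ^ 2 := by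
      rw [h1, ← (hψn z).1]
      linear_combination D.linearPart (ψ z) * hc (firstVector (g z))
    have h3 := Complex.abs_re_le_norm (D.antilinearPart (ψ z) * star (firstVector (g z) : ℂ) ^ 2)
    rw [norm_mul, norm_pow, norm_star, Circle.norm_coe, one_pow, mul_one] at h3
    rw [h2, Complex.add_re, Complex.ofReal_re]
    linarith [(abs_le.1 h3).1, (hψn z).2]
  obtain ⟨a, ha, ha2⟩ := Complex.continuous_sqrt_of_re_pos
    (a := fun z => w z * star (z : ℂ)) (hw.mul (continuous_star.comp continuous_circle_coe)) hw1
  obtain ⟨b, hb, hb2⟩ := Complex.continuous_sqrt_of_re_pos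
    (a := fun z => w z * star (firstVector (g z) : ℂ))
    (hw.mul (continuous_star.comp (continuous_circle_coe.comp (continuous_firstVector.comp hgc))))
    hw2
  have ha0 : ∀ z, a z ≠ 0 := fun z h0 => by
    have := hw1 z
    rw [← ha2, h0] at this
    simp at this
  -- Since `a ^ 2 = w * star z` and `b ^ 2 = w * star f` with `f = firstVector (g z)`, multiplying
  -- by the unit numbers `z` and `f` gives `z * a ^ 2 = w = f * b ^ 2`.
  refine Circle.not_exists_continuous_sqrt
    (k := fun z => sqrtFirstVector (g z) * b z / a z) ?_ fun z => ?_
  · exact ((continuous_sqrtFirstVector.comp hgc).mul hb).div ha ha0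
  · rw [div_pow, mul_pow, sqrtFirstVector_sq, hb2, div_eq_iff (pow_ne_zero 2 (ha0 z)), ha2]
    linear_combination w z * hc (firstVector (g z)) - w z * hc z

/-! ### Classification of pin⁻ circles -/

/-- The pin⁻ structure on the circle given by the Lie group framing. -/
def lieFramedCircle : PinMinus1 (𝓡 1) Circle :=
  .ofFraming Circle.field Circle.continuous_field Circle.field_ne_zero

theorem isLieFramed_lieFramedCircle : IsLieFramed lieFramedCircle := by
  refine ⟨Circle.exists_lieAlgebra_eq_I.choose, fun h => ?_, fun z => (z, (1 : PinMinus 1)),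
    continuous_id.prodMk continuous_const, fun z => ?_⟩
  · have := Circle.exists_lieAlgebra_eq_I.choose_spec
    rw [h, map_zero] at this
    exact Complex.I_ne_zero this.symm
  · refine (PinMinusStructure.tangent_ofFraming _ _ _ _).trans (congrArg (TotalSpace.mk z) ?_)
    rw [PinMinus.sign_one, one_smul]
    rfl

theorem IsLieFramed.hasSection {C : PinMinus1 (𝓡 1) Circle} (h : IsLieFramed C) :
    C.HasSection := by
  obtain ⟨v, -, s, hs, hv⟩ := h
  exact ⟨s, hs, fun z => congrArg TotalSpace.proj (hv z)⟩

namespace PinMinusStructure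

section

variable {H M : Type} [TopologicalSpace H] [TopologicalSpace M]
  {I : ModelWithCorners ℝ (EuclideanSpace ℝ (Fin 1)) H} [ChartedSpace H M] [IsManifold I 1 M]

/-- The loop returns with its initial velocity, so the two ends of a forward lift have the same
direction and differ by a sign. -/
theorem exists_lift_of_loop [T2Space M] (P : PinMinus1 I M) {γ : unitInterval → M}
    (hγ : IsImmersedPath I γ) (hloop : IsSimpleLoop γ)
    (hcl : pathVelocity I γ 1 = pathVelocity I γ 0) :
    ∃ (s : unitInterval → P.Total) (u : ℤˣ), Continuous s ∧ (∀ x, P.proj (s x) = γ x) ∧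
      SameDirection (pathVelocity I γ 0) (P.tangent (s 0)) ∧
      s 0 = op (PinMinus.unit u) • s 1 ∧ (P.HasSection ↔ u = 1) := by
  obtain ⟨a, ha⟩ := P.exists_sameDirection_tangent (hγ.velocity_ne_zero 0)
  obtain ⟨s, hs, hp, h0⟩ := P.exists_lift hγ.continuous (a := a) ha.proj_eq
  rw [← h0] at ha
  have h1 := P.sameDirection_lift hγ hs hp ha 1
  rw [hcl] at h1
  obtain ⟨u, hu⟩ := P.exists_unit_smul_eq h1 ha
  exact ⟨s, u, hs, hp, ha, hu, hasSection_iff_of_loop hγ.continuous hloop hs hp hu⟩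

end

theorem _root_.Int.units_eq_of_eq_one_iff {u v : ℤˣ} (h : u = 1 ↔ v = 1) : u = v := by
  rcases Int.units_eq_one_or u with rfl | rfl
  · exact (h.1 rfl).symm
  · rcases Int.units_eq_one_or v with rfl | rfl
    · exact h.2 rfl
    · rfl

variable {M : Type} [TopologicalSpace M] [ChartedSpace (EuclideanSpace ℝ (Fin 1)) M]
  [IsManifold (𝓡 1) 1 M]

/-- The standard loop and its pullback by `f` have holonomy signs detected by sections. Equal signs
give a pin⁻ diffeomorphism covering `f`. -/
theorem pinDiffeomorphic_of_hasSection_iff (f : M ≃ₘ⟮𝓡 1, 𝓡 1⟯ Circle) {P : PinMinus1 (𝓡 1) M}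
    {C : PinMinus1 (𝓡 1) Circle} (h : P.HasSection ↔ C.HasSection) : P.PinDiffeomorphic C := by
  have hT2 : T2Space M := f.toHomeomorph.symm.t2Space
  let γ : unitInterval → M := f.symm ∘ circlePath
  have hf : f ∘ γ = circlePath := funext fun x => f.apply_symm_apply _
  have hvel : ∀ x, pathVelocity (𝓡 1) γ x =
      tangentMap (𝓡 1) (𝓡 1) f.symm (pathVelocity (𝓡 1) circlePath x) :=
    pathVelocity_comp (f.symm.mdifferentiable (by simp))
      (isImmersedPath_circlePath.contMDiff.mdifferentiable one_ne_zero)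
  have hγC : ContMDiff (𝓡∂ 1) (𝓡 1) 1 γ :=
    (f.symm.contMDiff.of_le (by simp)).comp isImmersedPath_circlePath.contMDiff
  have hγ : IsImmersedPath (𝓡 1) γ := by
    refine ⟨hγC, fun x h0 => isImmersedPath_circlePath.velocity_ne_zero x ?_⟩
    have := pathVelocity_comp (I' := 𝓡 1) (f := f) (f.mdifferentiable (by simp))
      (hγC.mdifferentiable one_ne_zero) x
    rw [hf] at this
    rw [this]
    exact (congrArg (mfderiv (𝓡 1) (𝓡 1) f (γ x)) h0).trans (map_zero _)
  have hloop : IsSimpleLoop γ :=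
    ⟨f.symm.surjective.comp isSimpleLoop_circlePath.1, fun x y =>
      f.symm.injective.eq_iff.trans (isSimpleLoop_circlePath.2 x y)⟩
  obtain ⟨s, u, hs, hp, hdir, hu, hsec⟩ := P.exists_lift_of_loop hγ hloop
    (by rw [hvel, hvel, pathVelocity_circlePath_one])
  obtain ⟨s', u', hs', hp', hdir', hu', hsec'⟩ := C.exists_lift_of_loop isImmersedPath_circlePath
    isSimpleLoop_circlePath pathVelocity_circlePath_one
  obtain rfl : u = u' := Int.units_eq_of_eq_one_iff (hsec.symm.trans (h.trans hsec'))
  exact pinDiffeomorphic_of_loop f hf hγ isImmersedPath_circlePath hloop isSimpleLoop_circlePath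
    hs hs' hp hp' hdir hdir' hu hu'

theorem isNonboundingCircle_iff (f : M ≃ₘ⟮𝓡 1, 𝓡 1⟯ Circle) {P : PinMinus1 (𝓡 1) M} :
    P.IsNonboundingCircle ↔ P.HasSection := by
  constructor
  · rintro ⟨C, hC, h⟩
    exact h.hasSection.2 hC.hasSection
  · intro h
    exact ⟨lieFramedCircle, isLieFramed_lieFramedCircle, pinDiffeomorphic_of_hasSection_iff f
      (iff_of_true h isLieFramed_lieFramedCircle.hasSection)⟩

theorem isBoundingCircle_iff (f : M ≃ₘ⟮𝓡 1, 𝓡 1⟯ Circle) {P : PinMinus1 (𝓡 1) M} :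
    P.IsBoundingCircle ↔ ¬ P.HasSection := by
  constructor
  · rintro ⟨C, D, hC, h⟩
    rw [h.hasSection]
    exact hC.not_hasSection
  · intro h
    obtain ⟨C, D, hC⟩ := exists_isBoundaryOfDisc
    exact ⟨C, D, hC, pinDiffeomorphic_of_hasSection_iff f (iff_of_false h hC.not_hasSection)⟩

end PinMinusStructure

/-! ### Closing up an interval -/

namespace RelPinInterval

open PinMinusStructure

/-- Gluing identifies the left end with the right end, so the holonomy of the circle is the sign of
the interval. -/
theorem ClosesUpTo.hasSection_iff {r : RelPinInterval} {C : PinMinus1 (𝓡 1) Circle}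
    (h : r.ClosesUpTo C) : C.HasSection ↔ r.sgn = 1 := by
  obtain ⟨j, hj, hjr⟩ := h
  have hj' : r.pin.IsPinMap C circlePath j := hj
  obtain ⟨s, hs, hp, h0⟩ := C.exists_lift isImmersedPath_circlePath.continuous (a := j r.left)
    (by rw [hj'.proj, ← r.path_zero, r.proj_path])
  refine hasSection_iff_of_loop isImmersedPath_circlePath.continuous isSimpleLoop_circlePath hs hp ?_
  rw [h0, hjr]
  exact r.apply_right_of_isPinMap hj' hs hp h0

/-- Conversely, a pin⁻ map along the standard loop always exists, and equality of holonomy and sign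
makes it identify the two ends. -/
theorem closesUpTo_of_hasSection_iff {r : RelPinInterval} {C : PinMinus1 (𝓡 1) Circle}
    (h : C.HasSection ↔ r.sgn = 1) : r.ClosesUpTo C := by
  obtain ⟨s, u, hs, hp, hdir, hu, hsec⟩ := C.exists_lift_of_loop isImmersedPath_circlePath
    isSimpleLoop_circlePath pathVelocity_circlePath_one
  obtain rfl : u = r.sgn := Int.units_eq_of_eq_one_iff (hsec.symm.trans h)
  obtain ⟨j, hj, hjl⟩ := r.exists_isPinMap C isImmersedPath_circlePath hdir
  refine ⟨j, hj, ?_⟩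
  rw [r.apply_right_of_isPinMap hj hs hp hjl.symm, hjl, hu]

theorem isI0_iff (r : RelPinInterval) : r.IsI0 ↔ r.sgn = 1 := by
  constructor
  · rintro ⟨C, hC, h⟩
    exact hC.hasSection_iff.1 ((isNonboundingCircle_iff (Diffeomorph.refl _ _ _)).1 h)
  · intro h
    have hs := isLieFramed_lieFramedCircle.hasSection
    exact ⟨lieFramedCircle, closesUpTo_of_hasSection_iff (iff_of_true hs h),
      (isNonboundingCircle_iff (Diffeomorph.refl _ _ _)).2 hs⟩

theorem isI1_iff (r : RelPinInterval) : r.IsI1 ↔ r.sgn = -1 := by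
  constructor
  · rintro ⟨C, hC, h⟩
    have := mt hC.hasSection_iff.2 ((isBoundingCircle_iff (Diffeomorph.refl _ _ _)).1 h)
    exact (Int.units_eq_one_or _).resolve_left this
  · intro h
    obtain ⟨C, D, hC⟩ := exists_isBoundaryOfDisc
    exact ⟨C, closesUpTo_of_hasSection_iff (iff_of_false hC.not_hasSection (by rw [h]; decide)),
      (isBoundingCircle_iff (Diffeomorph.refl _ _ _)).2 hC.not_hasSection⟩

end RelPinInterval

/-- The isomorphism of `{±1}` with `ℤ/2`. -/
def unitsEquivZMod : ℤˣ ≃* Multiplicative (ZMod 2) where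
  toFun u := if u = 1 then .ofAdd 0 else .ofAdd 1
  invFun t := if t = .ofAdd 0 then 1 else -1
  left_inv := by decide
  right_inv := by decide
  map_mul' := by decide

theorem unitsEquivZMod_eq_zero_iff (u : ℤˣ) :
    unitsEquivZMod u = Multiplicative.ofAdd 0 ↔ u = 1 := by
  revert u; decide

theorem unitsEquivZMod_eq_one_iff (u : ℤˣ) :
    unitsEquivZMod u = Multiplicative.ofAdd 1 ↔ u = -1 := by
  revert u; decide

/-! ### Triangulated circles -/

theorem CircleTriangulation.isImmersedPath {M : Type} [TopologicalSpace M]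
    [ChartedSpace (EuclideanSpace ℝ (Fin 1)) M] {n : ℕ} [NeZero n] (T : CircleTriangulation M n)
    (i : Fin n) :
    IsImmersedPath (𝓡 1) (T.edge i) :=
  ⟨(T.smooth i).of_le (by simp), T.velocity_ne_zero i⟩

section Triangulation

variable {M : Type} [TopologicalSpace M] [ChartedSpace (EuclideanSpace ℝ (Fin 1)) M]
  [IsManifold (𝓡 1) 1 M] {P : PinMinus1 (𝓡 1) M} {n : ℕ} [NeZero n] {T : CircleTriangulation M n}

/-- The signs of the edges and their product. -/
theorem exists_edge_signs [T2Space M] (s : VertexTrivialization P T) :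
    ∃ u : Fin n → ℤˣ, (P.HasSection ↔ ∏ i, u i = 1) ∧
      (∀ i r, RelPinInterval.IsRestriction r P (T.edge i) (s.pt i) (s.pt (i + 1)) →
        r.sgn = u i) ∧
      ∀ i, RelPinInterval.IsRestriction (RelPinInterval.ofSgn (u i)) P (T.edge i) (s.pt i)
        (s.pt (i + 1)) := by
  choose l hl hlp hl0 using fun i =>
    P.exists_lift (T.isImmersedPath i).continuous (a := s.pt i) (s.pt_dir i).proj_eq
  have hdir : ∀ i, SameDirection (pathVelocity (𝓡 1) (T.edge i) 1) (P.tangent (l i 1)) := fun i =>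
    P.sameDirection_lift (T.isImmersedPath i) (hl i) (hlp i) (by rw [hl0]; exact s.pt_dir i) 1
  -- At a vertex the incoming and outgoing edges have the same direction, so the transported point
  -- and the chosen point differ by a sign.
  choose u hu using fun i =>
    P.exists_unit_smul_eq (hdir i) ((T.coherent i).trans (s.pt_dir (i + 1)))
  have hu' : ∀ i, l (i + 1) 0 = op (PinMinus.unit (u i)) • l i 1 := fun i => by rw [hl0, hu]
  refine ⟨u, ⟨fun h => ?_, fun h => ?_⟩, ?_, fun i => ?_⟩
  · exact PinMinusStructure.prod_eq_one_of_hasSection h (fun i => (T.isImmersedPath i).continuous)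
      T.edge_one hl hlp hu'
  · exact PinMinusStructure.hasSection_of_prod_eq_one (fun i => (T.isImmersedPath i).continuous)
      T.edge_one T.existsUnique hl hlp hu' h
  · rintro i r ⟨j, hj, hjl, hjr⟩
    have h := r.apply_right_of_isPinMap hj (hl i) (hlp i) (by rw [hl0, hjl])
    rw [hjr, hu] at h
    exact (PinMinus.unit_injective (P.smul_left_injective _ h)).symm
  · obtain ⟨j, hj, hjl⟩ := (RelPinInterval.ofSgn (u i)).exists_isPinMap P (T.isImmersedPath i)
      (s.pt_dir i)
    refine ⟨j, hj, hjl, ?_⟩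
    rw [(RelPinInterval.ofSgn (u i)).apply_right_of_isPinMap hj (hl i) (hlp i) (by rw [hl0, hjl]),
      RelPinInterval.sgn_ofSgn, hu]

/-- All restrictions to an edge have the same sign, so the choice of `r` is immaterial and `t` is
the edge sign written additively. -/
theorem isCombinatorialPinData_iff [T2Space M] (s : VertexTrivialization P T) :
    ∃ u : Fin n → ℤˣ, (P.HasSection ↔ ∏ i, u i = 1) ∧
      ∀ t, IsCombinatorialPinData P T s t ↔ ∀ i, u i = if t i = 1 then -1 else 1 := by
  obtain ⟨u, hP, hr, hex⟩ := exists_edge_signs s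
  have hz : ∀ a : ZMod 2, a = 0 ∨ a = 1 := by decide
  refine ⟨u, hP, fun t => ⟨fun ht i => ?_, fun ht i => ?_⟩⟩
  · obtain ⟨r, hri, h0, h1⟩ := ht i
    rw [← hr i r hri]
    rcases hz (t i) with h | h
    · rw [h, if_neg (by decide)]
      exact r.isI0_iff.1 (h0 h)
    · rw [h, if_pos rfl]
      exact r.isI1_iff.1 (h1 h)
  · refine ⟨_, hex i, fun h => ?_, fun h => ?_⟩
    · rw [RelPinInterval.isI0_iff, RelPinInterval.sgn_ofSgn, ht, h, if_neg (by decide)]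
    · rw [RelPinInterval.isI1_iff, RelPinInterval.sgn_ofSgn, ht, h, if_pos rfl]

end Triangulation

end
-- The main theorem
theorem mainTheorem8 :
    (∃ _group : Group RelPinInterval.Classes,
      (∀ r₁ r₂ : RelPinInterval, ∃ r, RelPinInterval.IsConcatenation r₁ r₂ r) ∧
      (∀ r₁ r₂ r : RelPinInterval, RelPinInterval.IsConcatenation r₁ r₂ r →
        (⟦r₁⟧ * ⟦r₂⟧ : RelPinInterval.Classes) = ⟦r⟧) ∧
      ∃ φ : RelPinInterval.Classes ≃* Multiplicative (ZMod 2),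
        ∀ r : RelPinInterval,
          (φ ⟦r⟧ = Multiplicative.ofAdd 0 ↔ r.IsI0) ∧
          (φ ⟦r⟧ = Multiplicative.ofAdd 1 ↔ r.IsI1)) ∧
    (∀ (M : Type) [TopologicalSpace M] [ChartedSpace (EuclideanSpace ℝ (Fin 1)) M]
      [IsManifold (𝓡 1) ∞ M]
      (_circle : Nonempty (M ≃ₘ⟮𝓡 1, 𝓡 1⟯ Circle))
      (P : PinMinus1 (𝓡 1) M) (n : ℕ) [NeZero n]
      (T : CircleTriangulation M n) (s : VertexTrivialization P T),
      ¬ (P.IsBoundingCircle ∧ P.IsNonboundingCircle) ∧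
      (∃! t : Fin n → ZMod 2, IsCombinatorialPinData P T s t) ∧
      ∀ t : Fin n → ZMod 2, IsCombinatorialPinData P T s t →
        (Odd (Finset.univ.filter fun i => t i = 1).card → P.IsBoundingCircle) ∧
        (Even (Finset.univ.filter fun i => t i = 1).card → P.IsNonboundingCircle)) := by
  constructor
  · refine ⟨RelPinInterval.classesEquiv.group, RelPinInterval.exists_isConcatenation,
      fun r₁ r₂ r h => ?_, ?_⟩
    · apply RelPinInterval.classesEquiv.injective
      -- The group law is transported from `{±1}`, so this is the multiplicativity of signs.
      refine (RelPinInterval.classesEquiv.apply_symm_apply _).trans ?_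
      exact h.sgn_eq.symm
    · let := RelPinInterval.classesEquiv.group
      refine ⟨RelPinInterval.classesEquiv.mulEquiv.trans unitsEquivZMod, fun r => ⟨?_, ?_⟩⟩
      · rw [r.isI0_iff]
        exact unitsEquivZMod_eq_zero_iff r.sgn
      · rw [r.isI1_iff]
        exact unitsEquivZMod_eq_one_iff r.sgn
  · rintro M _ _ _ ⟨f⟩ P n _ T s
    have hT2 : T2Space M := f.toHomeomorph.symm.t2Space
    obtain ⟨u, hP, hdata⟩ := isCombinatorialPinData_iff s
    refine ⟨?_, ?_, fun t ht => ?_⟩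
    · rw [PinMinusStructure.isBoundingCircle_iff f, PinMinusStructure.isNonboundingCircle_iff f]
      exact fun h => h.1 h.2
    · refine ⟨fun i => if u i = 1 then 0 else 1, (hdata _).2 fun i => ?_, fun t ht => ?_⟩
      · rcases Int.units_eq_one_or (u i) with h | h <;> simp [h]
      · funext i
        have h := (hdata t).1 ht i
        have hz : ∀ a : ZMod 2, a = 0 ∨ a = 1 := by decide
        rcases hz (t i) with h' | h' <;> simp [h, h']
    · rw [PinMinusStructure.isBoundingCircle_iff f, PinMinusStructure.isNonboundingCircle_iff f, hP]
      -- Each edge with `t i = 1` contributes `-1`, so a section exists precisely when the number of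
      -- such edges is even.
      have hu : ∏ i, u i = (-1) ^ (Finset.univ.filter fun i => t i = 1).card := by
        rw [Finset.prod_congr rfl fun i _ => (hdata t).1 ht i, Finset.prod_ite]
        simp
      rw [hu]
      refine ⟨fun h => ?_, fun h => h.neg_one_pow⟩
      rw [h.neg_one_pow]
      decide
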